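/- Let $H(\mathbb D)$ be the space of functions holomorphic in the unit disk $\mathbb D$, write $f(z)=\sum_{n\ge 0}\hat f(n)z^n$ for $f\in H(\mathbb D)$, and let $dA$ be Lebesgue measure on $\mathbb D$ normalized so that $\mathbb D$ has area $1$. For a positive continuous function $w$ on $[0,1)$ let - $\mathfrak B_w$ be the space of all $f\in H(\mathbb D)$ with $|f'(z)|=\mathcal O\big((1-|z|)^{-1}w(|z|)\big)$ on $\mathbb D$, with the norm $\|f\|_{\mathfrak B_w}=|f(0)|+\sup_{z\in\mathbb D}(1-|z|)\,w(|z|)^{-1}|f'(z)|$; - $\mathfrak b_w$ be the subspace of those $f\in\mathfrak B_w$ with $|f'(z)|=o\big((1-|z|)^{-1}w(|z|)\big)$ as $|z|\uparrow1$, with the same norm; - $\mathfrak B^1_w$ be the space of all $f\in H(\mathbb D)$ with $\|f\|_{\mathfrak B^1_w}=|f(0)|+\int_{\mathbb D}|f'(z)|\,w(|z|)\,dA(z)<\infty$. For $w(r)=\log^\alpha\frac{2}{1-r}$, $\alpha\in\mathbb R$, these spaces are denoted $\mathfrak B_{\log^\alpha},\mathfrak b_{\log^\alpha},\mathfrak B^1_{\log^\alpha}$;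 for $w(r)=\log\log\frac{4}{1-r}$ they are denoted $\mathfrak B_{\mathrm{logg}},\mathfrak b_{\mathrm{logg}},\mathfrak B^1_{\mathrm{logg}}$. Consider the bilinear pairing $$\langle f,g\rangle=\lim_{r\uparrow1}\sum_{n=0}^\infty\hat f(n)\hat g(n)r^{2n}.$$ We say that the dual of $X$ is isomorphic to $Y$ under this pairing if for all $f\in X$ and $g\in Y$ the limit $\langle f,g\rangle$ exists, and $g\mapsto\Phi_g$, $\Phi_g(f)=\langle f,g\rangle$, is a linear bijection of $Y$ onto the space $X^*$ of bounded linear functionals on $X$ such that, for some constant $C>0$ and all $g\in Y$, $\|g\|_Y/C\le\|\Phi_g\|\le C\|g\|_Y$. **Theorem.** Let $\alpha\in\mathbb R$. Then, under this pairing, the dual of $\mathfrak b_{\log^\alpha}$ is isomorphic to $\mathfrak B^1_{\log^\alpha}$, and the dual of $\mathfrak B^1_{\log^\alpha}$ is isomorphic to $\mathfrak B_{\log^\alpha}$. Likewise, under the same pairing, the dual of $\mathfrak b_{\mathrm{logg}}$ is isomorphic to $\mathfrak B^1_{\mathrm{logg}}$, and the dual of $\mathfrak B^1_{\mathrm{logg}}$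 is isomorphic to $\mathfrak B_{\mathrm{logg}}$. -/

import Mathlib

open Set Filter Topology MeasureTheory Asymptotics

noncomputable section

namespace LogBloch

/-- The open unit disk of the complex plane. -/
def disk : Set ℂ := Metric.ball 0 1

/-- `H(𝔻)`: the holomorphic functions on the unit disk. A function on the disk is represented by
its extension by zero to the whole plane, so that equality in this space is equality on the
disk. -/
def Hol : Submodule ℂ (ℂ → ℂ) where
  carrier := {f | DifferentiableOn ℂ f disk ∧ ∀ z ∉ disk, f z = 0}
  add_mem' := fun {f g} hf hg =>
    ⟨hf.1.add hg.1, fun z hz => by simp [hf.2 z hz, hg.2 z hz]⟩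
  zero_mem' := ⟨differentiableOn_const 0, fun _ _ => rfl⟩
  smul_mem' := fun c f hf => ⟨hf.1.const_smul c, fun z hz => by simp [hf.2 z hz]⟩

/-- The `n`-th Taylor coefficient of `f` at the origin. -/
def coeff (f : ℂ → ℂ) (n : ℕ) : ℂ := iteratedDeriv n f 0 / (n.factorial : ℂ)

/-- `⟨f, g⟩ = L` in the sense of the Abel pairing: the power series
`∑ f̂(n) ĝ(n) r ^ (2 n)` converges for `0 < r < 1`, and its sum tends to `L` as `r ↑ 1`. -/
def HasPairing (f g : ℂ → ℂ) (L : ℂ) : Prop :=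
  (∀ r ∈ Ioo (0 : ℝ) 1, Summable fun n : ℕ => coeff f n * coeff g n * (r : ℂ) ^ (2 * n)) ∧
  Tendsto (fun r : ℝ => ∑' n : ℕ, coeff f n * coeff g n * (r : ℂ) ^ (2 * n)) (𝓝[<] 1) (𝓝 L)

/-- A positive continuous radial weight on the disk, as a function of `r = |z| ∈ [0, 1)`. -/
structure Weight where
  toFun : ℝ → ℝ
  pos : ∀ r ∈ Ico (0 : ℝ) 1, 0 < toFun r
  cont : ContinuousOn toFun (Ico (0 : ℝ) 1)

theorem le_div_one_sub {r : ℝ} (hr : r ∈ Ico (0 : ℝ) 1) {a : ℝ} (ha : 0 ≤ a) : a ≤ a / (1 - r) := by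
  have h1 : 0 < 1 - r := by linarith [hr.2]
  rw [le_div_iff₀ h1]
  nlinarith [hr.1]

theorem continuousOn_div_one_sub (a : ℝ) :
    ContinuousOn (fun r : ℝ => a / (1 - r)) (Ico (0 : ℝ) 1) := by
  refine continuousOn_const.div (by fun_prop) fun r hr => ?_
  linarith [hr.2]

theorem log_two_div_pos {r : ℝ} (hr : r ∈ Ico (0 : ℝ) 1) : 0 < Real.log (2 / (1 - r)) :=
  Real.log_pos (by linarith [le_div_one_sub hr (a := 2) (by norm_num)])

theorem one_lt_log_four_div {r : ℝ} (hr : r ∈ Ico (0 : ℝ) 1) :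
    1 < Real.log (4 / (1 - r)) := by
  have h4 := le_div_one_sub hr (a := 4) (by norm_num)
  rw [Real.lt_log_iff_exp_lt (by linarith)]
  linarith [Real.exp_one_lt_d9]

/-- The weight `log ^ α (2 / (1 - r))`. -/
def logWeight (α : ℝ) : Weight where
  toFun r := Real.log (2 / (1 - r)) ^ α
  pos _ hr := Real.rpow_pos_of_pos (log_two_div_pos hr) α
  cont := by
    refine ContinuousOn.rpow_const ?_ fun r hr => Or.inl (log_two_div_pos hr).ne'
    refine (continuousOn_div_one_sub 2).log fun r hr => ?_
    linarith [le_div_one_sub hr (a := 2) (by norm_num)]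

/-- The weight `log log (4 / (1 - r))`. -/
def loglogWeight : Weight where
  toFun r := Real.log (Real.log (4 / (1 - r)))
  pos _ hr := Real.log_pos (one_lt_log_four_div hr)
  cont := by
    refine ContinuousOn.log ?_ fun r hr => by linarith [one_lt_log_four_div hr]
    refine (continuousOn_div_one_sub 4).log fun r hr => ?_
    linarith [le_div_one_sub hr (a := 4) (by norm_num)]

theorem isOpen_disk : IsOpen disk := Metric.isOpen_ball

theorem norm_mem_Ico {z : ℂ} (hz : z ∈ disk) : ‖z‖ ∈ Ico (0 : ℝ) 1 :=
  ⟨norm_nonneg z, by simpa [disk] using hz⟩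

theorem Hol.differentiableAt {f : ℂ → ℂ} (hf : f ∈ Hol) {z : ℂ} (hz : z ∈ disk) :
    DifferentiableAt ℂ f z := hf.1.differentiableAt (isOpen_disk.mem_nhds hz)

theorem Hol.deriv_add {f g : ℂ → ℂ} (hf : f ∈ Hol) (hg : g ∈ Hol) {z : ℂ} (hz : z ∈ disk) :
    deriv (f + g) z = deriv f z + deriv g z :=
  _root_.deriv_add (Hol.differentiableAt hf hz) (Hol.differentiableAt hg hz)

theorem Hol.deriv_smul {f : ℂ → ℂ} (c : ℂ) (hf : f ∈ Hol) {z : ℂ} (hz : z ∈ disk) :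
    deriv (c • f) z = c * deriv f z := by
  rw [deriv_const_smul c (Hol.differentiableAt hf hz), smul_eq_mul]

theorem Hol.eq_zero {f : ℂ → ℂ} (hf : f ∈ Hol) (h0 : f 0 = 0)
    (hd : ∀ z ∈ disk, deriv f z = 0) : f = 0 := by
  funext z
  by_cases hz : z ∈ disk
  · have h := isOpen_disk.is_const_of_deriv_eq_zero (convex_ball (0 : ℂ) 1).isPreconnected
      hf.1 (fun x hx => hd x hx) hz (show (0 : ℂ) ∈ disk by simp [disk])
    simpa [h0] using h
  · exact hf.2 z hz

theorem Hol.continuousOn_deriv {f : ℂ → ℂ} (hf : f ∈ Hol) : ContinuousOn (deriv f) disk :=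
  (hf.1.deriv isOpen_disk).continuousOn

/-! ### The Bloch-type spaces -/

/-- The comparison function `(1 - |z|)⁻¹ w(|z|)`. -/
def majorant (w : Weight) (z : ℂ) : ℝ := (1 - ‖z‖)⁻¹ * w.toFun ‖z‖

theorem majorant_pos (w : Weight) {z : ℂ} (hz : z ∈ disk) : 0 < majorant w z := by
  have h := norm_mem_Ico hz
  exact mul_pos (inv_pos.2 (by linarith [h.2])) (w.pos _ h)

/-- The functions `f ∈ H(𝔻)` with `f'(z) = O((1 - |z|)⁻¹ w(|z|))` on the disk. -/
def blochSubmodule (w : Weight) : Submodule ℂ (ℂ → ℂ) where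
  carrier := {f | f ∈ Hol ∧ deriv f =O[𝓟 disk] majorant w}
  add_mem' := fun {f g} hf hg => by
    refine ⟨Hol.add_mem hf.1 hg.1, (hf.2.add hg.2).congr' ?_ EventuallyEq.rfl⟩
    exact eventually_principal.2 fun z hz => (Hol.deriv_add hf.1 hg.1 hz).symm
  zero_mem' := ⟨Hol.zero_mem,
    (isBigO_zero (E' := ℂ) (majorant w) (𝓟 disk)).congr_left fun z => (deriv_const z 0).symm⟩
  smul_mem' := fun c f hf => by
    refine ⟨Hol.smul_mem c hf.1, (hf.2.const_mul_left c).congr' ?_ EventuallyEq.rfl⟩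
    exact eventually_principal.2 fun z hz => (Hol.deriv_smul c hf.1 hz).symm

/-- The Bloch-type space with weight `w`. -/
def Bloch (w : Weight) : Type := blochSubmodule w

namespace Bloch

variable {w : Weight}

instance : AddCommGroup (Bloch w) := inferInstanceAs (AddCommGroup (blochSubmodule w))

instance : Module ℂ (Bloch w) := inferInstanceAs (Module ℂ (blochSubmodule w))

instance : CoeFun (Bloch w) fun _ => ℂ → ℂ := ⟨fun f => f.1⟩

/-- The norm `|f(0)| + sup_{z ∈ 𝔻} (1 - |z|) w(|z|)⁻¹ |f'(z)|`. -/
instance : Norm (Bloch w) := ⟨fun f => ‖f 0‖ + ⨆ z : disk, ‖deriv f z‖ / majorant w z⟩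

theorem norm_def (f : Bloch w) :
    ‖f‖ = ‖f 0‖ + ⨆ z : disk, ‖deriv f z‖ / majorant w z := rfl

theorem coe_add (f g : Bloch w) : (⇑(f + g) : ℂ → ℂ) = ⇑f + ⇑g := rfl

theorem coe_smul (c : ℂ) (f : Bloch w) : (⇑(c • f) : ℂ → ℂ) = c • ⇑f := rfl

theorem bddAbove (f : Bloch w) :
    BddAbove (range fun z : disk => ‖deriv f z‖ / majorant w z) := by
  obtain ⟨C, hC⟩ := f.2.2.bound
  refine ⟨C, ?_⟩
  rintro _ ⟨z, rfl⟩
  have h := eventually_principal.1 hC z z.2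
  rw [Real.norm_of_nonneg (majorant_pos w z.2).le] at h
  exact (div_le_iff₀ (majorant_pos w z.2)).2 h

theorem quot_nonneg (f : Bloch w) (z : disk) : 0 ≤ ‖deriv f z‖ / majorant w z :=
  div_nonneg (norm_nonneg _) (majorant_pos w z.2).le

theorem core : NormedSpace.Core ℂ (Bloch w) where
  norm_nonneg f := add_nonneg (norm_nonneg _) (Real.iSup_nonneg (quot_nonneg f))
  norm_smul c f := by
    rw [norm_def, norm_def, coe_smul, mul_add, Real.mul_iSup_of_nonneg (norm_nonneg c)]
    congr 1
    · simp
    · congr 1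
      funext z
      rw [Hol.deriv_smul c f.2.1 z.2, norm_mul, mul_div_assoc]
  norm_triangle f g := by
    have : Nonempty disk := ⟨⟨0, by simp [disk]⟩⟩
    have h0 : ‖(f + g) 0‖ ≤ ‖f 0‖ + ‖g 0‖ := norm_add_le (f 0) (g 0)
    have h1 : ⨆ z : disk, ‖deriv (f + g) z‖ / majorant w z ≤
        (⨆ z : disk, ‖deriv f z‖ / majorant w z) + ⨆ z : disk, ‖deriv g z‖ / majorant w z := by
      refine ciSup_le fun z => ?_
      refine le_trans ?_ (add_le_add (le_ciSup (bddAbove f) z) (le_ciSup (bddAbove g) z))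
      rw [coe_add, Hol.deriv_add f.2.1 g.2.1 z.2, ← add_div]
      exact div_le_div_of_nonneg_right (norm_add_le _ _) (majorant_pos w z.2).le
    rw [norm_def, norm_def, norm_def]
    linarith
  norm_eq_zero_iff f := by
    constructor
    · intro h
      have hs : 0 ≤ ⨆ z : disk, ‖deriv f z‖ / majorant w z := Real.iSup_nonneg (quot_nonneg f)
      rw [norm_def] at h
      have h0 : ‖f 0‖ = 0 := by linarith [norm_nonneg (f 0)]
      have h1 : ⨆ z : disk, ‖deriv f z‖ / majorant w z = 0 := by linarith [norm_nonneg (f 0)]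
      refine Subtype.ext (Hol.eq_zero f.2.1 (norm_eq_zero.1 h0) fun z hz => ?_)
      have hle := le_ciSup (bddAbove f) ⟨z, hz⟩
      rw [h1] at hle
      have := (div_le_iff₀ (majorant_pos w hz)).1 hle
      rw [zero_mul] at this
      exact norm_le_zero_iff.1 this
    · rintro rfl
      have : (⇑(0 : Bloch w) : ℂ → ℂ) = 0 := rfl
      rw [norm_def, this]
      simp

instance : NormedAddCommGroup (Bloch w) := NormedAddCommGroup.ofCore core

instance : NormedSpace ℂ (Bloch w) := NormedSpace.ofCore core

end Bloch

/-- The little Bloch-type space: the subspace of those `f` with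
`f'(z) = o((1 - |z|)⁻¹ w(|z|))` as `|z| ↑ 1`, with the norm of `Bloch w`. -/
def LittleBloch (w : Weight) : Submodule ℂ (Bloch w) where
  carrier := {f | deriv f =o[comap norm (𝓝[<] 1)] majorant w}
  add_mem' := fun {f g} hf hg => by
    refine (IsLittleO.add hf hg).congr' ?_ EventuallyEq.rfl
    filter_upwards [preimage_mem_comap self_mem_nhdsWithin] with z hz
    exact (Hol.deriv_add f.2.1 g.2.1 (by simpa [disk] using hz)).symm
  zero_mem' := 
    (isLittleO_zero (E' := ℂ) (majorant w) (comap norm (𝓝[<] (1 : ℝ)))).congr_left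
      fun z => (deriv_const z 0).symm
  smul_mem' := fun c f hf => by
    refine (IsLittleO.const_mul_left hf c).congr' ?_ EventuallyEq.rfl
    filter_upwards [preimage_mem_comap self_mem_nhdsWithin] with z hz
    exact (Hol.deriv_smul c f.2.1 (by simpa [disk] using hz)).symm

instance (w : Weight) : CoeFun (LittleBloch w) fun _ => ℂ → ℂ := ⟨fun f => f.1.1⟩

/-! ### The spaces defined by an area integral -/

theorem aestronglyMeasurable_integrand (w : Weight) {f : ℂ → ℂ} (hf : f ∈ Hol) :
    AEStronglyMeasurable (fun z : ℂ => ‖deriv f z‖ * w.toFun ‖z‖) (volume.restrict disk) := by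
  refine ContinuousOn.aestronglyMeasurable ?_ isOpen_disk.measurableSet
  exact (Hol.continuousOn_deriv hf).norm.mul
    (w.cont.comp continuous_norm.continuousOn fun z hz => norm_mem_Ico hz)

/-- The functions `f ∈ H(𝔻)` with `∫_𝔻 |f'(z)| w(|z|) dA(z) < ∞`. -/
def blochOneSubmodule (w : Weight) : Submodule ℂ (ℂ → ℂ) where
  carrier := {f | f ∈ Hol ∧ IntegrableOn (fun z : ℂ => ‖deriv f z‖ * w.toFun ‖z‖) disk}
  add_mem' := fun {f g} hf hg => by
    refine ⟨Hol.add_mem hf.1 hg.1, ?_⟩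
    refine (Integrable.add hf.2 hg.2).mono'
      (aestronglyMeasurable_integrand w (Hol.add_mem hf.1 hg.1)) ?_
    filter_upwards [ae_restrict_mem isOpen_disk.measurableSet] with z hz
    have hw := w.pos _ (norm_mem_Ico hz)
    rw [norm_mul, norm_norm, Real.norm_of_nonneg hw.le, Hol.deriv_add hf.1 hg.1 hz]
    simp only [Pi.add_apply]
    rw [← add_mul]
    exact mul_le_mul_of_nonneg_right (norm_add_le _ _) hw.le
  zero_mem' := ⟨Hol.zero_mem, by simp⟩
  smul_mem' := fun c f hf => by
    refine ⟨Hol.smul_mem c hf.1, IntegrableOn.congr_fun (Integrable.const_mul hf.2 ‖c‖) ?_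
      isOpen_disk.measurableSet⟩
    intro z hz
    simp only
    rw [Hol.deriv_smul c hf.1 hz, norm_mul, mul_assoc]

/-- The space of all `f ∈ H(𝔻)` with `∫_𝔻 |f'(z)| w(|z|) dA(z) < ∞`. -/
def BlochOne (w : Weight) : Type := blochOneSubmodule w

namespace BlochOne

variable {w : Weight}

instance : AddCommGroup (BlochOne w) := inferInstanceAs (AddCommGroup (blochOneSubmodule w))

instance : Module ℂ (BlochOne w) := inferInstanceAs (Module ℂ (blochOneSubmodule w))

instance : CoeFun (BlochOne w) fun _ => ℂ → ℂ := ⟨fun f => f.1⟩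

/-- The norm `|f(0)| + ∫_𝔻 |f'(z)| w(|z|) dA(z)`, where `dA` is the Lebesgue measure
normalized so that the disk has area one. -/
instance : Norm (BlochOne w) :=
  ⟨fun f => ‖f 0‖ + Real.pi⁻¹ * ∫ z in disk, ‖deriv f z‖ * w.toFun ‖z‖⟩

theorem norm_def (f : BlochOne w) :
    ‖f‖ = ‖f 0‖ + Real.pi⁻¹ * ∫ z in disk, ‖deriv f z‖ * w.toFun ‖z‖ := rfl

theorem coe_add (f g : BlochOne w) : (⇑(f + g) : ℂ → ℂ) = ⇑f + ⇑g := rfl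

theorem coe_smul (c : ℂ) (f : BlochOne w) : (⇑(c • f) : ℂ → ℂ) = c • ⇑f := rfl

theorem integrand_nonneg (f : BlochOne w) {z : ℂ} (hz : z ∈ disk) :
    0 ≤ ‖deriv f z‖ * w.toFun ‖z‖ :=
  mul_nonneg (norm_nonneg _) (w.pos _ (norm_mem_Ico hz)).le

theorem integral_nonneg (f : BlochOne w) : 0 ≤ ∫ z in disk, ‖deriv f z‖ * w.toFun ‖z‖ :=
  setIntegral_nonneg isOpen_disk.measurableSet fun _ hz => integrand_nonneg f hz

theorem deriv_eq_zero (f : BlochOne w)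
    (h : ∫ z in disk, ‖deriv f z‖ * w.toFun ‖z‖ = 0) : ∀ z ∈ disk, deriv f z = 0 := by
  have h1 : (fun z : ℂ => ‖deriv f z‖ * w.toFun ‖z‖) =ᵐ[volume.restrict disk] 0 := by
    refine (setIntegral_eq_zero_iff_of_nonneg_ae ?_ f.2.2).1 h
    filter_upwards [ae_restrict_mem isOpen_disk.measurableSet] with z hz
    exact integrand_nonneg f hz
  have h2 : deriv f =ᵐ[volume.restrict disk] fun _ => 0 := by
    filter_upwards [h1, ae_restrict_mem isOpen_disk.measurableSet] with z hz hzd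
    rcases mul_eq_zero.1 hz with h | h
    · exact norm_eq_zero.1 h
    · exact absurd h (w.pos _ (norm_mem_Ico hzd)).ne'
  exact Measure.eqOn_open_of_ae_eq h2 isOpen_disk (Hol.continuousOn_deriv f.2.1)
    continuousOn_const

theorem core : NormedSpace.Core ℂ (BlochOne w) where
  norm_nonneg f :=
    add_nonneg (norm_nonneg _) (mul_nonneg (inv_nonneg.2 Real.pi_pos.le) (integral_nonneg f))
  norm_smul c f := by
    have : ∫ z in disk, ‖deriv (c • f) z‖ * w.toFun ‖z‖ =
        ‖c‖ * ∫ z in disk, ‖deriv f z‖ * w.toFun ‖z‖ := by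
      rw [← integral_const_mul]
      refine setIntegral_congr_fun isOpen_disk.measurableSet fun z hz => ?_
      rw [coe_smul, Hol.deriv_smul c f.2.1 hz, norm_mul, mul_assoc]
    have h0 : ‖(c • f) 0‖ = ‖c‖ * ‖f 0‖ := norm_mul c (f 0)
    rw [norm_def, norm_def, this, h0]
    ring
  norm_triangle f g := by
    have h0 : ‖(f + g) 0‖ ≤ ‖f 0‖ + ‖g 0‖ := norm_add_le (f 0) (g 0)
    have h1 : ∫ z in disk, ‖deriv (f + g) z‖ * w.toFun ‖z‖ ≤
        (∫ z in disk, ‖deriv f z‖ * w.toFun ‖z‖) + ∫ z in disk, ‖deriv g z‖ * w.toFun ‖z‖ := by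
      rw [← integral_add f.2.2 g.2.2]
      refine setIntegral_mono_on (f + g).2.2 (Integrable.add f.2.2 g.2.2)
        isOpen_disk.measurableSet fun z hz => ?_
      rw [coe_add, Hol.deriv_add f.2.1 g.2.1 hz, ← add_mul]
      exact mul_le_mul_of_nonneg_right (norm_add_le _ _) (w.pos _ (norm_mem_Ico hz)).le
    have h2 := mul_le_mul_of_nonneg_left h1 (inv_nonneg.2 Real.pi_pos.le)
    rw [norm_def, norm_def, norm_def]
    linarith
  norm_eq_zero_iff f := by
    constructor
    · intro h
      have hp : 0 < Real.pi⁻¹ := inv_pos.2 Real.pi_pos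
      have hs := mul_nonneg hp.le (integral_nonneg f)
      rw [norm_def] at h
      have h0 : ‖f 0‖ = 0 := by linarith [norm_nonneg (f 0)]
      have h1 : Real.pi⁻¹ * ∫ z in disk, ‖deriv f z‖ * w.toFun ‖z‖ = 0 := by
        linarith [norm_nonneg (f 0)]
      have h2 := (mul_eq_zero.1 h1).resolve_left hp.ne'
      exact Subtype.ext (Hol.eq_zero f.2.1 (norm_eq_zero.1 h0) (deriv_eq_zero f h2))
    · rintro rfl
      have : (⇑(0 : BlochOne w) : ℂ → ℂ) = 0 := rfl
      rw [norm_def, this]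
      simp

instance : NormedAddCommGroup (BlochOne w) := NormedAddCommGroup.ofCore core

instance : NormedSpace ℂ (BlochOne w) := NormedSpace.ofCore core

end BlochOne

end LogBloch

end

open LogBloch

noncomputable section

namespace LogBloch

/-! ### Taylor coefficients -/

/-! The argument works for every weight satisfying the two-sided growth bound `Weight.Regular`: `w`
changes by at most the square root of the ratio of the distances to the circle. This makes `(1 -
|z|)⁻¹ w(|z|)` almost increasing and at least a multiple of `(1 - |z|)^(-1/2)`, and it yields the
kernel estimate `∫_𝔻 w(|z|) |1 - ζz|⁻³ dA(z) ≲ (1 - |ζ|)⁻¹ w(|ζ|)`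
(`Weight.Regular.lintegral_disk_kernel_le`). Powers of the logarithm and the iterated logarithm are
regular.

The pairing is bounded because `π⁻¹ ∫ f'(rz) g'(r z̄) (1 - |z|²)` has the expansion `∑ (m+1)/(m+2)
f̂(m+1) ĝ(m+1) r^(2m)`. In the integral, `1 - |z|²` cancels the singular factor in the bound for
`f'`, leaving the integral of `|g'(r z̄)| w(|z|)`, which monotonicity of integral means bounds by
that of `|g'| w` (`lintegral_dilate_le`). The multiplier `(m+1)/(m+2)` is then removed by an
elementary integration (`norm_tsum_le_of_bound`).

Uniformly bounded Abel means converge once dilations approximate every element of `X`, since for a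
dilated function the limit is immediate. Dilations also reduce a functional to its values on
monomials, so `Φ` can only be represented by `g = ∑ Φ(zⁿ) zⁿ`. This part is abstract
(`IsModel.duality`); it remains to show that `g` lies in the right space, with norm at most a
constant times `‖Φ‖`.

Both cases evaluate `Φ` on a test function built from `K(z) = ∑ (n+1)² zⁿ = (1+z)/(1-z)³`. If `x(0)
= 0` and `x'(z) = K(ζz)`, then `Φ(x) = g'(ζ)`, and the kernel estimate bounds `x` in the
area-integral space; this gives the Bloch bound for `g`. On the little Bloch space, take `x'(ζ) = ∫
K(ρζz) u(z)` with `u = w` times the conjugate sign of `g'(ρz)`; then `Φ(x) = ∫ |g'(ρz)| w`, the same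
estimate bounds `x`, and Fatou's lemma lets `ρ ↑ 1`. -/

theorem mem_disk {z : ℂ} : z ∈ disk ↔ ‖z‖ < 1 := by simp [disk]

theorem zero_mem_disk : (0 : ℂ) ∈ disk := by simp [disk]

theorem mul_mem_disk {z u : ℂ} (hu : ‖u‖ ≤ 1) (hz : z ∈ disk) : u * z ∈ disk := by
  rw [mem_disk] at *
  rw [norm_mul]
  nlinarith [norm_nonneg z]

/-- The sequences of Taylor coefficients of holomorphic functions on the unit disk. -/
def IsTaylor (a : ℕ → ℂ) : Prop := ∀ r ∈ Ico (0 : ℝ) 1, Summable fun n => ‖a n‖ * r ^ n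

/-- The function on the unit disk with prescribed Taylor coefficients. -/
def ofCoeffs (a : ℕ → ℂ) : ℂ → ℂ := disk.indicator fun z => ∑' n, a n * z ^ n

theorem hasSum_coeff {f : ℂ → ℂ} (hf : f ∈ Hol) {z : ℂ} (hz : z ∈ disk) :
    HasSum (fun n => coeff f n * z ^ n) (f z) := by
  have h := Complex.hasSum_taylorSeries_on_ball hf.1 hz
  refine h.congr_fun fun n => ?_
  simp only [sub_zero, smul_eq_mul, coeff]
  ring

theorem IsTaylor.of_hasSum {a : ℕ → ℂ} {f : ℂ → ℂ}
    (h : ∀ z ∈ disk, HasSum (fun n => a n * z ^ n) (f z)) : IsTaylor a := by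
  intro r hr
  have hz : (r : ℂ) ∈ disk := by
    rw [mem_disk, Complex.norm_real, Real.norm_of_nonneg hr.1]
    exact hr.2
  refine (h _ hz).summable.norm.congr fun n => ?_
  rw [norm_mul, norm_pow, Complex.norm_real, Real.norm_of_nonneg hr.1]

theorem isTaylor_coeff {f : ℂ → ℂ} (hf : f ∈ Hol) : IsTaylor (coeff f) :=
  IsTaylor.of_hasSum fun _ hz => hasSum_coeff hf hz

theorem eball_zero_one : Metric.eball (0 : ℂ) 1 = disk := by
  rw [disk, ← Metric.eball_ofReal, ENNReal.ofReal_one]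

/-- Passing to formal power series gives both holomorphy of pointwise sums and uniqueness of
coefficients. -/
theorem hasFPowerSeriesOnBall_of_hasSum {a : ℕ → ℂ} {f : ℂ → ℂ}
    (h : ∀ z ∈ disk, HasSum (fun n => a n * z ^ n) (f z)) :
    HasFPowerSeriesOnBall f (FormalMultilinearSeries.ofScalars ℂ a) 0 1 where
  r_le := by
    refine ENNReal.le_of_forall_nnreal_lt fun r hr => ?_
    refine FormalMultilinearSeries.le_radius_of_summable_norm _ ?_
    have := IsTaylor.of_hasSum h r ⟨r.2, by exact_mod_cast hr⟩
    exact this.congr fun n => by rw [FormalMultilinearSeries.ofScalars_norm]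
  r_pos := zero_lt_one
  hasSum := by
    intro y hy
    have hy' : y ∈ disk := by rwa [← eball_zero_one]
    simpa [FormalMultilinearSeries.ofScalars_apply_eq, mul_comm] using h y hy'

theorem coeff_eq_of_hasSum {a : ℕ → ℂ} {f : ℂ → ℂ} (hf : f ∈ Hol)
    (h : ∀ z ∈ disk, HasSum (fun n => a n * z ^ n) (f z)) : coeff f = a := by
  have h1 := (hasFPowerSeriesOnBall_of_hasSum h).hasFPowerSeriesAt
  have h2 := (hasFPowerSeriesOnBall_of_hasSum fun z hz => hasSum_coeff hf hz).hasFPowerSeriesAt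
  exact FormalMultilinearSeries.ofScalars_series_injective ℂ ℂ
    (h2.eq_formalMultilinearSeries h1)

theorem IsTaylor.summable {a : ℕ → ℂ} (ha : IsTaylor a) {z : ℂ} (hz : z ∈ disk) :
    Summable fun n => a n * z ^ n := by
  refine Summable.of_norm ((ha ‖z‖ (norm_mem_Ico hz)).congr fun n => ?_)
  rw [norm_mul, norm_pow]

theorem hasSum_ofCoeffs {a : ℕ → ℂ} (ha : IsTaylor a) {z : ℂ} (hz : z ∈ disk) :
    HasSum (fun n => a n * z ^ n) (ofCoeffs a z) := by
  rw [ofCoeffs, indicator_of_mem hz]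
  exact (ha.summable hz).hasSum

theorem ofCoeffs_mem {a : ℕ → ℂ} (ha : IsTaylor a) : ofCoeffs a ∈ Hol := by
  refine ⟨?_, fun z hz => indicator_of_notMem hz _⟩
  have h1 := (hasFPowerSeriesOnBall_of_hasSum fun z hz => hasSum_ofCoeffs ha hz).differentiableOn
  rwa [eball_zero_one] at h1

theorem coeff_ofCoeffs {a : ℕ → ℂ} (ha : IsTaylor a) : coeff (ofCoeffs a) = a :=
  coeff_eq_of_hasSum (ofCoeffs_mem ha) fun _ hz => hasSum_ofCoeffs ha hz

theorem Hol.eq_of_hasSum {a : ℕ → ℂ} {f : ℂ → ℂ} (hf : f ∈ Hol)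
    (h : ∀ z ∈ disk, HasSum (fun n => a n * z ^ n) (f z)) : f = ofCoeffs a := by
  have ha := IsTaylor.of_hasSum h
  funext z
  by_cases hz : z ∈ disk
  · exact (h z hz).unique (hasSum_ofCoeffs ha hz)
  · rw [hf.2 z hz, (ofCoeffs_mem ha).2 z hz]

theorem ofCoeffs_coeff {f : ℂ → ℂ} (hf : f ∈ Hol) : ofCoeffs (coeff f) = f :=
  (Hol.eq_of_hasSum hf fun _ hz => hasSum_coeff hf hz).symm

theorem coeff_zero (f : ℂ → ℂ) : coeff f 0 = f 0 := by simp [coeff]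

theorem coeff_deriv (f : ℂ → ℂ) (n : ℕ) : coeff (deriv f) n = (n + 1) * coeff f (n + 1) := by
  have : ((n : ℂ) + 1) ≠ 0 := by exact_mod_cast n.succ_ne_zero
  have h2 : (n.factorial : ℂ) ≠ 0 := by exact_mod_cast n.factorial_ne_zero
  rw [coeff, coeff, iteratedDeriv_succ', Nat.factorial_succ]
  push_cast
  field_simp

theorem hasSum_deriv {f : ℂ → ℂ} (hf : f ∈ Hol) {z : ℂ} (hz : z ∈ disk) :
    HasSum (fun n : ℕ => (n + 1) * coeff f (n + 1) * z ^ n) (deriv f z) := by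
  have h := Complex.hasSum_taylorSeries_on_ball (hf.1.deriv isOpen_disk) hz
  refine h.congr_fun fun n => ?_
  rw [← coeff_deriv]
  simp only [sub_zero, smul_eq_mul, coeff]
  ring

/-! ### Constructions on coefficient sequences -/

theorem IsTaylor.mono {a b : ℕ → ℂ} (hb : IsTaylor b) (h : ∀ n, ‖a n‖ ≤ ‖b n‖) :
    IsTaylor a := fun r hr =>
  (hb r hr).of_nonneg_of_le (fun n => mul_nonneg (norm_nonneg _) (pow_nonneg hr.1 n))
    fun n => mul_le_mul_of_nonneg_right (h n) (pow_nonneg hr.1 n)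

theorem isTaylor_pow (k : ℕ) (C : ℝ) : IsTaylor fun n => C * ((n : ℂ) + 1) ^ k := by
  intro r hr
  have hr' : ‖r‖ < 1 := by rw [Real.norm_of_nonneg hr.1]; exact hr.2
  have h1 : Summable fun n : ℕ => ((n : ℝ) + 1) ^ k * r ^ n := by
    -- The shift of index below divides by `r`, so `r = 0` is treated apart.
    rcases hr.1.eq_or_lt with h | h
    · refine summable_of_ne_finset_zero (s := {0}) fun n hn => ?_
      rw [← h, zero_pow (by simpa using hn), mul_zero]
    · have h0 : Summable fun n : ℕ => (n : ℝ) ^ k * r ^ n :=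
        summable_pow_mul_geometric_of_norm_lt_one k hr'
      have h2 := (summable_nat_add_iff 1).2 h0
      refine (h2.mul_left r⁻¹).congr fun n => ?_
      rw [pow_succ r n, Nat.cast_add, Nat.cast_one, mul_comm (r ^ n), mul_left_comm,
        inv_mul_cancel_left₀ h.ne']
  refine (h1.mul_left ‖C‖).congr fun n => ?_
  have h3 : ‖(n : ℂ) + 1‖ = (n : ℝ) + 1 := by norm_cast
  rw [norm_mul, norm_pow, Complex.norm_real, h3, mul_assoc]

theorem IsTaylor.exists_le {a : ℕ → ℂ} (ha : IsTaylor a) {r : ℝ} (hr : r ∈ Ico (0 : ℝ) 1) :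
    ∃ C, 0 ≤ C ∧ ∀ n, ‖a n‖ * r ^ n ≤ C := by
  have h0 : ∀ n, 0 ≤ ‖a n‖ * r ^ n := fun n => mul_nonneg (norm_nonneg _) (pow_nonneg hr.1 n)
  exact ⟨∑' n, ‖a n‖ * r ^ n, tsum_nonneg h0, fun n => (ha r hr).le_tsum n fun i _ => h0 i⟩

/-- Write `rⁿ = √rⁿ √rⁿ`: one sequence is summable against `√rⁿ`, the other is bounded against it.
-/
theorem IsTaylor.mul {a b : ℕ → ℂ} (ha : IsTaylor a) (hb : IsTaylor b) :
    IsTaylor fun n => a n * b n := by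
  intro r hr
  have hs : √r ∈ Ico (0 : ℝ) 1 :=
    ⟨Real.sqrt_nonneg r, by rw [Real.sqrt_lt' one_pos]; simpa using hr.2⟩
  obtain ⟨C, -, hC⟩ := hb.exists_le hs
  have h0 : ∀ n, 0 ≤ ‖a n‖ * √r ^ n := fun n => mul_nonneg (norm_nonneg _) (pow_nonneg hs.1 n)
  refine ((ha _ hs).mul_right C).of_nonneg_of_le
    (fun n => mul_nonneg (norm_nonneg _) (pow_nonneg hr.1 n)) fun n => ?_
  calc ‖a n * b n‖ * r ^ n = (‖a n‖ * √r ^ n) * (‖b n‖ * √r ^ n) := by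
        rw [norm_mul, mul_mul_mul_comm, ← mul_pow, Real.mul_self_sqrt hr.1]
    _ ≤ _ := mul_le_mul_of_nonneg_left (hC n) (h0 n)

theorem isTaylor_of_norm_le {a : ℕ → ℂ} {C : ℝ} (h : ∀ n, ‖a n‖ ≤ C * (n + 1)) :
    IsTaylor a := by
  refine (isTaylor_pow 1 C).mono fun n => (h n).trans ?_
  rw [norm_mul, Complex.norm_real, pow_one]
  have : ‖(n : ℂ) + 1‖ = (n : ℝ) + 1 := by norm_cast
  rw [this]
  exact mul_le_mul_of_nonneg_right (le_abs_self C) (by positivity)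

/-- The geometric sequence, as the coefficients of a dilation. -/
theorem isTaylor_geometric {c : ℂ} (hc : ‖c‖ ≤ 1) : IsTaylor fun n => c ^ n := by
  refine isTaylor_of_norm_le (C := 1) fun n => ?_
  rw [norm_pow]
  have := pow_le_one₀ (n := n) (norm_nonneg c) hc
  have : (0 : ℝ) ≤ n := n.cast_nonneg
  linarith

/-- The dilation `z ↦ f(ρ z)` of a function on the disk. -/
def dilate (ρ : ℂ) (f : ℂ → ℂ) : ℂ → ℂ := ofCoeffs fun n => coeff f n * ρ ^ n

theorem isTaylor_dilate {ρ : ℂ} (hρ : ‖ρ‖ ≤ 1) {f : ℂ → ℂ} (hf : f ∈ Hol) :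
    IsTaylor fun n => coeff f n * ρ ^ n := (isTaylor_coeff hf).mul (isTaylor_geometric hρ)

theorem dilate_mem {ρ : ℂ} (hρ : ‖ρ‖ ≤ 1) {f : ℂ → ℂ} (hf : f ∈ Hol) : dilate ρ f ∈ Hol :=
  ofCoeffs_mem (isTaylor_dilate hρ hf)

theorem coeff_dilate {ρ : ℂ} (hρ : ‖ρ‖ ≤ 1) {f : ℂ → ℂ} (hf : f ∈ Hol) (n : ℕ) :
    coeff (dilate ρ f) n = coeff f n * ρ ^ n := by
  rw [dilate, coeff_ofCoeffs (isTaylor_dilate hρ hf)]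

theorem dilate_apply {ρ : ℂ} (hρ : ‖ρ‖ ≤ 1) {f : ℂ → ℂ} (hf : f ∈ Hol) {z : ℂ} (hz : z ∈ disk) :
    dilate ρ f z = f (ρ * z) := by
  refine (hasSum_ofCoeffs (isTaylor_dilate hρ hf) hz).unique ?_
  refine (hasSum_coeff hf (mul_mem_disk hρ hz)).congr_fun fun n => ?_
  rw [mul_pow]
  ring

theorem deriv_dilate {ρ : ℂ} (hρ : ‖ρ‖ ≤ 1) {f : ℂ → ℂ} (hf : f ∈ Hol) {z : ℂ} (hz : z ∈ disk) :
    deriv (dilate ρ f) z = ρ * deriv f (ρ * z) := by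
  refine (hasSum_deriv (dilate_mem hρ hf) hz).unique ?_
  refine ((hasSum_deriv hf (mul_mem_disk hρ hz)).mul_left ρ).congr_fun fun n => ?_
  rw [coeff_dilate hρ hf, mul_pow]
  ring

/-- The monomial `z ^ n` on the disk. -/
def monomial (n : ℕ) : ℂ → ℂ := ofCoeffs (Pi.single n 1)

theorem isTaylor_single (n : ℕ) : IsTaylor (Pi.single n 1) := fun r _ =>
  summable_of_ne_finset_zero (s := {n}) fun m hm => by
    rw [Pi.single_eq_of_ne (by simpa using hm), norm_zero, zero_mul]

theorem monomial_mem (n : ℕ) : monomial n ∈ Hol := ofCoeffs_mem (isTaylor_single n)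

theorem coeff_monomial (n : ℕ) : coeff (monomial n) = Pi.single n 1 :=
  coeff_ofCoeffs (isTaylor_single n)

theorem coeff_add {f g : ℂ → ℂ} (hf : f ∈ Hol) (hg : g ∈ Hol) :
    coeff (f + g) = coeff f + coeff g :=
  coeff_eq_of_hasSum (Hol.add_mem hf hg) fun z hz =>
    ((hasSum_coeff hf hz).add (hasSum_coeff hg hz)).congr_fun fun n => by
      rw [Pi.add_apply, add_mul]

theorem coeff_smul (c : ℂ) {f : ℂ → ℂ} (hf : f ∈ Hol) : coeff (c • f) = c • coeff f :=
  coeff_eq_of_hasSum (Hol.smul_mem c hf) fun z hz =>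
    ((hasSum_coeff hf hz).mul_left c).congr_fun fun n => by
      rw [Pi.smul_apply, smul_eq_mul, mul_assoc]

/-- The linear map taking a holomorphic function to its Taylor coefficients. -/
def coeffₗ : Hol →ₗ[ℂ] ℕ → ℂ where
  toFun f := coeff f
  map_add' f g := coeff_add f.2 g.2
  map_smul' c f := coeff_smul c f.2

theorem coeffₗ_injective : Function.Injective coeffₗ := fun f g h => Subtype.ext (by
  rw [← ofCoeffs_coeff f.2, ← ofCoeffs_coeff g.2]
  exact congrArg ofCoeffs h)

/-! ### An abstract duality theorem for the Abel pairing -/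

/-- One weighted `ℓ¹` norm controls the value at the origin and the derivative on the whole disk,
which are exactly the data that `IsModel.bounded` asks for. -/
theorem norm_le_tsum_coeff {f : ℂ → ℂ} (hf : f ∈ Hol)
    (hs : Summable fun n : ℕ => ((n : ℝ) + 1) * ‖coeff f n‖) :
    ‖f 0‖ ≤ ∑' n : ℕ, ((n : ℝ) + 1) * ‖coeff f n‖ ∧
      ∀ z ∈ disk, ‖deriv f z‖ ≤ ∑' n : ℕ, ((n : ℝ) + 1) * ‖coeff f n‖ := by
  have h0 : ∀ n : ℕ, 0 ≤ ((n : ℝ) + 1) * ‖coeff f n‖ := fun n => by positivity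
  refine ⟨?_, fun z hz => ?_⟩
  · have := hs.le_tsum 0 fun i _ => h0 i
    simpa [coeff_zero] using this
  · have h1 := (summable_nat_add_iff 1).2 hs
    have h2 : ∀ n : ℕ, ‖((n : ℂ) + 1) * coeff f (n + 1) * z ^ n‖ ≤
        (((n + 1 : ℕ) : ℝ) + 1) * ‖coeff f (n + 1)‖ := fun n => by
      have h3 : ‖(n : ℂ) + 1‖ = (n : ℝ) + 1 := by norm_cast
      have h4 : ‖z‖ ^ n ≤ 1 := pow_le_one₀ (norm_nonneg z) (mem_disk.1 hz).le
      rw [norm_mul, norm_mul, norm_pow, h3]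
      push_cast
      have h5 := norm_nonneg (coeff f (n + 1))
      have h6 : ((n : ℝ) + 1) * ‖coeff f (n + 1)‖ * ‖z‖ ^ n ≤ (n + 1) * ‖coeff f (n + 1)‖ :=
        mul_le_of_le_one_right (by positivity) h4
      linarith
    rw [← (hasSum_deriv hf hz).tsum_eq]
    refine (tsum_of_norm_bounded h1.hasSum h2).trans ?_
    rw [hs.tsum_eq_zero_add]
    linarith [h0 0]

/-- A normed space of holomorphic functions that contains boundedly all functions with bounded
derivative, and in which dilations approximate. -/
structure IsModel {X : Type*} [NormedAddCommGroup X] [NormedSpace ℂ X] (ι : X →ₗ[ℂ] Hol) :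
    Prop where
  injective : Function.Injective ι
  bounded : ∃ C : ℝ, ∀ (f : Hol) (M : ℝ), ‖f.1 0‖ ≤ M → (∀ z ∈ disk, ‖deriv f.1 z‖ ≤ M) →
    ∃ x, ι x = f ∧ ‖x‖ ≤ C * M
  dense : ∀ x, ∀ ε > 0, ∃ ρ ∈ Ioo (0 : ℝ) 1, ∃ y, (ι y : ℂ → ℂ) = dilate ρ (ι x) ∧ ‖x - y‖ < ε

namespace IsModel

variable {X : Type*} [NormedAddCommGroup X] [NormedSpace ℂ X] {ι : X →ₗ[ℂ] Hol}

theorem coeff_add (x y : X) : coeff (ι (x + y)) = coeff (ι x) + coeff (ι y) := by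
  rw [map_add]
  exact LogBloch.coeff_add (ι x).2 (ι y).2

theorem coeff_smul (c : ℂ) (x : X) : coeff (ι (c • x)) = c • coeff (ι x) := by
  rw [map_smul]
  exact LogBloch.coeff_smul c (ι x).2

theorem coeff_sub (x y : X) : coeff (ι (x - y)) = coeff (ι x) - coeff (ι y) := by
  rw [sub_eq_add_neg, ← neg_one_smul ℂ y, coeff_add, coeff_smul, neg_one_smul, sub_eq_add_neg]

theorem coeff_sum {s : Finset ℕ} (x : ℕ → X) :
    coeff (ι (∑ n ∈ s, x n)) = ∑ n ∈ s, coeff (ι (x n)) := by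
  have : coeffₗ (ι (∑ n ∈ s, x n)) = ∑ n ∈ s, coeffₗ (ι (x n)) := by simp
  exact this

theorem eq_of_coeff_eq (h : Function.Injective ι) {x y : X} (hxy : coeff (ι x) = coeff (ι y)) :
    x = y :=
  h (coeffₗ_injective hxy)

/-- Turns summability of coefficients into norm estimates in `X`; injectivity identifies the element
supplied by `bounded` with `x`. -/
theorem norm_le (h : IsModel ι) : ∃ C : ℝ, 0 ≤ C ∧ ∀ x,
    Summable (fun n : ℕ => ((n : ℝ) + 1) * ‖coeff (ι x) n‖) →
      ‖x‖ ≤ C * ∑' n : ℕ, ((n : ℝ) + 1) * ‖coeff (ι x) n‖ := by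
  obtain ⟨C, hC⟩ := h.bounded
  refine ⟨max C 0, le_max_right _ _, fun x hs => ?_⟩
  obtain ⟨h0, h1⟩ := norm_le_tsum_coeff (ι x).2 hs
  obtain ⟨y, hy, hyC⟩ := hC (ι x) _ h0 h1
  rw [h.injective hy] at hyC
  exact hyC.trans (mul_le_mul_of_nonneg_right (le_max_left _ _)
    (tsum_nonneg fun n => by positivity))

theorem exists_of_summable (h : IsModel ι) {f : ℂ → ℂ} (hf : f ∈ Hol)
    (hs : Summable fun n : ℕ => ((n : ℝ) + 1) * ‖coeff f n‖) : ∃ x, ι x = f := by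
  obtain ⟨C, hC⟩ := h.bounded
  obtain ⟨h0, h1⟩ := norm_le_tsum_coeff hf hs
  obtain ⟨x, hx, -⟩ := hC ⟨f, hf⟩ _ h0 h1
  exact ⟨x, by rw [hx]⟩

/-! ### Monomial expansions and functionals. -/

theorem exists_monomials (h : IsModel ι) :
    ∃ e : ℕ → X, ∀ n, (ι (e n) : ℂ → ℂ) = monomial n := by
  have : ∀ n, ∃ x, (ι x : ℂ → ℂ) = monomial n := fun n => by
    refine h.exists_of_summable (monomial_mem n) ?_
    refine summable_of_ne_finset_zero (s := {n}) fun m hm => ?_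
    rw [coeff_monomial, Pi.single_eq_of_ne (by simpa using hm), norm_zero, mul_zero]
  choose e he using this
  exact ⟨e, he⟩

variable {e : ℕ → X}

theorem coeff_e (he : ∀ n, (ι (e n) : ℂ → ℂ) = monomial n) (n : ℕ) :
    coeff (ι (e n)) = Pi.single n 1 := by
  rw [he n, coeff_monomial]

/-- Removing the terms of a finite set `s` leaves a function whose coefficients are those outside
`s`, so the error in `X` is at most a constant times the tail of the weighted coefficient sum. -/
theorem hasSum_monomials (h : IsModel ι) (he : ∀ n, (ι (e n) : ℂ → ℂ) = monomial n) {x : X}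
    (hs : Summable fun n : ℕ => ((n : ℝ) + 1) * ‖coeff (ι x) n‖) :
    HasSum (fun n => coeff (ι x) n • e n) x := by
  obtain ⟨C, -, hC⟩ := h.norm_le
  have h1 : Tendsto (fun s : Finset ℕ => C * ∑' n : {n // n ∉ s},
      (((n : ℕ) : ℝ) + 1) * ‖coeff (ι x) n‖) atTop (𝓝 0) := by
    simpa using (tendsto_tsum_compl_atTop_zero
      fun n : ℕ => ((n : ℝ) + 1) * ‖coeff (ι x) n‖).const_mul C
  rw [HasSum, SummationFilter.unconditional_filter, tendsto_iff_norm_sub_tendsto_zero]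
  refine squeeze_zero (fun s => norm_nonneg _) (fun s => ?_) h1
  have h2 : ∀ n : ℕ, ((n : ℝ) + 1) * ‖coeff (ι (x - ∑ n ∈ s, coeff (ι x) n • e n)) n‖ =
      indicator {n | n ∉ s} (fun n : ℕ => ((n : ℝ) + 1) * ‖coeff (ι x) n‖) n := fun n => by
    have h3 : coeff (ι (x - ∑ n ∈ s, coeff (ι x) n • e n)) n =
        if n ∈ s then 0 else coeff (ι x) n := by
      rw [coeff_sub, coeff_sum, Pi.sub_apply, Finset.sum_apply]
      simp_rw [coeff_smul, coeff_e he]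
      simp only [Pi.smul_apply, Pi.single_apply, smul_eq_mul, mul_ite, mul_one, mul_zero,
        Finset.sum_ite_eq]
      split_ifs <;> simp
    rw [h3]
    by_cases hn : n ∈ s
    · simp [hn]
    · simp [hn]
  rw [norm_sub_rev]
  refine (hC _ ?_).trans_eq ?_
  · simp_rw [h2]
    exact hs.indicator _
  · simp_rw [h2]
    rw [← tsum_subtype]
    rfl

theorem summable_dilate {f : ℂ → ℂ} (hf : f ∈ Hol) {ρ : ℝ} (hρ : ρ ∈ Ioo (0 : ℝ) 1) :
    Summable fun n : ℕ => ((n : ℝ) + 1) * ‖coeff (dilate ρ f) n‖ := by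
  have h1 : ‖(ρ : ℂ)‖ ≤ 1 := by
    rw [Complex.norm_real, Real.norm_of_nonneg hρ.1.le]
    exact hρ.2.le
  refine ((isTaylor_pow 1 1).mul (isTaylor_coeff hf) ρ ⟨hρ.1.le, hρ.2⟩).congr fun n => ?_
  have h3 : ‖(n : ℂ) + 1‖ = (n : ℝ) + 1 := by norm_cast
  rw [coeff_dilate h1 hf, norm_mul, norm_mul, norm_mul, norm_pow, norm_pow, h3,
    Complex.norm_real, Complex.norm_real, Real.norm_of_nonneg hρ.1.le]
  simp [mul_assoc]

/-- The functionals agree on dilations, which are norm limits of their Taylor sums, and dilations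
approximate every element. -/
theorem functional_ext (h : IsModel ι) (he : ∀ n, (ι (e n) : ℂ → ℂ) = monomial n)
    {Φ Ψ : X →L[ℂ] ℂ} (hΦ : ∀ n, Φ (e n) = Ψ (e n)) : Φ = Ψ := by
  ext x
  refine eq_of_forall_dist_le fun ε hε => ?_
  obtain ⟨ρ, hρ, y, hy, hxy⟩ := h.dense x (ε / (‖Φ - Ψ‖ + 1)) (by positivity)
  have hs := summable_dilate (ι x).2 hρ
  rw [← hy] at hs
  have h1 := h.hasSum_monomials he hs
  have h2 : Φ y = Ψ y := by
    refine (Φ.hasSum h1).unique ?_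
    refine (Ψ.hasSum h1).congr_fun fun n => ?_
    simp [hΦ]
  have h3 : Φ x - Ψ x = (Φ - Ψ) (x - y) := by
    rw [sub_apply, map_sub, map_sub, h2]
    ring
  rw [dist_eq_norm, h3]
  calc ‖(Φ - Ψ) (x - y)‖ ≤ ‖Φ - Ψ‖ * ‖x - y‖ := (Φ - Ψ).le_opNorm _
    _ ≤ (‖Φ - Ψ‖ + 1) * (ε / (‖Φ - Ψ‖ + 1)) := by gcongr; linarith
    _ = ε := by field_simp

/-- Linear growth makes `Φ (e n)` the coefficients of a holomorphic function; the case `n = 0`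
bounds its value at the origin by a multiple of `‖Φ‖`. -/
theorem norm_monomials_le (h : IsModel ι) : ∃ C, 0 ≤ C ∧ ∀ e : ℕ → X,
    (∀ n, (ι (e n) : ℂ → ℂ) = monomial n) → ∀ n : ℕ, ‖e n‖ ≤ C * (n + 1) := by
  obtain ⟨C, hC0, hC⟩ := h.norm_le
  refine ⟨C, hC0, fun e he n => ?_⟩
  have h1 : ∀ m, m ≠ n → ((m : ℝ) + 1) * ‖coeff (ι (e n)) m‖ = 0 := fun m hm => by
    rw [coeff_e he, Pi.single_eq_of_ne hm, norm_zero, mul_zero]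
  refine (hC _ ?_).trans_eq ?_
  · exact summable_of_ne_finset_zero (s := {n}) fun m hm => h1 m (by simpa using hm)
  · rw [tsum_eq_single n h1, coeff_e he]
    simp

theorem isTaylor_functional (h : IsModel ι) (he : ∀ n, (ι (e n) : ℂ → ℂ) = monomial n)
    (Φ : X →L[ℂ] ℂ) : IsTaylor fun n => Φ (e n) := by
  obtain ⟨C, -, hC⟩ := h.norm_monomials_le
  refine isTaylor_of_norm_le (C := ‖Φ‖ * C) fun n => ?_
  rw [mul_assoc]
  exact (Φ.le_opNorm _).trans (mul_le_mul_of_nonneg_left (hC e he n) (norm_nonneg _))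

theorem hasSum_functional (h : IsModel ι) (he : ∀ n, (ι (e n) : ℂ → ℂ) = monomial n)
    (Φ : X →L[ℂ] ℂ) {x : X} (hs : Summable fun n : ℕ => ((n : ℝ) + 1) * ‖coeff (ι x) n‖) :
    HasSum (fun n => coeff (ι x) n * Φ (e n)) (Φ x) :=
  (Φ.hasSum (h.hasSum_monomials he hs)).congr_fun fun n => by simp

end IsModel

/-- The Abel means of the pairing. -/
def abelSum (f g : ℂ → ℂ) (r : ℝ) : ℂ := ∑' n : ℕ, coeff f n * coeff g n * (r : ℂ) ^ (2 * n)

theorem summable_abelSum {f g : ℂ → ℂ} (hf : f ∈ Hol) (hg : g ∈ Hol) {r : ℝ}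
    (hr : r ∈ Ioo (0 : ℝ) 1) :
    Summable fun n : ℕ => coeff f n * coeff g n * (r : ℂ) ^ (2 * n) := by
  have h := ((isTaylor_coeff hf).mul (isTaylor_coeff hg)).summable (z := (r : ℂ) ^ 2) ?_
  · simpa [pow_mul] using h
  · rw [mem_disk, norm_pow, Complex.norm_real, Real.norm_of_nonneg hr.1.le]
    exact pow_lt_one₀ hr.1.le hr.2 two_ne_zero

theorem abelSum_comm (f g : ℂ → ℂ) (r : ℝ) : abelSum f g r = abelSum g f r :=
  tsum_congr fun n => by rw [mul_comm (coeff f n)]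

/-- The factor `ρ ^ n` makes the series absolutely convergent uniformly in `r`, so dominated
convergence applies up to `r = 1`. -/
theorem tendsto_abelSum_dilate {f g : ℂ → ℂ} (hf : f ∈ Hol) (hg : g ∈ Hol) {ρ : ℝ}
    (hρ : ρ ∈ Ioo (0 : ℝ) 1) :
    ∃ L, Tendsto (abelSum (dilate ρ f) g) (𝓝[<] 1) (𝓝 L) := by
  have h1 : ‖(ρ : ℂ)‖ ≤ 1 := by
    rw [Complex.norm_real, Real.norm_of_nonneg hρ.1.le]
    exact hρ.2.le
  refine ⟨∑' n : ℕ, coeff (dilate ρ f) n * coeff g n * ((1 : ℝ) : ℂ) ^ (2 * n), ?_⟩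
  refine tendsto_tsum_of_dominated_convergence
    (bound := fun n => ‖coeff f n * coeff g n‖ * ρ ^ n)
    ((isTaylor_coeff hf).mul (isTaylor_coeff hg) ρ ⟨hρ.1.le, hρ.2⟩) (fun n => ?_) ?_
  · have : Continuous fun r : ℝ => coeff (dilate ρ f) n * coeff g n * (r : ℂ) ^ (2 * n) := by
      fun_prop
    exact this.continuousAt.continuousWithinAt
  · filter_upwards [Ioo_mem_nhdsLT (zero_lt_one' ℝ)] with r hr n
    have h2 : ‖(r : ℂ) ^ (2 * n)‖ ≤ 1 := by
      rw [norm_pow, Complex.norm_real, Real.norm_of_nonneg hr.1.le]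
      exact pow_le_one₀ hr.1.le hr.2.le
    have h3 : ‖coeff (dilate ρ f) n * coeff g n‖ = ‖coeff f n * coeff g n‖ * ρ ^ n := by
      rw [coeff_dilate h1 hf, mul_right_comm, norm_mul _ ((ρ : ℂ) ^ n), norm_pow,
        Complex.norm_real, Real.norm_of_nonneg hρ.1.le]
    rw [norm_mul, ← h3]
    exact mul_le_of_le_one_right (norm_nonneg _) h2

/-! ### From bounded Abel means to the duality isomorphism. -/

section Duality

variable {X Y : Type*} [NormedAddCommGroup X] [NormedSpace ℂ X] [NormedAddCommGroup Y]
  [NormedSpace ℂ Y] {ι : X →ₗ[ℂ] Hol} {κ : Y →ₗ[ℂ] Hol}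

/-- Replacing `x` by a dilation changes the Abel means by little, uniformly in `r`. The means of the
dilation converge, so those of `x` satisfy the Cauchy criterion. -/
theorem IsModel.exists_tendsto (h : IsModel ι) {C : ℝ}
    (hC : ∀ x y, ∀ r ∈ Ioo (0 : ℝ) 1, ‖abelSum (ι x) (κ y) r‖ ≤ C * ‖x‖ * ‖y‖) (x : X) (y : Y) :
    ∃ L, Tendsto (abelSum (ι x) (κ y)) (𝓝[<] 1) (𝓝 L) := by
  refine cauchy_map_iff_exists_tendsto.1 (Metric.cauchy_iff.2 ⟨inferInstance, fun ε hε => ?_⟩)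
  -- The tolerance is chosen so that its product with `|C| * ‖y‖` is at most `ε / 4`; the added `1`
  -- covers a vanishing product.
  obtain ⟨ρ, hρ, x', hx', hxx⟩ := h.dense x (ε / (4 * (|C| * ‖y‖ + 1))) (by positivity)
  obtain ⟨L, hL⟩ := tendsto_abelSum_dilate (ι x).2 (κ y).2 hρ
  rw [← hx'] at hL
  have h1 : ∀ᶠ r in 𝓝[<] (1 : ℝ), dist (abelSum (ι x) (κ y) r) L < ε / 2 := by
    filter_upwards [Metric.tendsto_nhds.1 hL (ε / 4) (by positivity),
      Ioo_mem_nhdsLT (zero_lt_one' ℝ)] with r hr1 hr2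
    have h2 : abelSum (ι x) (κ y) r - abelSum (ι x') (κ y) r = abelSum (ι (x - x')) (κ y) r := by
      rw [abelSum, abelSum, ← (summable_abelSum (ι x).2 (κ y).2 hr2).tsum_sub
        (summable_abelSum (ι x').2 (κ y).2 hr2)]
      refine tsum_congr fun n => ?_
      rw [IsModel.coeff_sub, Pi.sub_apply]
      ring
    have h3 : dist (abelSum (ι x) (κ y) r) (abelSum (ι x') (κ y) r) ≤ ε / 4 := by
      rw [dist_eq_norm, h2]
      calc _ ≤ C * ‖x - x'‖ * ‖y‖ := hC _ _ r hr2
        _ ≤ |C| * (ε / (4 * (|C| * ‖y‖ + 1))) * ‖y‖ := by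
            gcongr
            exact le_abs_self C
        _ = (|C| * ‖y‖) / (|C| * ‖y‖ + 1) * (ε / 4) := by field_simp
        _ ≤ 1 * (ε / 4) := by
            gcongr
            rw [div_le_one (by positivity)]
            linarith
        _ = ε / 4 := one_mul _
    linarith [dist_triangle (abelSum (ι x) (κ y) r) (abelSum (ι x') (κ y) r) L]
  refine ⟨abelSum (ι x) (κ y) '' {r | dist (abelSum (ι x) (κ y) r) L < ε / 2},
    image_mem_map h1, ?_⟩
  rintro _ ⟨r, hr, rfl⟩ _ ⟨s, hs, rfl⟩
  have hr' : dist (abelSum (ι x) (κ y) r) L < ε / 2 := hr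
  have hs' : dist (abelSum (ι x) (κ y) s) L < ε / 2 := hs
  linarith [dist_triangle_right (abelSum (ι x) (κ y) r) (abelSum (ι x) (κ y) s) L]

/-- If the Abel means of the pairing are bounded and every functional on `X` is represented
boundedly by an element of `Y`, then `Y` is the dual of `X`. -/
theorem IsModel.duality (h : IsModel ι) (hκ : Function.Injective κ) {C : ℝ}
    (hC : ∀ x y, ∀ r ∈ Ioo (0 : ℝ) 1, ‖abelSum (ι x) (κ y) r‖ ≤ C * ‖x‖ * ‖y‖) {D : ℝ}
    (hD : ∀ e : ℕ → X, (∀ n, (ι (e n) : ℂ → ℂ) = monomial n) → ∀ Φ : X →L[ℂ] ℂ,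
      ∃ y, (∀ n, coeff (κ y) n = Φ (e n)) ∧ ‖y‖ ≤ D * ‖Φ‖) :
    ∃ E : Y ≃ₗ[ℂ] (X →L[ℂ] ℂ), (∀ y x, HasPairing (ι x) (κ y) (E y x)) ∧
      ∃ K : ℝ, 0 < K ∧ ∀ y, ‖y‖ / K ≤ ‖E y‖ ∧ ‖E y‖ ≤ K * ‖y‖ := by
  choose L hL using h.exists_tendsto hC
  obtain ⟨e, he⟩ := h.exists_monomials
  have hI : ∀ᶠ r in 𝓝[<] (1 : ℝ), r ∈ Ioo (0 : ℝ) 1 := Ioo_mem_nhdsLT (zero_lt_one' ℝ)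
  let B₀ : Y →ₗ[ℂ] X →ₗ[ℂ] ℂ := LinearMap.mk₂ ℂ (fun y x => L x y)
    (fun y y' x => by
      refine tendsto_nhds_unique (hL x (y + y')) (((hL x y).add (hL x y')).congr' ?_)
      filter_upwards [hI] with r hr
      rw [abelSum, abelSum, ← (summable_abelSum (ι x).2 (κ y).2 hr).tsum_add
        (summable_abelSum (ι x).2 (κ y').2 hr)]
      refine tsum_congr fun n => ?_
      rw [IsModel.coeff_add, Pi.add_apply]
      ring)
    (fun c y x => by
      refine tendsto_nhds_unique (hL x (c • y)) (((hL x y).const_smul c).congr' ?_)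
      filter_upwards [hI] with r hr
      rw [abelSum, smul_eq_mul, ← tsum_mul_left]
      refine tsum_congr fun n => ?_
      rw [IsModel.coeff_smul, Pi.smul_apply, smul_eq_mul]
      ring)
    (fun y x x' => by
      refine tendsto_nhds_unique (hL (x + x') y) (((hL x y).add (hL x' y)).congr' ?_)
      filter_upwards [hI] with r hr
      rw [abelSum, abelSum, ← (summable_abelSum (ι x).2 (κ y).2 hr).tsum_add
        (summable_abelSum (ι x').2 (κ y).2 hr)]
      refine tsum_congr fun n => ?_
      rw [IsModel.coeff_add, Pi.add_apply]
      ring)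
    (fun c y x => by
      refine tendsto_nhds_unique (hL (c • x) y) (((hL x y).const_smul c).congr' ?_)
      filter_upwards [hI] with r hr
      rw [abelSum, smul_eq_mul, ← tsum_mul_left]
      refine tsum_congr fun n => ?_
      rw [IsModel.coeff_smul, Pi.smul_apply, smul_eq_mul]
      ring)
  have hB₀ : ∀ y x, ‖B₀ y x‖ ≤ |C| * ‖y‖ * ‖x‖ := fun y x => by
    refine le_of_tendsto (hL x y).norm ?_
    filter_upwards [hI] with r hr
    refine (hC x y r hr).trans ?_
    rw [mul_right_comm]
    gcongr
    exact le_abs_self C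
  let B : Y →L[ℂ] X →L[ℂ] ℂ := B₀.mkContinuous₂ |C| hB₀
  have hB : ∀ y x, B y x = L x y := fun y x => rfl
  -- Against a monomial the Abel mean is a single term, so the functional recovers the coefficients
  -- of `y`. Injectivity and the lower norm bound both rest on this.
  have hBe : ∀ y n, B y (e n) = coeff (κ y) n := fun y n => by
    rw [hB]
    refine tendsto_nhds_unique (hL (e n) y) ?_
    have h1 : Continuous fun r : ℝ => coeff (κ y) n * (r : ℂ) ^ (2 * n) := by fun_prop
    have h2 := (h1.continuousAt (x := 1)).continuousWithinAt (s := Iio 1)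
    rw [ContinuousWithinAt, Complex.ofReal_one, one_pow, mul_one] at h2
    refine h2.congr fun r => ?_
    rw [abelSum, tsum_eq_single n, IsModel.coeff_e he, Pi.single_eq_same, one_mul]
    intro m hm
    rw [IsModel.coeff_e he, Pi.single_eq_of_ne hm, zero_mul, zero_mul]
  have hinj : Function.Injective B := fun y y' hy => IsModel.eq_of_coeff_eq hκ (by
    funext n
    rw [← hBe, ← hBe, hy])
  have hsurj : Function.Surjective B := fun Φ => by
    obtain ⟨y, hy, -⟩ := hD e he Φ
    exact ⟨y, h.functional_ext he fun n => by rw [hBe, hy]⟩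
  refine ⟨LinearEquiv.ofBijective B.toLinearMap ⟨hinj, hsurj⟩, fun y x => ⟨fun r hr =>
    summable_abelSum (ι x).2 (κ y).2 hr, hL x y⟩, max (max |C| D) 1, by positivity, fun y => ?_⟩
  change ‖y‖ / _ ≤ ‖B y‖ ∧ ‖B y‖ ≤ _
  constructor
  · rw [div_le_iff₀ (by positivity), mul_comm]
    -- The element representing `B y` has the coefficients of `y`, hence is `y`, and its norm bound
    -- becomes the lower estimate.
    obtain ⟨y', hy', hn⟩ := hD e he (B y)
    have : y' = y := IsModel.eq_of_coeff_eq hκ (by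
      funext n
      rw [hy', hBe])
    rw [this] at hn
    exact hn.trans (mul_le_mul_of_nonneg_right ((le_max_right _ _).trans (le_max_left _ _))
      (norm_nonneg _))
  · refine (B y).opNorm_le_bound (by positivity) fun x => (hB₀ y x).trans ?_
    gcongr
    exact (le_max_left _ _).trans (le_max_left _ _)

end Duality

/-! ### Regular weights -/

/-- A weight is regular if it satisfies Potter-type bounds with exponent `1 / 2`. -/
def Weight.Regular (w : Weight) : Prop :=
  ∃ C : ℝ, 0 < C ∧ ∀ r ∈ Ico (0 : ℝ) 1, ∀ s ∈ Ico (0 : ℝ) 1,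
    w.toFun r ≤ C * w.toFun s * (((1 - r) + (1 - s)) / √((1 - r) * (1 - s)))

/-- With `a = 1 - r` and `b = 1 - s`, `√(a / b) * √(a * b) = a ≤ a + b`. The symmetric quotient in
the definition therefore dominates the square root in either order, and only `r ≤ s` has to be
examined. -/
theorem Weight.Regular.of_le {w : Weight} {C : ℝ} (hC : 0 < C)
    (h : ∀ r s, 0 ≤ r → r ≤ s → s < 1 → w.toFun s ≤ C * √((1 - r) / (1 - s)) * w.toFun r ∧
      w.toFun r ≤ C * √((1 - r) / (1 - s)) * w.toFun s) : w.Regular := by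
  have key : ∀ r s : ℝ, r < 1 → s < 1 →
      √((1 - r) / (1 - s)) ≤ ((1 - r) + (1 - s)) / √((1 - r) * (1 - s)) := fun r s hr hs => by
    have hr' : 0 < 1 - r := by linarith
    have hs' : 0 < 1 - s := by linarith
    rw [le_div_iff₀ (by positivity), ← Real.sqrt_mul (by positivity)]
    have : (1 - r) / (1 - s) * ((1 - r) * (1 - s)) = (1 - r) ^ 2 := by field_simp
    rw [this, Real.sqrt_sq hr'.le]
    linarith
  refine ⟨C, hC, fun r hr s hs => ?_⟩
  have hw := w.pos s hs
  rcases le_total r s with hrs | hrs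
  · refine (h r s hr.1 hrs hs.2).2.trans ?_
    rw [mul_right_comm]
    exact mul_le_mul_of_nonneg_left (key r s hr.2 hs.2) (by positivity)
  · refine (h s r hs.1 hrs hr.2).1.trans ?_
    rw [mul_right_comm, add_comm, mul_comm (1 - r)]
    exact mul_le_mul_of_nonneg_left (key s r hs.2 hr.2) (by positivity)

namespace Weight.Regular

variable {w : Weight}

/-- The factor `(1 - |z|)⁻¹` outgrows the square-root loss permitted to `w`, so the majorant is
almost increasing in `|z|`. -/
theorem majorant_le (h : w.Regular) : ∃ C : ℝ, 0 < C ∧ ∀ z ∈ disk, ∀ u ∈ disk, ‖z‖ ≤ ‖u‖ →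
    majorant w z ≤ C * majorant w u := by
  obtain ⟨C, hC, h⟩ := h
  refine ⟨2 * C, by positivity, fun z hz u hu hzu => ?_⟩
  have hr := norm_mem_Ico hz
  have hs := norm_mem_Ico hu
  have hw := w.pos _ hs
  have ht : 0 < 1 - ‖z‖ := by linarith [hr.2]
  have ha : 0 < 1 - ‖u‖ := by linarith [hs.2]
  have h1 : ((1 - ‖z‖) + (1 - ‖u‖)) / √((1 - ‖z‖) * (1 - ‖u‖)) ≤
      2 * (1 - ‖z‖) / (1 - ‖u‖) := by
    refine div_le_div₀ (by positivity) (by linarith) ha ?_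
    refine Real.le_sqrt_of_sq_le ?_
    rw [sq]
    exact mul_le_mul_of_nonneg_right (by linarith) ha.le
  rw [majorant, majorant, inv_mul_le_iff₀ ht]
  calc w.toFun ‖z‖ ≤ C * w.toFun ‖u‖ * (2 * (1 - ‖z‖) / (1 - ‖u‖)) :=
        (h _ hr _ hs).trans (mul_le_mul_of_nonneg_left h1 (by positivity))
    _ = _ := by field_simp

/-- Comparison with `w(0)` shows that `w` decays no faster than `√(1 - |z|)`. Hence the majorant
blows up at the circle, and a bounded derivative is negligible against it. -/
theorem inv_majorant_le (h : w.Regular) : ∃ C : ℝ, 0 < C ∧ ∀ z ∈ disk,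
    (majorant w z)⁻¹ ≤ C * √(1 - ‖z‖) := by
  obtain ⟨C, hC, h⟩ := h
  have h0 := w.pos 0 (by simp)
  refine ⟨2 * C / w.toFun 0, by positivity, fun z hz => ?_⟩
  have hs := norm_mem_Ico hz
  have hw := w.pos _ hs
  have ha : 0 < 1 - ‖z‖ := by linarith [hs.2]
  have hsq : 0 < √(1 - ‖z‖) := Real.sqrt_pos.2 ha
  have h1 := h 0 (by simp) _ hs
  rw [sub_zero, one_mul] at h1
  have h2 : w.toFun 0 ≤ 2 * C * w.toFun ‖z‖ / √(1 - ‖z‖) := by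
    refine h1.trans ?_
    rw [← mul_div_assoc]
    refine div_le_div_of_nonneg_right ?_ hsq.le
    nlinarith [mul_pos hC hw, hs.1]
  rw [le_div_iff₀ hsq] at h2
  rw [majorant, mul_inv, inv_inv, div_mul_eq_mul_div, le_div_iff₀ h0, ← div_eq_mul_inv,
    div_mul_eq_mul_div, div_le_iff₀ hw]
  have h3 : (1 - ‖z‖) = √(1 - ‖z‖) * √(1 - ‖z‖) := (Real.mul_self_sqrt ha.le).symm
  calc (1 - ‖z‖) * w.toFun 0 = √(1 - ‖z‖) * (w.toFun 0 * √(1 - ‖z‖)) := by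
        rw [mul_left_comm, ← h3, mul_comm]
    _ ≤ √(1 - ‖z‖) * (2 * C * w.toFun ‖z‖) := mul_le_mul_of_nonneg_left h2 hsq.le
    _ = _ := by ring

/-- The substitution `t = √((1 - r) / a)` gives an arctangent as antiderivative; bounding it by `π /
2` yields `π / a`. -/
theorem lintegral_kernel_le {a : ℝ} (ha : 0 < a) :
    ∫⁻ r in Ioo (0 : ℝ) 1, ENNReal.ofReal (1 / (((1 - r) + a) * √((1 - r) * a))) ≤
      ENNReal.ofReal (Real.pi / a) := by
  have hd : ∀ r ∈ Ioo (0 : ℝ) 1,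
      HasDerivAt (fun r => -(2 / a) * Real.arctan √((1 - r) / a))
        (1 / (((1 - r) + a) * √((1 - r) * a))) r := fun r hr => by
    have ht : 0 < 1 - r := by linarith [hr.2]
    have h1 : HasDerivAt (fun r : ℝ => (1 - r) / a) (-1 / a) r :=
      ((hasDerivAt_id r).const_sub 1).div_const a
    have h2 := ((h1.sqrt (by positivity)).arctan).const_mul (-(2 / a))
    refine h2.congr_deriv ?_
    have h3 : √((1 - r) * a) = √((1 - r) / a) * a := by
      conv_rhs => rw [← Real.sqrt_sq ha.le, ← Real.sqrt_mul (by positivity)]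
      rw [Real.sqrt_sq ha.le]
      congr 1
      field_simp
    have h4 : √((1 - r) / a) ≠ 0 := (Real.sqrt_pos.2 (by positivity)).ne'
    rw [h3, Real.sq_sqrt (by positivity)]
    field_simp
    ring
  have hc : ContinuousOn (fun r => -(2 / a) * Real.arctan √((1 - r) / a)) (Icc 0 1) := by
    refine Continuous.continuousOn ?_
    exact continuous_const.mul (Real.continuous_arctan.comp (Real.continuous_sqrt.comp (by fun_prop)))
  have hn : ∀ r ∈ Ioo (0 : ℝ) 1, 0 ≤ 1 / (((1 - r) + a) * √((1 - r) * a)) := fun r hr => by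
    have ht : 0 < 1 - r := by linarith [hr.2]
    positivity
  have hi := (intervalIntegral.integrableOn_deriv_of_nonneg hc hd hn)
  rw [← ofReal_integral_eq_lintegral_ofReal (hi.mono_set Ioo_subset_Ioc_self)
    ((ae_restrict_mem measurableSet_Ioo).mono hn)]
  refine ENNReal.ofReal_le_ofReal ?_
  rw [← integral_Ioc_eq_integral_Ioo, ← intervalIntegral.integral_of_le zero_le_one,
    intervalIntegral.integral_eq_sub_of_hasDerivAt_of_le zero_le_one hc hd
      ((intervalIntegrable_iff_integrableOn_Ioc_of_le zero_le_one).2 hi)]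
  have h5 := (Real.arctan_lt_pi_div_two √((1 - 0) / a)).le
  have h6 := mul_le_mul_of_nonneg_left h5 (show 0 ≤ 2 / a by positivity)
  have h7 : 2 / a * (Real.pi / 2) = Real.pi / a := by field_simp
  simp only [sub_self, zero_div, Real.sqrt_zero, Real.arctan_zero, mul_zero]
  linarith

/-- Since `1 - s r` is at least half of `(1 - r) + (1 - s)`, one factor of its square cancels the
numerator in the regularity bound, leaving the kernel integrated above. The `4` comes from squaring
the half, the `π` from the arctangent. -/
theorem lintegral_le (h : w.Regular) : ∃ C : ℝ, 0 < C ∧ ∀ s ∈ Ico (0 : ℝ) 1,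
    ∫⁻ r in Ioo (0 : ℝ) 1, ENNReal.ofReal (w.toFun r / (1 - s * r) ^ 2) ≤
      ENNReal.ofReal (C * ((1 - s)⁻¹ * w.toFun s)) := by
  obtain ⟨C, hC, h⟩ := h
  refine ⟨4 * C * Real.pi, by positivity, fun s hs => ?_⟩
  have ha : 0 < 1 - s := by linarith [hs.2]
  have hw := w.pos s hs
  have h1 : ∀ r ∈ Ioo (0 : ℝ) 1, ENNReal.ofReal (w.toFun r / (1 - s * r) ^ 2) ≤
      ENNReal.ofReal (4 * C * w.toFun s) *
        ENNReal.ofReal (1 / (((1 - r) + (1 - s)) * √((1 - r) * (1 - s)))) := fun r hr => by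
    have ht : 0 < 1 - r := by linarith [hr.2]
    have hq : 0 < √((1 - r) * (1 - s)) := by positivity
    rw [← ENNReal.ofReal_mul (by positivity)]
    refine ENNReal.ofReal_le_ofReal ?_
    have h2 : ((1 - r) + (1 - s)) / 2 ≤ 1 - s * r := by nlinarith [hr.1, hs.1, hr.2, hs.2]
    have h3 : (((1 - r) + (1 - s)) / 2) ^ 2 ≤ (1 - s * r) ^ 2 :=
      pow_le_pow_left₀ (by positivity) h2 2
    refine (div_le_div₀ (by positivity) (h r ⟨hr.1.le, hr.2⟩ s hs) (by positivity) h3).trans_eq ?_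
    field_simp
    norm_num
  refine (setLIntegral_mono' measurableSet_Ioo h1).trans ?_
  rw [lintegral_const_mul' _ _ ENNReal.ofReal_ne_top]
  refine (mul_le_mul_right (lintegral_kernel_le ha) _).trans_eq ?_
  rw [← ENNReal.ofReal_mul (by positivity)]
  congr 1
  field_simp

end Weight.Regular

/-! ### Regularity of the logarithmic weights. -/

theorem log_div_sub {c r s : ℝ} (hc : 0 < c) (hr : r < 1) (hs : s < 1) :
    Real.log (c / (1 - s)) = Real.log (c / (1 - r)) + Real.log ((1 - r) / (1 - s)) := by
  have hr' : 0 < 1 - r := by linarith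
  have hs' : 0 < 1 - s := by linarith
  rw [← Real.log_mul (by positivity) (by positivity)]
  congr 1
  field_simp

theorem exists_rpow_log_le (b : ℝ) (hb : 0 ≤ b) :
    ∃ C : ℝ, 0 < C ∧ ∀ x : ℝ, 1 ≤ x → (1 + Real.log x / Real.log 2) ^ b ≤ C * √x := by
  have h2 : 0 < Real.log 2 := Real.log_pos one_lt_two
  -- With this exponent, `log x ≤ x ^ ε / ε` raised to the power `b` costs at most `x ^ (1 / 2)`.
  have hε : 0 < 1 / (2 * (b + 1)) := by positivity
  refine ⟨(1 + 2 * (b + 1) / Real.log 2) ^ b, by positivity, fun x hx => ?_⟩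
  have hx0 : 0 ≤ Real.log x := Real.log_nonneg hx
  have h3 := Real.log_le_rpow_div (zero_le_one.trans hx) hε
  have h4 : (1 : ℝ) ≤ x ^ (1 / (2 * (b + 1))) := Real.one_le_rpow hx hε.le
  have h5 : 1 + Real.log x / Real.log 2 ≤
      (1 + 2 * (b + 1) / Real.log 2) * x ^ (1 / (2 * (b + 1))) := by
    have h6 : Real.log x / Real.log 2 ≤
        2 * (b + 1) / Real.log 2 * x ^ (1 / (2 * (b + 1))) := by
      rw [div_mul_eq_mul_div]
      refine div_le_div_of_nonneg_right ?_ h2.le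
      rw [div_div_eq_mul_div, div_one, mul_comm] at h3
      exact h3
    linarith
  refine (Real.rpow_le_rpow (by positivity) h5 hb).trans ?_
  rw [Real.mul_rpow (by positivity) (by positivity), ← Real.rpow_mul (by positivity),
    Real.sqrt_eq_rpow]
  refine mul_le_mul_of_nonneg_left (Real.rpow_le_rpow_of_exponent_le hx ?_) (by positivity)
  rw [div_mul_eq_mul_div, div_le_div_iff₀ (by positivity) (by positivity)]
  linarith

theorem one_le_div_one_sub {r s : ℝ} (hrs : r ≤ s) (hs : s < 1) : 1 ≤ (1 - r) / (1 - s) := by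
  rw [le_div_iff₀ (by linarith)]
  linarith

/-- The ratio `q` of the two logarithms is at least `1` and at most `1 + log x / log 2`. Both `q ^
α` and `q ^ (-α)` are at most `q ^ |α|`, which is `O(√x)`; this treats both signs of `α` at once. -/
theorem regular_logWeight (α : ℝ) : (logWeight α).Regular := by
  obtain ⟨C, hC, h⟩ := exists_rpow_log_le |α| (abs_nonneg α)
  refine Weight.Regular.of_le hC fun r s hr hrs hs => ?_
  have h2 : 0 < Real.log 2 := Real.log_pos one_lt_two
  have hx := one_le_div_one_sub hrs hs
  have hlr := log_two_div_pos (r := r) ⟨hr, hrs.trans_lt hs⟩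
  have hlr2 : Real.log 2 ≤ Real.log (2 / (1 - r)) :=
    Real.log_le_log two_pos (le_div_one_sub ⟨hr, hrs.trans_lt hs⟩ two_pos.le)
  have hls := log_div_sub two_pos (hrs.trans_lt hs) hs
  set x := (1 - r) / (1 - s)
  have hlx : 0 ≤ Real.log x := Real.log_nonneg hx
  set q := 1 + Real.log x / Real.log (2 / (1 - r)) with hq
  have hq1 : 1 ≤ q := by
    have : 0 ≤ Real.log x / Real.log (2 / (1 - r)) := by positivity
    linarith
  have hq2 : q ^ |α| ≤ C * √x := by
    refine (Real.rpow_le_rpow (by linarith) ?_ (abs_nonneg α)).trans (h x hx)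
    rw [hq]
    gcongr
  have hls' : Real.log (2 / (1 - s)) = q * Real.log (2 / (1 - r)) := by
    rw [hls, hq]
    field_simp
  have e1 : (logWeight α).toFun s = q ^ α * (logWeight α).toFun r := by
    simp only [logWeight]
    rw [hls', Real.mul_rpow (by linarith) hlr.le]
  have e2 : (logWeight α).toFun r = q ^ (-α) * (logWeight α).toFun s := by
    rw [e1, ← mul_assoc, ← Real.rpow_add (by linarith), neg_add_cancel, Real.rpow_zero, one_mul]
  constructor
  · rw [e1]
    refine mul_le_mul_of_nonneg_right (le_trans ?_ hq2)
      ((logWeight α).pos r ⟨hr, hrs.trans_lt hs⟩).le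
    exact Real.rpow_le_rpow_of_exponent_le hq1 (le_abs_self α)
  · rw [e2]
    refine mul_le_mul_of_nonneg_right (le_trans ?_ hq2)
      ((logWeight α).pos s ⟨hr.trans hrs, hs⟩).le
    exact Real.rpow_le_rpow_of_exponent_le hq1 (neg_le_abs α)

/-- The weight is increasing, and from `r` to `s` it grows by at most `log (1 + log x) ≤ log x ≤ 2
√x`. Its lower bound `m`, the value at `0`, turns this additive error into a multiplicative one. -/
theorem regular_loglogWeight : loglogWeight.Regular := by
  have hm := loglogWeight.pos 0 (by simp)
  set m := loglogWeight.toFun 0 with hm0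
  refine Weight.Regular.of_le (C := 1 + 2 / m) (by positivity) fun r s hr hrs hs => ?_
  have hx := one_le_div_one_sub hrs hs
  have hr1 := hrs.trans_lt hs
  have h1 := one_lt_log_four_div (r := r) ⟨hr, hr1⟩
  have hls := log_div_sub (c := 4) (by norm_num) hr1 hs
  have hwr := loglogWeight.pos r ⟨hr, hr1⟩
  have hmr : m ≤ loglogWeight.toFun r := by
    have h0 := one_lt_log_four_div (r := 0) (by simp)
    simp only [hm0, loglogWeight] at h0 ⊢
    refine Real.log_le_log (by linarith) (Real.log_le_log (by norm_num) ?_)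
    rw [sub_zero, div_one]
    exact le_div_one_sub ⟨hr, hr1⟩ (by norm_num)
  set x := (1 - r) / (1 - s)
  have hlx : 0 ≤ Real.log x := Real.log_nonneg hx
  have hsq : 1 ≤ √x := Real.one_le_sqrt.2 hx
  have hmono : loglogWeight.toFun r ≤ loglogWeight.toFun s := by
    simp only [loglogWeight]
    exact Real.log_le_log (by linarith) (by linarith)
  have hK : 1 ≤ (1 + 2 / m) * √x := by
    have : 0 < 2 / m := by positivity
    nlinarith
  have hlog : Real.log x ≤ 2 * √x := by
    have := Real.log_le_sub_one_of_pos (show 0 < √x by linarith)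
    rw [Real.log_sqrt (by linarith)] at this
    linarith
  constructor
  · have h3 : loglogWeight.toFun s ≤ loglogWeight.toFun r + Real.log x := by
      simp only [loglogWeight]
      calc Real.log (Real.log (4 / (1 - s)))
          ≤ Real.log (Real.log (4 / (1 - r)) * (1 + Real.log x)) := by
            -- Because `log (4 / (1 - r)) > 1`, adding `log x` costs no more than multiplying by `1
            -- + log x`.
            refine Real.log_le_log (by linarith) ?_
            rw [hls]
            nlinarith
        _ = Real.log (Real.log (4 / (1 - r))) + Real.log (1 + Real.log x) :=
            Real.log_mul (by linarith) (by linarith)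
        _ ≤ _ := by
            have := Real.log_le_sub_one_of_pos (show 0 < 1 + Real.log x by linarith)
            linarith
    have h4 : 2 * √x ≤ 2 / m * √x * loglogWeight.toFun r := by
      calc 2 * √x = 2 / m * √x * m := by field_simp
        _ ≤ _ := by gcongr
    nlinarith
  · nlinarith

/-! ### Integration over the disk -/

/-- A weight, extended by zero and with values in `[0, ∞]`. -/
def Weight.ennreal (w : Weight) (r : ℝ) : ENNReal :=
  ENNReal.ofReal ((Ico (0 : ℝ) 1).indicator w.toFun r)

theorem Weight.measurable_ennreal (w : Weight) : Measurable w.ennreal := by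
  refine ENNReal.measurable_ofReal.comp ?_
  classical
  rw [← piecewise_eq_indicator]
  exact w.cont.measurable_piecewise continuousOn_const measurableSet_Ico

theorem Weight.ennreal_apply (w : Weight) {r : ℝ} (hr : r ∈ Ico (0 : ℝ) 1) :
    w.ennreal r = ENNReal.ofReal (w.toFun r) := by
  rw [Weight.ennreal, indicator_of_mem hr]

theorem measurableSet_disk : MeasurableSet disk := isOpen_disk.measurableSet

/-- Polar coordinates on the unit disk. -/
theorem lintegral_disk {F : ℂ → ENNReal} (hF : Measurable F) :
    ∫⁻ z in disk, F z = ∫⁻ r in Ioo (0 : ℝ) 1, ENNReal.ofReal r *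
      ∫⁻ θ in Ioo (-Real.pi) Real.pi, F (r * Complex.exp (θ * Complex.I)) := by
  rw [← lintegral_indicator measurableSet_disk, ← Complex.lintegral_comp_polarCoord_symm]
  have h1 : polarCoord.target = Ioi (0 : ℝ) ×ˢ Ioo (-Real.pi) Real.pi := rfl
  have h2 : ∀ p : ℝ × ℝ, Complex.polarCoord.symm p = p.1 * Complex.exp (p.2 * Complex.I) :=
    fun p => by rw [Complex.polarCoord_symm_apply, Complex.exp_mul_I]; push_cast; rfl
  simp_rw [h2, smul_eq_mul]
  have hm : Measurable fun p : ℝ × ℝ => ENNReal.ofReal p.1 *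
      disk.indicator F (p.1 * Complex.exp (p.2 * Complex.I)) := by
    refine (ENNReal.measurable_ofReal.comp measurable_fst).mul
      ((hF.indicator measurableSet_disk).comp ?_)
    fun_prop
  rw [h1, Measure.volume_eq_prod, ← Measure.prod_restrict, lintegral_prod _ hm.aemeasurable,
    ← lintegral_indicator measurableSet_Ioi, ← lintegral_indicator measurableSet_Ioo]
  refine lintegral_congr fun r => ?_
  by_cases hr : r ∈ Ioo (0 : ℝ) 1
  · have hr' : r ∈ Ioi (0 : ℝ) := hr.1
    rw [indicator_of_mem hr, indicator_of_mem hr', lintegral_const_mul' _ _ ENNReal.ofReal_ne_top]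
    congr 1
    refine lintegral_congr fun θ => indicator_of_mem ?_ _
    rw [mem_disk, norm_mul, Complex.norm_exp_ofReal_mul_I, mul_one, Complex.norm_real,
      Real.norm_of_nonneg hr.1.le]
    exact hr.2
  · rw [indicator_of_notMem hr]
    by_cases hr0 : 0 < r
    · have hr' : r ∈ Ioi (0 : ℝ) := hr0
      rw [indicator_of_mem hr', lintegral_const_mul' _ _ ENNReal.ofReal_ne_top]
      have : ∀ θ : ℝ, disk.indicator F (r * Complex.exp (θ * Complex.I)) = 0 := fun θ => by
        refine indicator_of_notMem (fun h => hr ⟨hr0, ?_⟩) _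
        rwa [mem_disk, norm_mul, Complex.norm_exp_ofReal_mul_I, mul_one, Complex.norm_real,
          Real.norm_of_nonneg hr0.le] at h
      simp [this]
    · have hr' : r ∉ Ioi (0 : ℝ) := hr0
      rw [indicator_of_notMem hr']

/-- Termwise integration of a power series. -/
theorem hasSum_integral_powerSeries {Ω : Type*} [MeasurableSpace Ω] {μ : Measure Ω} {φ u : Ω → ℂ}
    (hφ : AEStronglyMeasurable φ μ) (hφ1 : ∀ᵐ ω ∂μ, ‖φ ω‖ ≤ 1) (hu : Integrable u μ)
    {b : ℕ → ℂ} {H : ℂ → ℂ} (hH : ∀ z ∈ disk, HasSum (fun n => b n * z ^ n) (H z))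
    {l : ℂ} (hl : l ∈ disk) :
    HasSum (fun n => b n * l ^ n * ∫ ω, φ ω ^ n * u ω ∂μ) (∫ ω, H (l * φ ω) * u ω ∂μ) := by
  have hint : ∀ n, Integrable (fun ω => φ ω ^ n * u ω) μ := fun n => by
    refine hu.norm.mono' ((hφ.pow n).mul hu.1) ?_
    filter_upwards [hφ1] with ω hω
    rw [norm_mul, norm_pow]
    exact mul_le_of_le_one_left (norm_nonneg _) (pow_le_one₀ (norm_nonneg _) hω)
  have hb := IsTaylor.of_hasSum hH ‖l‖ (norm_mem_Ico hl)
  have h1 : ∀ n, Integrable (fun ω => b n * l ^ n * (φ ω ^ n * u ω)) μ := fun n =>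
    (hint n).const_mul _
  have h2 : Summable fun n => ∫ ω, ‖b n * l ^ n * (φ ω ^ n * u ω)‖ ∂μ := by
    refine (hb.mul_right (∫ ω, ‖u ω‖ ∂μ)).of_nonneg_of_le
      (fun n => integral_nonneg fun ω => norm_nonneg _) fun n => ?_
    rw [← integral_const_mul]
    refine integral_mono_ae (h1 n).norm (hu.norm.const_mul _) ?_
    filter_upwards [hφ1] with ω hω
    rw [norm_mul, norm_mul (b n), norm_pow, norm_mul, norm_pow]
    refine mul_le_mul_of_nonneg_left ?_ (by positivity)
    exact mul_le_of_le_one_left (norm_nonneg _) (pow_le_one₀ (norm_nonneg _) hω)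
  have h3 := hasSum_integral_of_summable_integral_norm h1 h2
  simp_rw [integral_const_mul] at h3
  have h4 : ∫ ω, H (l * φ ω) * u ω ∂μ = ∫ ω, ∑' n, b n * l ^ n * (φ ω ^ n * u ω) ∂μ := by
    refine integral_congr_ae ?_
    filter_upwards [hφ1] with ω hω
    have hz : l * φ ω ∈ disk := by
      rw [mul_comm]
      exact mul_mem_disk hω hl
    rw [← (hH _ hz).tsum_eq, ← tsum_mul_right]
    refine tsum_congr fun n => ?_
    rw [mul_pow]
    ring
  rw [h4]
  exact h3

/-! ### Integral means -/

/-- The unimodular conjugate sign of a complex number. -/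
def conjSign (z : ℂ) : ℂ := (starRingEnd ℂ) z / ‖z‖

theorem mul_conjSign (z : ℂ) : z * conjSign z = ‖z‖ := by
  rw [conjSign, ← mul_div_assoc, Complex.mul_conj, Complex.normSq_eq_norm_sq]
  rcases eq_or_ne (‖z‖ : ℂ) 0 with h | h
  · rw [h, div_zero]
  · field_simp
    push_cast
    ring

theorem norm_conjSign_le (z : ℂ) : ‖conjSign z‖ ≤ 1 := by
  rw [conjSign, norm_div, RCLike.norm_conj, Complex.norm_real, norm_norm]
  exact div_self_le_one _

theorem measurable_conjSign : Measurable conjSign := by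
  unfold conjSign
  exact (Complex.continuous_conj.measurable).div (by fun_prop)

theorem circle_mem_disk {l : ℂ} (hl : l ∈ disk) (θ : ℝ) :
    l * Complex.exp (θ * Complex.I) ∈ disk := by
  rw [mul_comm]
  exact mul_mem_disk (Complex.norm_exp_ofReal_mul_I θ).le hl

/-- The argument of `l` only translates `θ`, and the integrand is periodic. -/
theorem integral_norm_circle_rotate (H : ℂ → ℂ) (l : ℂ) :
    ∫ θ in Ioo (-Real.pi) Real.pi, ‖H (l * Complex.exp (θ * Complex.I))‖ =
      ∫ θ in Ioo (-Real.pi) Real.pi, ‖H (‖l‖ * Complex.exp (θ * Complex.I))‖ := by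
  have hper : Function.Periodic (fun θ : ℝ => ‖H (‖l‖ * Complex.exp (θ * Complex.I))‖)
      (2 * Real.pi) := fun θ => by
    simp only
    rw [Complex.ofReal_add, add_mul, Complex.exp_add]
    push_cast
    rw [Complex.exp_two_pi_mul_I, mul_one]
  have h1 : ∀ θ : ℝ, ‖H (l * Complex.exp (θ * Complex.I))‖ =
      ‖H (‖l‖ * Complex.exp (((θ + l.arg : ℝ) : ℂ) * Complex.I))‖ := fun θ => by
    rw [Complex.ofReal_add, add_mul, Complex.exp_add, mul_comm (Complex.exp (θ * Complex.I)),
      ← mul_assoc, Complex.norm_mul_exp_arg_mul_I]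
  have hpi : -Real.pi ≤ Real.pi := by linarith [Real.pi_pos]
  simp_rw [h1]
  rw [← integral_Ioc_eq_integral_Ioo, ← integral_Ioc_eq_integral_Ioo,
    ← intervalIntegral.integral_of_le hpi, ← intervalIntegral.integral_of_le hpi,
    intervalIntegral.integral_comp_add_right
      (fun θ : ℝ => ‖H (‖l‖ * Complex.exp (θ * Complex.I))‖)]
  have := hper.intervalIntegral_add_eq (-Real.pi + l.arg) (-Real.pi)
  convert this using 2 <;> ring

/-- Integral means increase with the radius, by linearization and the maximum principle: integrating
`H (l * exp (θ * I))` against a fixed bounded `u` gives a holomorphic function of `l`, bounded on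
`|l| = r` by the mean at radius `r`. -/
theorem integral_norm_circle_mono {H : ℂ → ℂ} (hH : DifferentiableOn ℂ H disk) {ρ r : ℝ}
    (hρ : ρ ∈ Icc (0 : ℝ) 1) (hr : r ∈ Ioo (0 : ℝ) 1) :
    ∫ θ in Ioo (-Real.pi) Real.pi, ‖H (((ρ * r : ℝ) : ℂ) * Complex.exp (θ * Complex.I))‖ ≤
      ∫ θ in Ioo (-Real.pi) Real.pi, ‖H (r * Complex.exp (θ * Complex.I))‖ := by
  have hcont : ∀ l ∈ disk, Continuous fun θ : ℝ => H (l * Complex.exp (θ * Complex.I)) :=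
    fun l hl => hH.continuousOn.comp_continuous (by fun_prop) (circle_mem_disk hl)
  have hint : ∀ l ∈ disk, IntegrableOn (fun θ : ℝ => H (l * Complex.exp (θ * Complex.I)))
      (Ioo (-Real.pi) Real.pi) := fun l hl =>
    ((hcont l hl).integrableOn_Icc).mono_set Ioo_subset_Icc_self
  have hrd : ∀ l : ℂ, ‖l‖ ≤ r → l ∈ disk := fun l hl => mem_disk.2 (hl.trans_lt hr.2)
  have hn : ‖((ρ * r : ℝ) : ℂ)‖ ≤ r := by
    rw [Complex.norm_real, Real.norm_of_nonneg (mul_nonneg hρ.1 hr.1.le)]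
    exact mul_le_of_le_one_left hr.1.le hρ.2
  set l₀ : ℂ := ((ρ * r : ℝ) : ℂ)
  have hl₀ := hrd l₀ hn
  -- The sign is taken at `l₀` and frozen as `l` varies, so that `ψ` is holomorphic while `ψ l₀` is
  -- the integral of the modulus.
  set u : ℝ → ℂ := fun θ => conjSign (H (l₀ * Complex.exp (θ * Complex.I))) with hu
  have humeas : Measurable u := measurable_conjSign.comp (hcont l₀ hl₀).measurable
  have hu1 : ∀ θ, ‖u θ‖ ≤ 1 := fun θ => norm_conjSign_le _
  have huint : IntegrableOn u (Ioo (-Real.pi) Real.pi) :=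
    Measure.integrableOn_of_bounded (M := 1) measure_Ioo_lt_top.ne humeas.aestronglyMeasurable
      (Eventually.of_forall hu1)
  have hHs : ∀ z ∈ disk, HasSum (fun n => coeff H n * z ^ n) (H z) := fun z hz => by
    have h := Complex.hasSum_taylorSeries_on_ball hH hz
    refine h.congr_fun fun n => ?_
    simp only [sub_zero, smul_eq_mul, coeff]
    ring
  set ψ : ℂ → ℂ := fun l => ∫ θ in Ioo (-Real.pi) Real.pi, H (l * Complex.exp (θ * Complex.I)) * u θ
    with hψ
  have hψs : ∀ l ∈ disk, HasSum (fun n => (coeff H n * ∫ θ in Ioo (-Real.pi) Real.pi,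
      Complex.exp (θ * Complex.I) ^ n * u θ) * l ^ n) (ψ l) := fun l hl => by
    refine (hasSum_integral_powerSeries (φ := fun θ : ℝ => Complex.exp (θ * Complex.I))
      (μ := volume.restrict (Ioo (-Real.pi) Real.pi)) (Continuous.aestronglyMeasurable (by fun_prop))
      (Eventually.of_forall fun θ => (Complex.norm_exp_ofReal_mul_I θ).le) huint hHs hl).congr_fun
      fun n => by ring
  have hψd : DifferentiableOn ℂ ψ disk := by
    have := (hasFPowerSeriesOnBall_of_hasSum hψs).differentiableOn
    rwa [eball_zero_one] at this
  have hψle : ∀ l ∈ disk, ‖ψ l‖ ≤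
      ∫ θ in Ioo (-Real.pi) Real.pi, ‖H (‖l‖ * Complex.exp (θ * Complex.I))‖ := fun l hl => by
    rw [← integral_norm_circle_rotate]
    refine norm_integral_le_of_norm_le (hint l hl).norm (Eventually.of_forall fun θ => ?_)
    rw [norm_mul]
    exact mul_le_of_le_one_right (norm_nonneg _) (hu1 θ)
  have hψ0 : ψ l₀ = ((∫ θ in Ioo (-Real.pi) Real.pi,
      ‖H (l₀ * Complex.exp (θ * Complex.I))‖ : ℝ) : ℂ) := by
    rw [hψ, ← integral_complex_ofReal]
    refine integral_congr_ae (Eventually.of_forall fun θ => ?_)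
    exact mul_conjSign _
  have hmax : ‖ψ l₀‖ ≤ ∫ θ in Ioo (-Real.pi) Real.pi, ‖H (r * Complex.exp (θ * Complex.I))‖ := by
    have hcl : closure (Metric.ball (0 : ℂ) r) = Metric.closedBall 0 r := closure_ball _ hr.1.ne'
    refine Complex.norm_le_of_forall_mem_frontier_norm_le (U := Metric.ball (0 : ℂ) r)
      Metric.isBounded_ball ?_ (fun z hz => ?_) ?_
    · refine (hψd.mono ?_).diffContOnCl
      rw [hcl]
      exact fun z hz => hrd z (by simpa using hz)
    · rw [frontier_ball _ hr.1.ne', mem_sphere_zero_iff_norm] at hz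
      have := hψle z (hrd z hz.le)
      rwa [hz] at this
    · rw [hcl]
      simpa using hn
  rw [hψ0, Complex.norm_real, Real.norm_of_nonneg (integral_nonneg fun θ => norm_nonneg _)] at hmax
  exact hmax

/-- Weighted area integrals of holomorphic functions do not increase under dilation. -/
theorem lintegral_dilate_le {H : ℂ → ℂ} (hH : DifferentiableOn ℂ H disk) (hHm : Measurable H)
    {V : ℝ → ENNReal} (hV : Measurable V) {ρ : ℝ} (hρ : ρ ∈ Icc (0 : ℝ) 1) :
    ∫⁻ z in disk, ‖H (ρ * z)‖ₑ * V ‖z‖ ≤ ∫⁻ z in disk, ‖H z‖ₑ * V ‖z‖ := by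
  have hVn : Measurable fun z : ℂ => V ‖z‖ := hV.comp measurable_norm
  have hHρ : Measurable fun z : ℂ => H (ρ * z) := hHm.comp (by fun_prop)
  rw [lintegral_disk (F := fun z => ‖H (ρ * z)‖ₑ * V ‖z‖) (hHρ.enorm.mul hVn),
    lintegral_disk (F := fun z => ‖H z‖ₑ * V ‖z‖) (hHm.enorm.mul hVn)]
  refine setLIntegral_mono' measurableSet_Ioo fun r hr => mul_le_mul_right ?_ _
  have hn : ∀ θ : ℝ, ‖(r : ℂ) * Complex.exp (θ * Complex.I)‖ = r := fun θ => by
    rw [norm_mul, Complex.norm_exp_ofReal_mul_I, mul_one, Complex.norm_real,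
      Real.norm_of_nonneg hr.1.le]
  simp_rw [hn]
  have hcont : ∀ l ∈ disk, Continuous fun θ : ℝ => H (l * Complex.exp (θ * Complex.I)) :=
    fun l hl => hH.continuousOn.comp_continuous (by fun_prop) (circle_mem_disk hl)
  have h1 : ∀ l ∈ disk, ∫⁻ θ in Ioo (-Real.pi) Real.pi, ‖H (l * Complex.exp (θ * Complex.I))‖ₑ =
      ENNReal.ofReal (∫ θ in Ioo (-Real.pi) Real.pi, ‖H (l * Complex.exp (θ * Complex.I))‖) :=
    fun l hl => by
      rw [ofReal_integral_norm_eq_lintegral_enorm]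
      exact ((hcont l hl).integrableOn_Icc).mono_set Ioo_subset_Icc_self
  have hrd : (r : ℂ) ∈ disk := by
    rw [mem_disk, Complex.norm_real, Real.norm_of_nonneg hr.1.le]
    exact hr.2
  have hρ1 : ‖(ρ : ℂ)‖ ≤ 1 := by
    rw [Complex.norm_real, Real.norm_of_nonneg hρ.1]
    exact hρ.2
  rw [lintegral_mul_const _ (by fun_prop), lintegral_mul_const _ (by fun_prop)]
  refine mul_le_mul_left ?_ _
  rw [h1 _ hrd]
  simp_rw [← mul_assoc]
  rw [h1 _ (mul_mem_disk hρ1 hrd)]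
  refine ENNReal.ofReal_le_ofReal ?_
  have := integral_norm_circle_mono hH hρ hr
  rwa [Complex.ofReal_mul] at this

/-! ### The kernel estimate -/

/-- On the unit circle `|1 - v e^{iθ}| = |e^{iθ} - v̄|`, so up to the factor `1 - |v|²` this is the
Poisson kernel at `v̄`, whose mean is `1`. -/
theorem lintegral_circle_kernel {v : ℂ} (hv : v ∈ disk) :
    ∫⁻ θ in Ioo (-Real.pi) Real.pi,
      ENNReal.ofReal (1 / ‖1 - v * Complex.exp (θ * Complex.I)‖ ^ 2) =
      ENNReal.ofReal (2 * Real.pi / (1 - ‖v‖ ^ 2)) := by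
  have hv1 := norm_mem_Ico hv
  have hv2 : 0 < 1 - ‖v‖ ^ 2 := by nlinarith [hv1.1, hv1.2]
  have hne : ∀ θ : ℝ, 0 < ‖1 - v * Complex.exp (θ * Complex.I)‖ := fun θ => by
    rw [norm_pos_iff, sub_ne_zero]
    intro h
    have := mem_disk.1 (circle_mem_disk hv θ)
    rw [← h, norm_one] at this
    exact lt_irrefl _ this
  have hcont : Continuous fun θ : ℝ => 1 / ‖1 - v * Complex.exp (θ * Complex.I)‖ ^ 2 :=
    continuous_const.div (by fun_prop) fun θ => (pow_pos (hne θ) 2).ne'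
  have hpi : -Real.pi ≤ Real.pi := by linarith [Real.pi_pos]
  have hw : (starRingEnd ℂ) v ∈ Metric.ball (0 : ℂ) 1 := by
    simpa using mem_disk.1 hv
  have h1 := DiffContOnCl.circleAverage_poissonKernel_smul' (f := fun _ => (1 : ℂ)) (c := 0)
    diffContOnCl_const hw
  rw [Real.circleAverage_eq_integral_add (-Real.pi)] at h1
  have h2 : ∀ θ : ℝ, ((‖circleMap 0 1 θ - 0‖ ^ 2 - ‖(starRingEnd ℂ) v - 0‖ ^ 2) /
      ‖(circleMap 0 1 θ - 0) - ((starRingEnd ℂ) v - 0)‖ ^ 2) • (1 : ℂ) =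
      (((1 - ‖v‖ ^ 2) * (1 / ‖1 - v * Complex.exp (θ * Complex.I)‖ ^ 2) : ℝ) : ℂ) := fun θ => by
    have h3 : ‖1 - v * Complex.exp (θ * Complex.I)‖ =
        ‖Complex.exp (θ * Complex.I) - (starRingEnd ℂ) v‖ := by
      have h4 : (starRingEnd ℂ) (1 - v * Complex.exp (θ * Complex.I)) *
          Complex.exp (θ * Complex.I) = Complex.exp (θ * Complex.I) - (starRingEnd ℂ) v := by
        rw [map_sub, map_one, map_mul, ← Complex.exp_conj, sub_mul, one_mul, mul_assoc,
          ← Complex.exp_add]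
        simp
      rw [← h4, norm_mul, Complex.norm_exp_ofReal_mul_I, mul_one, RCLike.norm_conj]
    rw [h3]
    simp only [sub_zero, circleMap, zero_add, Complex.ofReal_one, one_mul,
      Complex.norm_exp_ofReal_mul_I, RCLike.norm_conj, one_pow, Complex.real_smul, mul_one]
    rw [mul_one_div]
  simp_rw [h2] at h1
  rw [intervalIntegral.integral_comp_add_right (fun θ : ℝ =>
    (((1 - ‖v‖ ^ 2) * (1 / ‖1 - v * Complex.exp (θ * Complex.I)‖ ^ 2) : ℝ) : ℂ)),
    intervalIntegral.integral_ofReal, intervalIntegral.integral_const_mul, zero_add,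
    show 2 * Real.pi + -Real.pi = Real.pi by ring, Complex.real_smul, ← Complex.ofReal_mul,
    Complex.ofReal_eq_one, intervalIntegral.integral_of_le hpi, integral_Ioc_eq_integral_Ioo] at h1
  rw [← ofReal_integral_eq_lintegral_ofReal
    (hcont.integrableOn_Icc.mono_set Ioo_subset_Icc_self)
    (Eventually.of_forall fun θ => by positivity)]
  congr 1
  field_simp at h1
  rw [eq_div_iff hv2.ne', mul_comm]
  exact h1

/-- In polar coordinates one of the three factors `|1 - ζz|` is bounded below by `1 - |ζ| r`, and
the other two integrate over the circle as a Poisson kernel. What remains is the radial estimate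
`lintegral_le`. -/
theorem Weight.Regular.lintegral_disk_kernel_le {w : Weight} (h : w.Regular) :
    ∃ C : ℝ, 0 < C ∧ ∀ ζ ∈ disk,
      ∫⁻ z in disk, w.ennreal ‖z‖ * ENNReal.ofReal (1 / ‖1 - ζ * z‖ ^ 3) ≤
        ENNReal.ofReal (C * majorant w ζ) := by
  obtain ⟨C, hC, h⟩ := h.lintegral_le
  refine ⟨2 * Real.pi * C, by positivity, fun ζ hζ => ?_⟩
  have hwn : Measurable fun z : ℂ => w.ennreal ‖z‖ := w.measurable_ennreal.comp measurable_norm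
  rw [lintegral_disk (F := fun z => w.ennreal ‖z‖ * ENNReal.ofReal (1 / ‖1 - ζ * z‖ ^ 3))
    (hwn.mul (by fun_prop))]
  have h1 : ∀ r ∈ Ioo (0 : ℝ) 1, ENNReal.ofReal r * ∫⁻ θ in Ioo (-Real.pi) Real.pi,
      w.ennreal ‖r * Complex.exp (θ * Complex.I)‖ *
        ENNReal.ofReal (1 / ‖1 - ζ * (r * Complex.exp (θ * Complex.I))‖ ^ 3) ≤
      ENNReal.ofReal (2 * Real.pi) * ENNReal.ofReal (w.toFun r / (1 - ‖ζ‖ * r) ^ 2) := by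
    intro r hr
    have hζ' := norm_mem_Ico hζ
    have hw := w.pos r ⟨hr.1.le, hr.2⟩
    have hv : ‖ζ * r‖ = ‖ζ‖ * r := by
      rw [norm_mul, Complex.norm_real, Real.norm_of_nonneg hr.1.le]
    have hx : 0 < 1 - ‖ζ‖ * r := by nlinarith [hr.1, hr.2, hζ'.1, hζ'.2]
    have hvd : ζ * r ∈ disk := by
      rw [mem_disk, hv]
      linarith
    have h2 : ∀ θ : ℝ, w.ennreal ‖r * Complex.exp (θ * Complex.I)‖ *
        ENNReal.ofReal (1 / ‖1 - ζ * (r * Complex.exp (θ * Complex.I))‖ ^ 3) ≤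
        ENNReal.ofReal (w.toFun r / (1 - ‖ζ‖ * r)) *
          ENNReal.ofReal (1 / ‖1 - (ζ * r) * Complex.exp (θ * Complex.I)‖ ^ 2) := fun θ => by
      have hn : ‖(r : ℂ) * Complex.exp (θ * Complex.I)‖ = r := by
        rw [norm_mul, Complex.norm_exp_ofReal_mul_I, mul_one, Complex.norm_real,
          Real.norm_of_nonneg hr.1.le]
      rw [hn, w.ennreal_apply ⟨hr.1.le, hr.2⟩, ← ENNReal.ofReal_mul hw.le,
        ← ENNReal.ofReal_mul (by positivity), mul_assoc]
      refine ENNReal.ofReal_le_ofReal ?_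
      have h3 : 1 - ‖ζ‖ * r ≤ ‖1 - ζ * (r * Complex.exp (θ * Complex.I))‖ := by
        have := norm_sub_norm_le (1 : ℂ) (ζ * (r * Complex.exp (θ * Complex.I)))
        rwa [norm_one, norm_mul, hn] at this
      have h4 : 0 < ‖1 - ζ * (r * Complex.exp (θ * Complex.I))‖ := hx.trans_le h3
      set q := ‖1 - ζ * (r * Complex.exp (θ * Complex.I))‖
      rw [div_mul_div_comm, mul_one, mul_one_div]
      refine div_le_div_of_nonneg_left hw.le (by positivity) ?_
      rw [pow_succ' q 2]
      exact mul_le_mul_of_nonneg_right h3 (by positivity)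
    have hr1 : ENNReal.ofReal r ≤ 1 := by
      rw [← ENNReal.ofReal_one]
      exact ENNReal.ofReal_le_ofReal hr.2.le
    refine (mul_le_of_le_one_left' hr1).trans ((lintegral_mono h2).trans ?_)
    rw [lintegral_const_mul' _ _ ENNReal.ofReal_ne_top, lintegral_circle_kernel hvd, hv,
      ← ENNReal.ofReal_mul (by positivity), ← ENNReal.ofReal_mul (by positivity)]
    refine ENNReal.ofReal_le_ofReal ?_
    have h5 : 1 - (‖ζ‖ * r) ^ 2 = (1 - ‖ζ‖ * r) * (1 + ‖ζ‖ * r) := by ring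
    have h6 : 0 ≤ ‖ζ‖ * r := mul_nonneg hζ'.1 hr.1.le
    rw [h5, div_mul_div_comm, ← mul_div_assoc]
    refine div_le_div₀ (by positivity) (by linarith) (by positivity) ?_
    rw [sq]
    refine mul_le_mul_of_nonneg_left ?_ hx.le
    nlinarith
  refine (setLIntegral_mono' measurableSet_Ioo h1).trans ?_
  rw [lintegral_const_mul' _ _ ENNReal.ofReal_ne_top]
  refine (mul_le_mul_right (h ‖ζ‖ (norm_mem_Ico hζ)) _).trans_eq ?_
  rw [← ENNReal.ofReal_mul (by positivity), majorant]
  congr 1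
  ring

/-! ### Boundedness of the pairing -/

theorem measurePreserving_disk (e : ℂ ≃ₗᵢ[ℝ] ℂ) :
    MeasurePreserving e (volume.restrict disk) (volume.restrict disk) := by
  have h := e.measurePreserving.restrict_preimage measurableSet_disk
  have h2 : e ⁻¹' disk = disk := by
    ext z
    rw [mem_preimage, mem_disk, mem_disk, e.norm_map]
  rwa [h2] at h

theorem integral_disk_isometry (e : ℂ ≃ₗᵢ[ℝ] ℂ) (F : ℂ → ℂ) :
    ∫ z in disk, F (e z) = ∫ z in disk, F z :=
  (measurePreserving_disk e).integral_comp e.toHomeomorph.measurableEmbedding F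

theorem lintegral_disk_isometry (e : ℂ ≃ₗᵢ[ℝ] ℂ) (F : ℂ → ENNReal) :
    ∫⁻ z in disk, F (e z) = ∫⁻ z in disk, F z :=
  (measurePreserving_disk e).lintegral_comp_emb e.toHomeomorph.measurableEmbedding F

/-- Rotation by the angle `π / (m - n)` preserves the measure and changes the sign of the integrand.
-/
theorem integral_disk_moment_ne {m n : ℕ} (hmn : m ≠ n) :
    ∫ z in disk, (starRingEnd ℂ) z ^ n * (z ^ m * (1 - (‖z‖ : ℂ) ^ 2)) = 0 := by
  set d : ℝ := (m : ℝ) - n with hd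
  have hd0 : d ≠ 0 := sub_ne_zero.2 (by exact_mod_cast hmn)
  set F : ℂ → ℂ := fun z => (starRingEnd ℂ) z ^ n * (z ^ m * (1 - (‖z‖ : ℂ) ^ 2)) with hF
  have h := integral_disk_isometry (rotation (Circle.exp (Real.pi / d))) F
  have h1 : ∀ z, F (rotation (Circle.exp (Real.pi / d)) z) = -F z := fun z => by
    have h2 : (starRingEnd ℂ) (Complex.exp ((Real.pi / d : ℝ) * Complex.I)) ^ n *
        Complex.exp ((Real.pi / d : ℝ) * Complex.I) ^ m = -1 := by
      rw [← Complex.exp_conj, ← Complex.exp_nat_mul, ← Complex.exp_nat_mul, ← Complex.exp_add,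
        ← Complex.exp_pi_mul_I]
      congr 1
      rw [map_mul, Complex.conj_ofReal, Complex.conj_I]
      have h3 : ((m : ℂ) - n) = (d : ℂ) := by rw [hd]; push_cast; rfl
      have h4 : (d : ℂ) ≠ 0 := by exact_mod_cast hd0
      calc _ = ((m : ℂ) - n) * ((Real.pi / d : ℝ) * Complex.I) := by ring
        _ = _ := by
          rw [h3]
          push_cast
          field_simp
    simp only [hF]
    rw [(rotation _).norm_map, rotation_apply, Circle.coe_exp, map_mul, mul_pow, mul_pow]
    linear_combination ((starRingEnd ℂ) z ^ n * z ^ m * (1 - (‖z‖ : ℂ) ^ 2)) * h2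
  simp_rw [h1] at h
  rw [integral_neg] at h
  have : (2 : ℂ) * ∫ z in disk, F z = 0 := by linear_combination -h
  simpa using this

/-- Radially this is `2π ∫ (r^(2n+1) - r^(2n+3)) dr`. Multiplied by the `(n+1)²` of the two
derivatives and divided by `π`, it gives the multiplier `(n+1)/(n+2)` of the pairing integral. -/
theorem integral_disk_moment_self (n : ℕ) :
    ∫ z in disk, (starRingEnd ℂ) z ^ n * (z ^ n * (1 - (‖z‖ : ℂ) ^ 2)) =
      (Real.pi / ((n + 1) * (n + 2)) : ℂ) := by
  have h1 : ∀ z : ℂ, disk.indicator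
      (fun z => (starRingEnd ℂ) z ^ n * (z ^ n * (1 - (‖z‖ : ℂ) ^ 2))) z =
      (((Iio (1 : ℝ)).indicator (fun r => r ^ (2 * n) - r ^ (2 * n + 2)) ‖z‖ : ℝ) : ℂ) :=
    fun z => by
      by_cases hz : z ∈ disk
      · have hz' : ‖z‖ ∈ Iio (1 : ℝ) := mem_disk.1 hz
        rw [indicator_of_mem hz, indicator_of_mem hz', ← mul_assoc, ← mul_pow,
          mul_comm _ z, Complex.mul_conj, Complex.normSq_eq_norm_sq]
        push_cast
        ring
      · have hz' : ‖z‖ ∉ Iio (1 : ℝ) := fun h => hz (mem_disk.2 h)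
        rw [indicator_of_notMem hz, indicator_of_notMem hz', Complex.ofReal_zero]
  rw [← integral_indicator measurableSet_disk]
  simp_rw [h1]
  rw [integral_complex_ofReal, integral_fun_norm_addHaar volume
    (fun r => (Iio (1 : ℝ)).indicator (fun r => r ^ (2 * n) - r ^ (2 * n + 2)) r)]
  have h2 : ∫ y in Ioi (0 : ℝ), y ^ (Module.finrank ℝ ℂ - 1) •
      (Iio (1 : ℝ)).indicator (fun r => r ^ (2 * n) - r ^ (2 * n + 2)) y =
      1 / (2 * (n + 1) * (n + 2)) := by
    have h3 : ∀ y : ℝ, y ^ (Module.finrank ℝ ℂ - 1) •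
        (Iio (1 : ℝ)).indicator (fun r => r ^ (2 * n) - r ^ (2 * n + 2)) y =
        (Iio (1 : ℝ)).indicator (fun r => r ^ (2 * n + 1) - r ^ (2 * n + 3)) y := fun y => by
      rw [Complex.finrank_real_complex]
      by_cases hy : y ∈ Iio (1 : ℝ)
      · rw [indicator_of_mem hy, indicator_of_mem hy, smul_eq_mul]
        ring
      · rw [indicator_of_notMem hy, indicator_of_notMem hy, smul_zero]
    simp_rw [h3]
    rw [setIntegral_indicator measurableSet_Iio, Ioi_inter_Iio, ← integral_Ioc_eq_integral_Ioo,
      ← intervalIntegral.integral_of_le zero_le_one, intervalIntegral.integral_sub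
        (Continuous.intervalIntegrable (by fun_prop) _ _)
        (Continuous.intervalIntegrable (by fun_prop) _ _), integral_pow, integral_pow]
    push_cast
    rw [one_pow, one_pow, zero_pow (by omega), zero_pow (by omega)]
    have : (0 : ℝ) ≤ n := n.cast_nonneg
    field_simp
    ring
  have h4 : (volume : Measure ℂ).real (Metric.ball 0 1) = Real.pi := by
    simp [Measure.real, Complex.volume_ball]
  rw [h2, h4, Complex.finrank_real_complex]
  have : ((n : ℂ) + 1) ≠ 0 := by exact_mod_cast n.succ_ne_zero
  have : ((n : ℂ) + 2) ≠ 0 := by exact_mod_cast (n + 1).succ_ne_zero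
  simp only [nsmul_eq_mul, smul_eq_mul]
  push_cast
  field_simp

theorem exists_bound_deriv_dilate {g : ℂ → ℂ} (hg : g ∈ Hol) {r : ℝ} (hr : r ∈ Ico (0 : ℝ) 1) :
    ∃ C, ∀ z, ‖z‖ ≤ r → ‖deriv g z‖ ≤ C := by
  have hs : Metric.closedBall (0 : ℂ) r ⊆ disk := fun z hz =>
    mem_disk.2 ((by simpa using hz : ‖z‖ ≤ r).trans_lt hr.2)
  obtain ⟨C, hC⟩ := (isCompact_closedBall (0 : ℂ) r).exists_bound_of_continuousOn
    ((Hol.continuousOn_deriv hg).mono hs)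
  exact ⟨C, fun z hz => hC z (by simpa using hz)⟩

theorem volume_disk_ne_top : volume disk ≠ ⊤ := measure_ball_lt_top.ne

/-- The integral form of the pairing. -/
theorem hasSum_pairing_integral {f g : ℂ → ℂ} (hf : f ∈ Hol) (hg : g ∈ Hol) {r : ℝ}
    (hr : r ∈ Ico (0 : ℝ) 1) :
    HasSum (fun m : ℕ => ((m + 1) / (m + 2) * (coeff f (m + 1) * coeff g (m + 1))) *
      ((r : ℂ) ^ 2) ^ m)
      ((Real.pi : ℂ)⁻¹ * ∫ z in disk, deriv f (r * z) *
        (deriv g (r * (starRingEnd ℂ) z) * (1 - (‖z‖ : ℂ) ^ 2))) := by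
  have hrd : (r : ℂ) ∈ disk := by
    rw [mem_disk, Complex.norm_real, Real.norm_of_nonneg hr.1]
    exact hr.2
  obtain ⟨C, hC⟩ := exists_bound_deriv_dilate hg hr
  have hfin : ∀ {φ : ℂ → ℂ} {M : ℝ}, Measurable φ → (∀ z ∈ disk, ‖φ z‖ ≤ M) →
      IntegrableOn φ disk := fun hφ hM =>
    Measure.integrableOn_of_bounded volume_disk_ne_top hφ.aestronglyMeasurable
      ((ae_restrict_mem measurableSet_disk).mono hM)
  have hw1 : ∀ z ∈ disk, ‖1 - (‖z‖ : ℂ) ^ 2‖ ≤ 1 := fun z hz => by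
    have h1 := norm_mem_Ico hz
    have h2 : (1 : ℂ) - (‖z‖ : ℂ) ^ 2 = ((1 - ‖z‖ ^ 2 : ℝ) : ℂ) := by push_cast; rfl
    rw [h2, Complex.norm_real, Real.norm_of_nonneg (by nlinarith [h1.1, h1.2])]
    nlinarith [h1.1, h1.2]
  have hle : ∀ᵐ z ∂(volume.restrict disk), ‖z‖ ≤ 1 :=
    (ae_restrict_mem measurableSet_disk).mono fun z hz => (mem_disk.1 hz).le
  have hu : IntegrableOn (fun z : ℂ => deriv g (r * (starRingEnd ℂ) z) * (1 - (‖z‖ : ℂ) ^ 2))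
      disk := by
    refine hfin (M := C * 1) (((measurable_deriv g).comp ?_).mul (by fun_prop)) fun z hz => ?_
    · exact measurable_const.mul Complex.continuous_conj.measurable
    · rw [norm_mul]
      have h3 : ‖deriv g (r * (starRingEnd ℂ) z)‖ ≤ C := by
        refine hC _ ?_
        rw [norm_mul, RCLike.norm_conj, Complex.norm_real, Real.norm_of_nonneg hr.1]
        exact mul_le_of_le_one_right hr.1 (mem_disk.1 hz).le
      exact mul_le_mul h3 (hw1 z hz) (norm_nonneg _) ((norm_nonneg _).trans h3)
  -- Expand `f'` first; each resulting moment is evaluated by expanding `g'` in powers of `z̄`,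
  -- where orthogonality keeps only the term `n = m`.
  have h1 := hasSum_integral_powerSeries (μ := volume.restrict disk) (φ := fun z => z)
    measurable_id.aestronglyMeasurable hle hu (fun z hz => hasSum_deriv hf hz) hrd
  refine (h1.mul_left (Real.pi : ℂ)⁻¹).congr_fun fun m => ?_
  have hu' : IntegrableOn (fun z : ℂ => z ^ m * (1 - (‖z‖ : ℂ) ^ 2)) disk := by
    refine hfin (M := 1 * 1) (by fun_prop) fun z hz => ?_
    rw [norm_mul, norm_pow]
    exact mul_le_mul (pow_le_one₀ (norm_nonneg _) (mem_disk.1 hz).le) (hw1 z hz) (norm_nonneg _)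
      zero_le_one
  have h2 := hasSum_integral_powerSeries (μ := volume.restrict disk)
    (φ := fun z => (starRingEnd ℂ) z) Complex.continuous_conj.measurable.aestronglyMeasurable
    (hle.mono fun z hz => by rwa [RCLike.norm_conj]) hu' (fun z hz => hasSum_deriv hg hz) hrd
  have h3 := h2.unique (hasSum_single m fun n hn => by
    rw [integral_disk_moment_ne hn.symm, mul_zero])
  rw [integral_disk_moment_self] at h3
  have h4 : ∫ z in disk, z ^ m * (deriv g (r * (starRingEnd ℂ) z) * (1 - (‖z‖ : ℂ) ^ 2)) =
      ∫ z in disk, deriv g (r * (starRingEnd ℂ) z) * (z ^ m * (1 - (‖z‖ : ℂ) ^ 2)) :=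
    integral_congr_ae (Eventually.of_forall fun z => by ring)
  rw [h4, h3]
  have : (Real.pi : ℂ) ≠ 0 := by exact_mod_cast Real.pi_ne_zero
  have : ((m : ℂ) + 1) ≠ 0 := by exact_mod_cast m.succ_ne_zero
  have : ((m : ℂ) + 2) ≠ 0 := by exact_mod_cast (m + 1).succ_ne_zero
  field_simp
  rw [← pow_mul, ← pow_mul, mul_comm 2 m]

/-- If the derivative of `f` is dominated by `A` times the majorant and the weighted integral of
`|g'|` is at most `B`, then the integral form of the pairing is bounded. -/
theorem Weight.Regular.norm_pairing_integral_le {w : Weight} (h : w.Regular) :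
    ∃ C : ℝ, 0 < C ∧ ∀ {f g : ℂ → ℂ}, f ∈ Hol → g ∈ Hol → ∀ {A B : ℝ}, 0 ≤ A → 0 ≤ B →
      (∀ z ∈ disk, ‖deriv f z‖ ≤ A * majorant w z) →
      ∫⁻ z in disk, ‖deriv g z‖ₑ * w.ennreal ‖z‖ ≤ ENNReal.ofReal B → ∀ r ∈ Ico (0 : ℝ) 1,
      ‖∫ z in disk, deriv f (r * z) *
        (deriv g (r * (starRingEnd ℂ) z) * (1 - (‖z‖ : ℂ) ^ 2))‖ ≤ C * A * B := by
  obtain ⟨C, hC, h⟩ := h.majorant_le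
  refine ⟨2 * C, by positivity, fun {f g} hf hg {A B} hA hB hfA hgB r hr => ?_⟩
  have hr1 : ‖(r : ℂ)‖ ≤ 1 := by
    rw [Complex.norm_real, Real.norm_of_nonneg hr.1]
    exact hr.2.le
  have h1 : ∀ z ∈ disk, ‖deriv f (r * z) *
      (deriv g (r * (starRingEnd ℂ) z) * (1 - (‖z‖ : ℂ) ^ 2))‖ₑ ≤
      ENNReal.ofReal (2 * C * A) * (‖deriv g (r * (starRingEnd ℂ) z)‖ₑ *
        w.ennreal ‖(starRingEnd ℂ) z‖) := fun z hz => by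
    have hz' := norm_mem_Ico hz
    have hrz := mul_mem_disk hr1 hz
    have h2 : ‖(r : ℂ) * z‖ ≤ ‖z‖ := by
      rw [norm_mul]
      exact mul_le_of_le_one_left (norm_nonneg _) hr1
    have h3 := (hfA _ hrz).trans (mul_le_mul_of_nonneg_left (h _ hrz z hz h2) hA)
    have hw := w.pos _ hz'
    have h0 : 0 < 1 - ‖z‖ := by linarith [hz'.2]
    -- This factor cancels `(1 - ‖z‖)⁻¹` in the majorant, so that just the weight remains beside
    -- `g'`.
    have h4 : ‖(1 : ℂ) - (‖z‖ : ℂ) ^ 2‖ ≤ 2 * (1 - ‖z‖) := by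
      have h5 : (1 : ℂ) - (‖z‖ : ℂ) ^ 2 = ((1 - ‖z‖ ^ 2 : ℝ) : ℂ) := by push_cast; rfl
      rw [h5, Complex.norm_real, Real.norm_of_nonneg (by nlinarith [hz'.1])]
      nlinarith [hz'.1]
    rw [RCLike.norm_conj, w.ennreal_apply hz', ← ofReal_norm, ← ofReal_norm,
      ← ENNReal.ofReal_mul (norm_nonneg _), ← ENNReal.ofReal_mul (by positivity)]
    refine ENNReal.ofReal_le_ofReal ?_
    rw [norm_mul, norm_mul]
    calc ‖deriv f (r * z)‖ * (‖deriv g (r * (starRingEnd ℂ) z)‖ * ‖(1 : ℂ) - (‖z‖ : ℂ) ^ 2‖)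
        ≤ (A * (C * majorant w z)) *
          (‖deriv g (r * (starRingEnd ℂ) z)‖ * (2 * (1 - ‖z‖))) := by
          have hm := majorant_pos w hz
          gcongr
      _ = _ := by
          rw [majorant]
          field_simp
  have h2 : ‖∫ z in disk, deriv f (r * z) *
      (deriv g (r * (starRingEnd ℂ) z) * (1 - (‖z‖ : ℂ) ^ 2))‖ₑ ≤
      ENNReal.ofReal (2 * C * A * B) := by
    refine (enorm_integral_le_lintegral_enorm _).trans ?_
    refine (setLIntegral_mono' measurableSet_disk h1).trans ?_
    rw [lintegral_const_mul' _ _ ENNReal.ofReal_ne_top,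
      ENNReal.ofReal_mul (p := 2 * C * A) (by positivity)]
    refine mul_le_mul_right (le_trans ?_ hgB) _
    have h3 := lintegral_disk_isometry Complex.conjLIE
      (fun z => ‖deriv g (r * z)‖ₑ * w.ennreal ‖z‖)
    simp only [Complex.conjLIE_apply] at h3
    rw [h3]
    exact lintegral_dilate_le (hg.1.deriv isOpen_disk) (measurable_deriv g) w.measurable_ennreal
      ⟨hr.1, hr.2.le⟩
  rw [← ofReal_norm] at h2
  exact (ENNReal.ofReal_le_ofReal_iff (by positivity)).1 h2

/-- A bound for `∑ (m + 1) / (m + 2) b (m + 1) t ^ m` implies one for `∑ b n t ^ n`. -/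
theorem norm_tsum_le_of_bound {b : ℕ → ℂ} (hb : IsTaylor b) {M : ℝ}
    (hM : ∀ x ∈ Ico (0 : ℝ) 1,
      ‖∑' m : ℕ, ((m + 1) / (m + 2) * b (m + 1)) * (x : ℂ) ^ m‖ ≤ M) {t : ℝ}
    (ht : t ∈ Ico (0 : ℝ) 1) : ‖∑' n, b n * (t : ℂ) ^ n‖ ≤ ‖b 0‖ + 2 * M := by
  have hc : IsTaylor fun n : ℕ => b n / (n + 1) := by
    refine hb.mono fun n => ?_
    have h1 : ‖(n : ℂ) + 1‖ = (n : ℝ) + 1 := by norm_cast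
    rw [norm_div, h1]
    exact div_le_self (norm_nonneg _) (by linarith [(n.cast_nonneg : (0 : ℝ) ≤ n)])
  -- `T'` is the series bounded by hypothesis, and `∑ b n t ^ n` is the derivative of `t T(t)`,
  -- namely `T + t T'`; integrating `T'` bounds `T - T 0`.
  set T := ofCoeffs fun n : ℕ => b n / (n + 1) with hT
  have hTm := ofCoeffs_mem hc
  have hTd : ∀ x ∈ Ico (0 : ℝ) 1, HasSum (fun m : ℕ => ((m + 1) / (m + 2) * b (m + 1)) *
      (x : ℂ) ^ m) (deriv T x) := fun x hx => by
    have hxd : (x : ℂ) ∈ disk := by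
      rw [mem_disk, Complex.norm_real, Real.norm_of_nonneg hx.1]
      exact hx.2
    refine (hasSum_deriv hTm hxd).congr_fun fun m => ?_
    rw [coeff_ofCoeffs hc]
    have : ((m : ℂ) + 2) ≠ 0 := by exact_mod_cast (m + 1).succ_ne_zero
    push_cast
    rw [show ((m : ℂ) + 1 + 1) = m + 2 by ring]
    field_simp
  have hM0 : 0 ≤ M := (norm_nonneg _).trans (hM 0 (by simp))
  have htd : (t : ℂ) ∈ disk := by
    rw [mem_disk, Complex.norm_real, Real.norm_of_nonneg ht.1]
    exact ht.2
  have hT1 : ‖T t - T 0‖ ≤ M * ‖(t : ℂ) - 0‖ := by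
    -- The bound on `T'` is available only at real points, so the mean value inequality is used on
    -- the real segment.
    refine Convex.norm_image_sub_le_of_norm_deriv_le (s := (fun x : ℝ => (x : ℂ)) '' Ico 0 1)
      ?_ ?_ ?_ ⟨0, by simp, by simp⟩ ⟨t, ht, rfl⟩
    · rintro _ ⟨x, hx, rfl⟩
      exact Hol.differentiableAt hTm (by
        rw [mem_disk, Complex.norm_real, Real.norm_of_nonneg hx.1]
        exact hx.2)
    · rintro _ ⟨x, hx, rfl⟩
      rw [← (hTd x hx).tsum_eq]
      exact hM x hx
    · exact (convex_Ico 0 1).is_linear_image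
        (IsLinearMap.mk (fun x y => by simp) fun c x => by simp)
  have hT0 : T 0 = b 0 := by
    rw [← coeff_zero T, hT, coeff_ofCoeffs hc]
    simp
  have hnt : ‖(t : ℂ)‖ ≤ 1 := (mem_disk.1 htd).le
  have hsum : HasSum (fun n => b n * (t : ℂ) ^ n) (T t + t * deriv T t) := by
    have h1 := hasSum_ofCoeffs hc htd
    have h2 : HasSum (fun n : ℕ => (n / (n + 1) * b n) * (t : ℂ) ^ n) (t * deriv T t) := by
      rw [← hasSum_nat_add_iff' 1]
      simp only [Finset.range_one, Finset.sum_singleton, Nat.cast_zero, zero_div, zero_mul,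
        sub_zero]
      refine ((hTd t ht).mul_left (t : ℂ)).congr_fun fun m => ?_
      push_cast
      rw [show ((m : ℂ) + 1 + 1) = m + 2 by ring]
      ring
    refine (h1.add h2).congr_fun fun n => ?_
    have : ((n : ℂ) + 1) ≠ 0 := by exact_mod_cast n.succ_ne_zero
    field_simp
    ring
  rw [hsum.tsum_eq]
  have h3 : T t + t * deriv T t = b 0 + (T t - T 0) + t * deriv T t := by rw [hT0]; ring
  have h4 : ‖(t : ℂ) * deriv T t‖ ≤ M := by
    rw [norm_mul, ← (hTd t ht).tsum_eq]
    exact (mul_le_of_le_one_left (norm_nonneg _) hnt).trans (hM t ht)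
  have h5 : ‖T t - T 0‖ ≤ M := by
    refine hT1.trans ?_
    rw [sub_zero]
    exact mul_le_of_le_one_right hM0 hnt
  rw [h3]
  have h6 := norm_add₃_le (a := b 0) (b := T t - T 0) (c := t * deriv T t)
  linarith

theorem Weight.Regular.norm_abelSum_le {w : Weight} (h : w.Regular) :
    ∃ C : ℝ, 0 < C ∧ ∀ {f g : ℂ → ℂ}, f ∈ Hol → g ∈ Hol → ∀ {A B : ℝ}, 0 ≤ A → 0 ≤ B →
      (∀ z ∈ disk, ‖deriv f z‖ ≤ A * majorant w z) →
      ∫⁻ z in disk, ‖deriv g z‖ₑ * w.ennreal ‖z‖ ≤ ENNReal.ofReal B → ∀ r ∈ Ioo (0 : ℝ) 1,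
      ‖abelSum f g r‖ ≤ ‖f 0‖ * ‖g 0‖ + C * A * B := by
  obtain ⟨C, hC, h⟩ := h.norm_pairing_integral_le
  have hpi := Real.pi_pos
  refine ⟨2 * (Real.pi⁻¹ * C), by positivity, fun {f g} hf hg {A B} hA hB hfA hgB r hr => ?_⟩
  have h1 := norm_tsum_le_of_bound ((isTaylor_coeff hf).mul (isTaylor_coeff hg))
    (M := Real.pi⁻¹ * (C * A * B)) (fun x hx => ?_) (t := r ^ 2)
    ⟨sq_nonneg r, pow_lt_one₀ hr.1.le hr.2 two_ne_zero⟩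
  · rw [norm_mul, coeff_zero, coeff_zero] at h1
    push_cast at h1
    simp_rw [← pow_mul] at h1
    rw [abelSum]
    linarith
  -- The integral at radius `r` is a power series in `r²`, so the parameter `x` calls for radius
  -- `√x`.
  · have hs : √x ∈ Ico (0 : ℝ) 1 :=
      ⟨Real.sqrt_nonneg x, by rw [Real.sqrt_lt' one_pos]; simpa using hx.2⟩
    have h2 := (hasSum_pairing_integral hf hg hs).tsum_eq
    rw [← Complex.ofReal_pow, Real.sq_sqrt hx.1] at h2
    rw [h2, norm_mul, norm_inv, Complex.norm_real, Real.norm_of_nonneg hpi.le]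
    exact mul_le_mul_of_nonneg_left (h hf hg hA hB hfA hgB _ hs) (by positivity)

/-! ### The Bloch-type spaces as models -/

variable {w : Weight}

/-- The inclusion of the Bloch-type space in the holomorphic functions. -/
def Bloch.toHol (w : Weight) : Bloch w →ₗ[ℂ] Hol where
  toFun f := ⟨f.1, f.2.1⟩
  map_add' _ _ := rfl
  map_smul' _ _ := rfl

/-- The inclusion of the little Bloch-type space in the holomorphic functions. -/
def LittleBloch.toHol (w : Weight) : LittleBloch w →ₗ[ℂ] Hol :=
  (Bloch.toHol w).comp (LittleBloch w).subtype

/-- The inclusion of the space defined by an area integral in the holomorphic functions. -/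
def BlochOne.toHol (w : Weight) : BlochOne w →ₗ[ℂ] Hol where
  toFun f := ⟨f.1, f.2.1⟩
  map_add' _ _ := rfl
  map_smul' _ _ := rfl

theorem Bloch.toHol_injective : Function.Injective (Bloch.toHol w) := fun _ _ h =>
  Subtype.ext (congrArg (fun u : Hol => u.1) h)

theorem LittleBloch.toHol_injective : Function.Injective (LittleBloch.toHol w) :=
  Bloch.toHol_injective.comp Subtype.val_injective

theorem BlochOne.toHol_injective : Function.Injective (BlochOne.toHol w) := fun _ _ h =>
  Subtype.ext (congrArg (fun u : Hol => u.1) h)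

theorem Bloch.norm_apply_zero_le (f : Bloch w) : ‖f 0‖ ≤ ‖f‖ := by
  rw [Bloch.norm_def]
  exact le_add_of_nonneg_right (Real.iSup_nonneg (Bloch.quot_nonneg f))

theorem Bloch.norm_deriv_le (f : Bloch w) {z : ℂ} (hz : z ∈ disk) :
    ‖deriv f z‖ ≤ ‖f‖ * majorant w z := by
  rw [← div_le_iff₀ (majorant_pos w hz), Bloch.norm_def]
  exact (le_ciSup (Bloch.bddAbove f) ⟨z, hz⟩).trans (le_add_of_nonneg_left (norm_nonneg _))

theorem Bloch.norm_le (f : Bloch w) {A : ℝ} (h : ∀ z ∈ disk, ‖deriv f z‖ ≤ A * majorant w z) :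
    ‖f‖ ≤ ‖f 0‖ + A := by
  have : Nonempty disk := ⟨⟨0, zero_mem_disk⟩⟩
  rw [Bloch.norm_def]
  gcongr
  exact ciSup_le fun z => (div_le_iff₀ (majorant_pos w z.2)).2 (h z z.2)

theorem Bloch.exists_of_norm_deriv_le {f : ℂ → ℂ} (hf : f ∈ Hol) {A : ℝ}
    (h : ∀ z ∈ disk, ‖deriv f z‖ ≤ A * majorant w z) :
    ∃ x, (Bloch.toHol w x : ℂ → ℂ) = f ∧ ‖x‖ ≤ ‖f 0‖ + A := by
  have hO : deriv f =O[𝓟 disk] majorant w := by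
    refine IsBigO.of_bound A (eventually_principal.2 fun z hz => ?_)
    rw [Real.norm_of_nonneg (majorant_pos w hz).le]
    exact h z hz
  exact ⟨⟨f, hf, hO⟩, rfl, Bloch.norm_le (⟨f, hf, hO⟩ : Bloch w) h⟩

theorem BlochOne.lintegral_eq (f : BlochOne w) :
    ∫⁻ z in disk, ‖deriv f z‖ₑ * w.ennreal ‖z‖ =
      ENNReal.ofReal (∫ z in disk, ‖deriv f z‖ * w.toFun ‖z‖) := by
  rw [ofReal_integral_eq_lintegral_ofReal f.2.2
    ((ae_restrict_mem measurableSet_disk).mono fun z hz => BlochOne.integrand_nonneg f hz)]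
  refine setLIntegral_congr_fun measurableSet_disk fun z hz => ?_
  rw [w.ennreal_apply (norm_mem_Ico hz), ENNReal.ofReal_mul (norm_nonneg _), ofReal_norm]

theorem BlochOne.lintegral_le (f : BlochOne w) :
    ∫⁻ z in disk, ‖deriv f z‖ₑ * w.ennreal ‖z‖ ≤ ENNReal.ofReal (Real.pi * ‖f‖) := by
  rw [BlochOne.lintegral_eq]
  refine ENNReal.ofReal_le_ofReal ?_
  rw [BlochOne.norm_def, mul_add, mul_inv_cancel_left₀ Real.pi_ne_zero]
  exact le_add_of_nonneg_left (mul_nonneg Real.pi_pos.le (norm_nonneg _))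

theorem BlochOne.norm_apply_zero_le (f : BlochOne w) : ‖f 0‖ ≤ ‖f‖ := by
  rw [BlochOne.norm_def]
  exact le_add_of_nonneg_right (mul_nonneg (inv_nonneg.2 Real.pi_pos.le)
    (BlochOne.integral_nonneg f))

theorem BlochOne.norm_le (f : BlochOne w) {B : ℝ} (hB : 0 ≤ B)
    (h : ∫⁻ z in disk, ‖deriv f z‖ₑ * w.ennreal ‖z‖ ≤ ENNReal.ofReal B) :
    ‖f‖ ≤ ‖f 0‖ + Real.pi⁻¹ * B := by
  rw [BlochOne.lintegral_eq, ENNReal.ofReal_le_ofReal_iff hB] at h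
  rw [BlochOne.norm_def]
  have := Real.pi_pos
  gcongr

theorem BlochOne.exists_of_lintegral_le {f : ℂ → ℂ} (hf : f ∈ Hol) {B : ℝ} (hB : 0 ≤ B)
    (h : ∫⁻ z in disk, ‖deriv f z‖ₑ * w.ennreal ‖z‖ ≤ ENNReal.ofReal B) :
    ∃ x, (BlochOne.toHol w x : ℂ → ℂ) = f ∧ ‖x‖ ≤ ‖f 0‖ + Real.pi⁻¹ * B := by
  have hI : IntegrableOn (fun z : ℂ => ‖deriv f z‖ * w.toFun ‖z‖) disk := by
    refine ⟨aestronglyMeasurable_integrand w hf, ?_⟩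
    rw [hasFiniteIntegral_iff_enorm]
    refine lt_of_le_of_lt (le_trans (le_of_eq ?_) h) ENNReal.ofReal_lt_top
    refine setLIntegral_congr_fun measurableSet_disk fun z hz => ?_
    rw [enorm_mul, enorm_norm, w.ennreal_apply (norm_mem_Ico hz),
      Real.enorm_of_nonneg (w.pos _ (norm_mem_Ico hz)).le]
  exact ⟨⟨f, hf, hI⟩, rfl, BlochOne.norm_le (⟨f, hf, hI⟩ : BlochOne w) hB h⟩

/-! ### Bounded derivatives and approximation by dilations. -/

theorem Weight.Regular.exists_lintegral_le (h : w.Regular) :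
    ∃ W : ℝ, 0 < W ∧ ∫⁻ z in disk, w.ennreal ‖z‖ ≤ ENNReal.ofReal W := by
  obtain ⟨C, hC, h⟩ := h.lintegral_disk_kernel_le
  refine ⟨C * majorant w 0, mul_pos hC (majorant_pos w zero_mem_disk), ?_⟩
  simpa using h 0 zero_mem_disk

/-- Dilations are locally uniformly close to the function, at the level of derivatives. -/
theorem exists_norm_deriv_sub_dilate_le {f : ℂ → ℂ} (hf : f ∈ Hol) {R : ℝ}
    (hR : R ∈ Ico (0 : ℝ) 1) : ∃ K, 0 ≤ K ∧ ∀ ρ ∈ Icc (0 : ℝ) 1, ∀ z, ‖z‖ ≤ R →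
      ‖deriv f z - ρ * deriv f (ρ * z)‖ ≤ K * (1 - ρ) := by
  have hs : ∀ z ∈ Metric.closedBall (0 : ℂ) R, z ∈ disk := fun z hz =>
    mem_disk.2 ((by simpa using hz : ‖z‖ ≤ R).trans_lt hR.2)
  have hd1 := hf.1.deriv isOpen_disk
  obtain ⟨C1, hC1⟩ := (isCompact_closedBall (0 : ℂ) R).exists_bound_of_continuousOn
    (hd1.continuousOn.mono hs)
  obtain ⟨C2, hC2⟩ := (isCompact_closedBall (0 : ℂ) R).exists_bound_of_continuousOn
    ((hd1.deriv isOpen_disk).continuousOn.mono hs)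
  have h0 : (0 : ℂ) ∈ Metric.closedBall (0 : ℂ) R := by simpa using hR.1
  have hC1' := (norm_nonneg _).trans (hC1 0 h0)
  have hC2' := (norm_nonneg _).trans (hC2 0 h0)
  refine ⟨C1 + C2, by positivity, fun ρ hρ z hz => ?_⟩
  have hnρ : ‖(ρ : ℂ)‖ = ρ := by rw [Complex.norm_real, Real.norm_of_nonneg hρ.1]
  have hn1 : ‖1 - (ρ : ℂ)‖ = 1 - ρ := by
    rw [← Complex.ofReal_one, ← Complex.ofReal_sub, Complex.norm_real,
      Real.norm_of_nonneg (by linarith [hρ.2])]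
  have hzm : z ∈ Metric.closedBall (0 : ℂ) R := by simpa using hz
  have hzm' : ρ * z ∈ Metric.closedBall (0 : ℂ) R := by
    rw [mem_closedBall_zero_iff, norm_mul, hnρ]
    exact (mul_le_of_le_one_left (norm_nonneg _) hρ.2).trans hz
  have h1 : ‖deriv f z - deriv f (ρ * z)‖ ≤ C2 * ‖z - ρ * z‖ :=
    Convex.norm_image_sub_le_of_norm_deriv_le
      (fun x hx => hd1.differentiableAt (isOpen_disk.mem_nhds (hs x hx))) hC2
      (convex_closedBall 0 R) hzm' hzm
  have h2 : ‖z - ρ * z‖ ≤ 1 - ρ := by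
    rw [← one_sub_mul, norm_mul, hn1]
    exact mul_le_of_le_one_right (by linarith [hρ.2]) (hz.trans hR.2.le)
  have h3 : deriv f z - ρ * deriv f (ρ * z) =
      (deriv f z - deriv f (ρ * z)) + (1 - ρ) * deriv f (ρ * z) := by ring
  rw [h3]
  refine (norm_add_le _ _).trans ?_
  rw [norm_mul, hn1]
  have h4 := mul_le_mul_of_nonneg_left h2 hC2'
  have h5 := mul_le_mul_of_nonneg_left (hC1 _ hzm') (by linarith [hρ.2] : 0 ≤ 1 - ρ)
  linarith

/-- The crude bound `M` gives membership, since the majorant tends to infinity at the circle; the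
norm depends only on `A`. -/
theorem LittleBloch.exists_of_norm_deriv_le (h : w.Regular) {f : ℂ → ℂ} (hf : f ∈ Hol) {M A : ℝ}
    (hM : ∀ z ∈ disk, ‖deriv f z‖ ≤ M) (hA : ∀ z ∈ disk, ‖deriv f z‖ ≤ A * majorant w z) :
    ∃ x, (LittleBloch.toHol w x : ℂ → ℂ) = f ∧ ‖x‖ ≤ ‖f 0‖ + A := by
  obtain ⟨x, hx, hxn⟩ := Bloch.exists_of_norm_deriv_le hf hA
  have hx' : x.1 = f := hx
  refine ⟨⟨x, ?_⟩, hx, hxn⟩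
  obtain ⟨C, hC, h⟩ := h.inv_majorant_le
  change deriv x.1 =o[comap norm (𝓝[<] 1)] majorant w
  rw [hx']
  refine IsLittleO.of_bound fun c hc => ?_
  have hM0 := (norm_nonneg _).trans (hM 0 zero_mem_disk)
  have h1 : Tendsto (fun r : ℝ => M * (C * √(1 - r))) (𝓝[<] 1) (𝓝 0) := by
    have : Continuous fun r : ℝ => M * (C * √(1 - r)) := by fun_prop
    have := (this.continuousAt (x := 1)).continuousWithinAt (s := Iio 1)
    simpa [ContinuousWithinAt] using this
  have h2 : ∀ᶠ r in 𝓝[<] (1 : ℝ), M * (C * √(1 - r)) < c ∧ r < 1 :=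
    (h1.eventually (gt_mem_nhds hc)).and self_mem_nhdsWithin
  filter_upwards [h2.comap norm] with z hz
  have hzd := mem_disk.2 hz.2
  have hm := majorant_pos w hzd
  rw [Real.norm_of_nonneg hm.le, ← div_le_iff₀ hm, div_eq_mul_inv]
  exact (mul_le_mul (hM z hzd) (h z hzd) (inv_nonneg.2 hm.le) hM0).trans hz.1.le

theorem Weight.Regular.one_le_majorant (h : w.Regular) : ∃ C : ℝ, 0 < C ∧ ∀ z ∈ disk,
    1 ≤ C * majorant w z := by
  obtain ⟨C, hC, h⟩ := h.inv_majorant_le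
  refine ⟨C, hC, fun z hz => ?_⟩
  have hm := majorant_pos w hz
  rw [← div_le_iff₀ hm, one_div]
  refine (h z hz).trans (mul_le_of_le_one_right hC.le ?_)
  refine Real.sqrt_le_iff.2 ⟨zero_le_one, ?_⟩
  rw [one_pow]
  linarith [norm_nonneg z]

theorem sub_toHol {X : Type*} [NormedAddCommGroup X] [NormedSpace ℂ X] (ι : X →ₗ[ℂ] Hol) (x y : X)
    {z : ℂ} (hz : z ∈ disk) : (ι (x - y) : ℂ → ℂ) 0 = (ι x : ℂ → ℂ) 0 - (ι y : ℂ → ℂ) 0 ∧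
      deriv (ι (x - y)) z = deriv (ι x) z - deriv (ι y : ℂ → ℂ) z := by
  have h : (ι (x - y) : ℂ → ℂ) = (ι x : ℂ → ℂ) - (ι y : ℂ → ℂ) := by rw [map_sub]; rfl
  rw [h]
  exact ⟨rfl, deriv_sub (Hol.differentiableAt (ι x).2 hz) (Hol.differentiableAt (ι y).2 hz)⟩

/-- For density, `f'` and the derivative of its dilation are both small against the majorant near
the circle, while on a smaller disk the derivatives of dilations converge uniformly. The little-o
condition is what makes the boundary part small. -/
theorem isModel_littleBloch (h : w.Regular) : IsModel (LittleBloch.toHol w) where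
  injective := LittleBloch.toHol_injective
  bounded := by
    obtain ⟨C, hC, hC1⟩ := h.one_le_majorant
    refine ⟨1 + C, fun f M hM0 hM => ?_⟩
    have hM' := (norm_nonneg _).trans hM0
    obtain ⟨x, hx, hxn⟩ := LittleBloch.exists_of_norm_deriv_le h f.2 (A := M * C) hM fun z hz => by
      refine (hM z hz).trans ?_
      rw [mul_assoc]
      exact le_mul_of_one_le_right hM' (hC1 z hz)
    exact ⟨x, Subtype.ext hx, by linarith⟩
  dense := by
    intro x ε hε
    obtain ⟨C, hC, hC1⟩ := h.one_le_majorant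
    obtain ⟨D, hD, hD1⟩ := h.majorant_le
    set f : ℂ → ℂ := (LittleBloch.toHol w x).1 with hfdef
    have hf : f ∈ Hol := (LittleBloch.toHol w x).2
    -- `f'` contributes this constant and the dilation `D` times it, from comparing majorants at `ρ
    -- z` and `z`; together they give `ε / 4`.
    have hc : 0 < ε / (4 * (1 + D)) := by positivity
    have hlo : deriv f =o[comap norm (𝓝[<] 1)] majorant w := x.2
    obtain ⟨t, ht, hts⟩ := mem_comap.1 (hlo.def hc)
    obtain ⟨R₀, hR₀, hR₀t⟩ := mem_nhdsLT_iff_exists_Ioo_subset.1 ht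
    set R := max R₀ 0
    have hR : R < 1 := max_lt hR₀ one_pos
    have hR0 : 0 ≤ R := le_max_right _ _
    have hfR : ∀ z ∈ disk, R < ‖z‖ → ‖deriv f z‖ ≤ ε / (4 * (1 + D)) * majorant w z :=
      fun z hz hRz => by
        have := hts (hR₀t ⟨(le_max_left _ _).trans_lt hRz, mem_disk.1 hz⟩)
        rwa [mem_ofPred_eq, Real.norm_of_nonneg (majorant_pos w hz).le] at this
    -- A radius strictly between `R` and `1` leaves room for `ρ z` to stay outside `R` when `z` is
    -- outside `R₁` and `ρ` is close to `1`.
    set R₁ := (1 + R) / 2 with hR₁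
    obtain ⟨K, hK, hKb⟩ := exists_norm_deriv_sub_dilate_le hf (R := R₁)
      ⟨by linarith, by linarith⟩
    have hev : ∀ᶠ ρ in 𝓝[<] (1 : ℝ), K * C * (1 - ρ) < ε / 2 ∧ R < ρ * R₁ ∧ ρ ∈ Ioo (0 : ℝ) 1 := by
      refine Eventually.and ?_ (Eventually.and ?_ (Ioo_mem_nhdsLT one_pos))
      · have h1 : Continuous fun ρ : ℝ => K * C * (1 - ρ) := by fun_prop
        refine (h1.continuousAt.continuousWithinAt.tendsto).eventually (gt_mem_nhds ?_)
        simpa using half_pos hε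
      · have h1 : Continuous fun ρ : ℝ => ρ * R₁ := by fun_prop
        refine (h1.continuousAt.continuousWithinAt.tendsto).eventually (lt_mem_nhds ?_)
        linarith
    obtain ⟨ρ, hρ1, hρ2, hρ⟩ := hev.exists
    have hnρ : ‖(ρ : ℂ)‖ = ρ := by rw [Complex.norm_real, Real.norm_of_nonneg hρ.1.le]
    have hρ1' : ‖(ρ : ℂ)‖ ≤ 1 := by rw [hnρ]; exact hρ.2.le
    have hρf := dilate_mem hρ1' hf
    have hρs := norm_le_tsum_coeff hρf (IsModel.summable_dilate hf hρ)
    obtain ⟨y, hy, -⟩ := LittleBloch.exists_of_norm_deriv_le h hρf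
      (A := (∑' n : ℕ, ((n : ℝ) + 1) * ‖coeff (dilate ρ f) n‖) * C) hρs.2 fun z hz => by
        refine (hρs.2 z hz).trans ?_
        rw [mul_assoc]
        exact le_mul_of_one_le_right ((norm_nonneg _).trans hρs.1) (hC1 z hz)
    refine ⟨ρ, hρ, y, hy, ?_⟩
    have hzero : (LittleBloch.toHol w (x - y) : ℂ → ℂ) 0 = 0 := by
      rw [(sub_toHol _ x y zero_mem_disk).1, hy, dilate_apply hρ1' hf zero_mem_disk, mul_zero,
        sub_self]
    have hder : ∀ z ∈ disk, ‖deriv (LittleBloch.toHol w (x - y)).1 z‖ ≤ ε / 2 * majorant w z :=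
      fun z hz => by
        have hm := majorant_pos w hz
        rw [(sub_toHol _ x y hz).2, hy, deriv_dilate hρ1' hf hz]
        rcases le_or_gt ‖z‖ R₁ with hzR | hzR
        · refine (hKb ρ ⟨hρ.1.le, hρ.2.le⟩ z hzR).trans ?_
          have h1 : 0 ≤ K * (1 - ρ) := mul_nonneg hK (by linarith [hρ.2])
          calc K * (1 - ρ) ≤ K * (1 - ρ) * (C * majorant w z) :=
                le_mul_of_one_le_right h1 (hC1 z hz)
            _ = K * C * (1 - ρ) * majorant w z := by ring
            _ ≤ _ := mul_le_mul_of_nonneg_right hρ1.le hm.le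
        · have hz2 := mul_mem_disk hρ1' hz
          have hle : ‖(ρ : ℂ) * z‖ ≤ ‖z‖ := by
            rw [norm_mul]
            exact mul_le_of_le_one_left (norm_nonneg _) hρ1'
          have hgt : R < ‖(ρ : ℂ) * z‖ := by
            rw [norm_mul, hnρ]
            exact hρ2.trans_le (mul_le_mul_of_nonneg_left hzR.le hρ.1.le)
          have h1 := hfR z hz (by linarith)
          have h2 := (hfR _ hz2 hgt).trans (mul_le_mul_of_nonneg_left (hD1 _ hz2 z hz hle) hc.le)
          have h3 : ‖(ρ : ℂ) * deriv f (ρ * z)‖ ≤ ‖deriv f (ρ * z)‖ := by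
            rw [norm_mul]
            exact mul_le_of_le_one_left (norm_nonneg _) hρ1'
          have h4 := norm_sub_le (deriv f z) (ρ * deriv f (ρ * z))
          have h5 : ε / (4 * (1 + D)) * majorant w z + ε / (4 * (1 + D)) * (D * majorant w z) =
              ε / 4 * majorant w z := by field_simp
          have h6 : ε / 4 * majorant w z ≤ ε / 2 * majorant w z :=
            mul_le_mul_of_nonneg_right (by linarith) hm.le
          linarith
    have hfin := Bloch.norm_le ((x - y : LittleBloch w) : Bloch w) hder
    have hzero' : ((x - y : LittleBloch w) : Bloch w) 0 = 0 := hzero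
    rw [hzero', norm_zero, zero_add] at hfin
    exact hfin.trans_lt (half_lt_self hε)

theorem exists_lintegral_tail_le {F : ℂ → ENNReal} (hF : Measurable F)
    (hfin : ∫⁻ z in disk, F z ≠ ⊤) {ε : ENNReal} (hε : 0 < ε) :
    ∃ R ∈ Ico (0 : ℝ) 1, ∫⁻ z in disk, (Ioi R).indicator 1 ‖z‖ * F z < ε := by
  have h1 : Tendsto (fun n : ℕ => ∫⁻ z in disk,
      (Ioi (1 - 1 / ((n : ℝ) + 1))).indicator 1 ‖z‖ * F z) atTop (𝓝 (∫⁻ _ in disk, 0)) := by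
    refine tendsto_lintegral_of_dominated_convergence F (fun n => ?_) (fun n => ?_) hfin ?_
    · exact ((measurable_one.indicator measurableSet_Ioi).comp measurable_norm).mul hF
    · refine Eventually.of_forall fun z => mul_le_of_le_one_left' ?_
      exact indicator_le_self' (fun _ _ => zero_le) _
    · filter_upwards [ae_restrict_mem measurableSet_disk] with z hz
      have h2 : Tendsto (fun n : ℕ => 1 - 1 / ((n : ℝ) + 1)) atTop (𝓝 (1 - 0)) :=
        tendsto_const_nhds.sub tendsto_one_div_add_atTop_nhds_zero_nat
      rw [sub_zero] at h2
      refine tendsto_const_nhds.congr' ?_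
      filter_upwards [h2.eventually (lt_mem_nhds (mem_disk.1 hz))] with n hn
      have hn' : ‖z‖ ∉ Ioi (1 - 1 / ((n : ℝ) + 1)) := fun h => lt_asymm hn h
      rw [indicator_of_notMem hn', zero_mul]
  rw [lintegral_zero] at h1
  obtain ⟨n, hn⟩ := (h1.eventually (gt_mem_nhds hε)).exists
  have : (1 : ℝ) / (n + 1) ≤ 1 := by
    rw [div_le_one (by positivity)]
    linarith [(n.cast_nonneg : (0 : ℝ) ≤ n)]
  have : (0 : ℝ) < 1 / (n + 1) := by positivity
  exact ⟨_, ⟨by linarith, by linarith⟩, hn⟩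

/-- For density, cut the disk at a radius beyond which `f` has small weighted integral. Inside,
derivatives of dilations converge uniformly and the weight is integrable; outside, the dilation is
no larger than `f` in the mean. -/
theorem isModel_blochOne (h : w.Regular) : IsModel (BlochOne.toHol w) where
  injective := BlochOne.toHol_injective
  bounded := by
    obtain ⟨W, hW, hWb⟩ := h.exists_lintegral_le
    refine ⟨1 + Real.pi⁻¹ * W, fun f M hM0 hM => ?_⟩
    have hM' := (norm_nonneg _).trans hM0
    obtain ⟨x, hx, hxn⟩ := BlochOne.exists_of_lintegral_le (w := w) f.2 (B := M * W)
      (by positivity) (by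
        calc ∫⁻ z in disk, ‖deriv f.1 z‖ₑ * w.ennreal ‖z‖
            ≤ ∫⁻ z in disk, ENNReal.ofReal M * w.ennreal ‖z‖ := by
              refine setLIntegral_mono' measurableSet_disk fun z hz => mul_le_mul_left ?_ _
              rw [← ofReal_norm]
              exact ENNReal.ofReal_le_ofReal (hM z hz)
          _ ≤ ENNReal.ofReal (M * W) := by
              rw [lintegral_const_mul' _ _ ENNReal.ofReal_ne_top, ENNReal.ofReal_mul hM']
              exact mul_le_mul_right hWb _)
    exact ⟨x, Subtype.ext hx, by linarith⟩
  dense := by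
    intro x ε hε
    obtain ⟨W, hW, hWb⟩ := h.exists_lintegral_le
    set f : ℂ → ℂ := (BlochOne.toHol w x).1 with hfdef
    have hf : f ∈ Hol := (BlochOne.toHol w x).2
    have hwn : Measurable fun z : ℂ => w.ennreal ‖z‖ := w.measurable_ennreal.comp measurable_norm
    have hF : Measurable fun z : ℂ => ‖deriv f z‖ₑ * w.ennreal ‖z‖ :=
      (measurable_deriv f).enorm.mul hwn
    have hfin : ∫⁻ z in disk, ‖deriv f z‖ₑ * w.ennreal ‖z‖ ≠ ⊤ :=
      ((BlochOne.lintegral_le x).trans_lt ENNReal.ofReal_lt_top).ne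
    have hpi := Real.pi_pos
    obtain ⟨R, hR, hRt⟩ := exists_lintegral_tail_le hF hfin
      (ENNReal.ofReal_pos.2 (show 0 < ε / 4 by positivity))
    obtain ⟨K, hK, hKb⟩ := exists_norm_deriv_sub_dilate_le hf hR
    have hev : ∀ᶠ ρ in 𝓝[<] (1 : ℝ), K * W * (1 - ρ) < ε / 2 ∧ ρ ∈ Ioo (0 : ℝ) 1 := by
      refine Eventually.and ?_ (Ioo_mem_nhdsLT one_pos)
      have h1 : Continuous fun ρ : ℝ => K * W * (1 - ρ) := by fun_prop
      refine (h1.continuousAt.continuousWithinAt.tendsto).eventually (gt_mem_nhds ?_)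
      simpa using half_pos hε
    obtain ⟨ρ, hρ1, hρ⟩ := hev.exists
    have hnρ : ‖(ρ : ℂ)‖ = ρ := by rw [Complex.norm_real, Real.norm_of_nonneg hρ.1.le]
    have hρ1' : ‖(ρ : ℂ)‖ ≤ 1 := by rw [hnρ]; exact hρ.2.le
    have hρf := dilate_mem hρ1' hf
    have hle : ∀ z, ‖(ρ : ℂ) * deriv f (ρ * z)‖ₑ ≤ ‖deriv f (ρ * z)‖ₑ := fun z => by
      rw [enorm_le_iff_norm_le, norm_mul]
      exact mul_le_of_le_one_left (norm_nonneg _) hρ1'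
    obtain ⟨y, hy, -⟩ := BlochOne.exists_of_lintegral_le (w := w) hρf (B := Real.pi * ‖x‖)
      (by positivity) (by
        refine le_trans ?_ (BlochOne.lintegral_le x)
        refine le_trans (setLIntegral_mono' measurableSet_disk fun z hz => ?_)
          (lintegral_dilate_le (hf.1.deriv isOpen_disk) (measurable_deriv f) w.measurable_ennreal
            ⟨hρ.1.le, hρ.2.le⟩)
        rw [deriv_dilate hρ1' hf hz]
        exact mul_le_mul_left (hle z) _)
    refine ⟨ρ, hρ, y, hy, ?_⟩
    have hzero : (BlochOne.toHol w (x - y) : ℂ → ℂ) 0 = 0 := by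
      rw [(sub_toHol _ x y zero_mem_disk).1, hy, dilate_apply hρ1' hf zero_mem_disk, mul_zero,
        sub_self]
    -- The truncated weight is still radial, so `lintegral_dilate_le` bounds the tail of the
    -- dilation by the tail of `f` over the same annulus.
    have hV : Measurable fun r : ℝ => (Ioi R).indicator (1 : ℝ → ENNReal) r * w.ennreal r :=
      (measurable_one.indicator measurableSet_Ioi).mul w.measurable_ennreal
    have hVn : Measurable fun z : ℂ => (Ioi R).indicator (1 : ℝ → ENNReal) ‖z‖ * w.ennreal ‖z‖ :=
      hV.comp measurable_norm
    have hder : ∀ z ∈ disk, ‖deriv (BlochOne.toHol w (x - y)).1 z‖ₑ * w.ennreal ‖z‖ ≤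
        ENNReal.ofReal (K * (1 - ρ)) * w.ennreal ‖z‖ +
          (‖deriv f z‖ₑ * ((Ioi R).indicator 1 ‖z‖ * w.ennreal ‖z‖) +
            ‖deriv f (ρ * z)‖ₑ * ((Ioi R).indicator 1 ‖z‖ * w.ennreal ‖z‖)) := fun z hz => by
      rw [(sub_toHol _ x y hz).2, hy, deriv_dilate hρ1' hf hz]
      rcases le_or_gt ‖z‖ R with hzR | hzR
      · refine le_trans (mul_le_mul_left ?_ _) le_self_add
        rw [← ofReal_norm]
        exact ENNReal.ofReal_le_ofReal (hKb ρ ⟨hρ.1.le, hρ.2.le⟩ z hzR)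
      · refine le_trans ?_ le_add_self
        rw [indicator_of_mem (show ‖z‖ ∈ Ioi R from hzR), Pi.one_apply, one_mul, ← add_mul]
        refine mul_le_mul_left ?_ _
        exact enorm_sub_le.trans (add_le_add le_rfl (hle z))
    have hfinal : ∫⁻ z in disk, ‖deriv (BlochOne.toHol w (x - y)).1 z‖ₑ * w.ennreal ‖z‖ ≤
        ENNReal.ofReal (K * (1 - ρ) * W + (ε / 4 + ε / 4)) := by
      have h1 : 0 ≤ K * (1 - ρ) := mul_nonneg hK (by linarith [hρ.2])
      have htail : ∫⁻ z in disk, ‖deriv f z‖ₑ * ((Ioi R).indicator 1 ‖z‖ * w.ennreal ‖z‖) ≤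
          ENNReal.ofReal (ε / 4) := by
        refine le_trans (le_of_eq ?_) hRt.le
        exact lintegral_congr fun z => mul_left_comm _ _ _
      have hm : Measurable fun z : ℂ =>
          ‖deriv f z‖ₑ * ((Ioi R).indicator 1 ‖z‖ * w.ennreal ‖z‖) :=
        (measurable_deriv f).enorm.mul hVn
      refine (setLIntegral_mono' measurableSet_disk hder).trans ?_
      rw [lintegral_add_left (hwn.const_mul _), lintegral_add_left hm, lintegral_const_mul' _ _ ENNReal.ofReal_ne_top,
        ENNReal.ofReal_add (by positivity) (by positivity),
        ENNReal.ofReal_add (by positivity) (by positivity), ENNReal.ofReal_mul h1]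
      refine add_le_add (mul_le_mul_right hWb _) (add_le_add htail (le_trans ?_ htail))
      exact lintegral_dilate_le (hf.1.deriv isOpen_disk) (measurable_deriv f) hV
        ⟨hρ.1.le, hρ.2.le⟩
    have h1 : 0 ≤ K * (1 - ρ) := mul_nonneg hK (by linarith [hρ.2])
    have hres := BlochOne.norm_le (x - y) (by positivity) hfinal
    have hzero' : (x - y : BlochOne w) 0 = 0 := hzero
    rw [hzero', norm_zero, zero_add] at hres
    refine hres.trans_lt ?_
    have hpi1 : Real.pi⁻¹ < 1 := inv_lt_one_of_one_lt₀ (by linarith [Real.pi_gt_three])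
    have h2 : 0 < K * (1 - ρ) * W + (ε / 4 + ε / 4) := by positivity
    calc _ < 1 * (K * (1 - ρ) * W + (ε / 4 + ε / 4)) := mul_lt_mul_of_pos_right hpi1 h2
      _ < ε := by linarith

/-! ### Representation of functionals -/

/-- The sum of the power series `∑ (n + 1) ^ 2 z ^ n`. -/
def sqKernel (z : ℂ) : ℂ := (1 + z) / (1 - z) ^ 3

theorem one_sub_ne_zero {z : ℂ} (hz : z ∈ disk) : 1 - z ≠ 0 := by
  rw [sub_ne_zero]
  rintro rfl
  simp [mem_disk] at hz

/-- Uses `(n+1)² = 2 C(n+2, 2) - C(n+1, 1)` and the binomial series for `(1 - z)⁻³` and `(1 - z)⁻²`.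
-/
theorem hasSum_sqKernel {z : ℂ} (hz : z ∈ disk) :
    HasSum (fun n : ℕ => ((n : ℂ) + 1) ^ 2 * z ^ n) (sqKernel z) := by
  have hz1 := mem_disk.1 hz
  have h2 := (hasSum_choose_mul_geometric_of_norm_lt_one 2 hz1).mul_left 2
  have h1 := hasSum_choose_mul_geometric_of_norm_lt_one 1 hz1
  have h3 := h2.sub h1
  have hne := one_sub_ne_zero hz
  have h4 : 2 * (1 / (1 - z) ^ (2 + 1)) - 1 / (1 - z) ^ (1 + 1) = sqKernel z := by
    rw [sqKernel]
    field_simp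
    ring
  rw [h4] at h3
  refine h3.congr_fun fun n => ?_
  rw [Nat.cast_choose_two, Nat.choose_one_right]
  push_cast
  ring

theorem norm_sqKernel_le {z : ℂ} (hz : z ∈ disk) : ‖sqKernel z‖ ≤ 2 * (1 / ‖1 - z‖ ^ 3) := by
  rw [sqKernel, norm_div, norm_pow, mul_one_div]
  refine div_le_div_of_nonneg_right ?_ (by positivity)
  have := norm_add_le (1 : ℂ) z
  rw [norm_one] at this
  linarith [mem_disk.1 hz]

theorem Weight.Regular.lintegral_sqKernel_le {w : Weight} (h : w.Regular) :
    ∃ C : ℝ, 0 < C ∧ ∀ ζ ∈ disk,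
      ∫⁻ z in disk, ‖sqKernel (ζ * z)‖ₑ * w.ennreal ‖z‖ ≤ ENNReal.ofReal (C * majorant w ζ) := by
  obtain ⟨C, hC, h⟩ := h.lintegral_disk_kernel_le
  refine ⟨2 * C, by positivity, fun ζ hζ => ?_⟩
  have h1 : ∀ z ∈ disk, ‖sqKernel (ζ * z)‖ₑ * w.ennreal ‖z‖ ≤
      ENNReal.ofReal 2 * (w.ennreal ‖z‖ * ENNReal.ofReal (1 / ‖1 - ζ * z‖ ^ 3)) := fun z hz => by
    rw [mul_comm (w.ennreal ‖z‖), ← mul_assoc, ← ENNReal.ofReal_mul zero_le_two]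
    refine mul_le_mul_left ?_ _
    rw [← ofReal_norm]
    exact ENNReal.ofReal_le_ofReal (norm_sqKernel_le (mul_mem_disk (mem_disk.1 hζ).le hz))
  refine (setLIntegral_mono' measurableSet_disk h1).trans ?_
  rw [lintegral_const_mul' _ _ ENNReal.ofReal_ne_top, mul_assoc,
    ENNReal.ofReal_mul (p := 2) zero_le_two]
  exact mul_le_mul_right (h ζ hζ) _

section Test

variable {X : Type*} [NormedAddCommGroup X] [NormedSpace ℂ X] {ι : X →ₗ[ℂ] Hol} {e : ℕ → X}

/-- The function with derivative coefficients `(n + 1) ^ 2 c n`, and the value of a functional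
on it. -/
theorem IsModel.exists_test (h : IsModel ι) (he : ∀ n, (ι (e n) : ℂ → ℂ) = monomial n)
    (Φ : X →L[ℂ] ℂ) {c : ℕ → ℂ} {W ρ : ℝ} (hρ : ρ ∈ Ico (0 : ℝ) 1) (hc : ∀ n, ‖c n‖ ≤ W * ρ ^ n) :
    ∃ x, (ι x : ℂ → ℂ) 0 = 0 ∧
      (∀ z ∈ disk, HasSum (fun n : ℕ => (((n : ℂ) + 1) ^ 2 * c n) * z ^ n) (deriv (ι x).1 z)) ∧
      HasSum (fun n : ℕ => (((n : ℂ) + 1) * Φ (e (n + 1))) * c n) (Φ x) := by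
  -- The factor `n` annihilates the spurious value of the truncated subtraction at `n = 0`.
  set a : ℕ → ℂ := fun n => n * c (n - 1) with ha
  have ha1 : ∀ n, a (n + 1) = ((n : ℂ) + 1) * c n := fun n => by
    simp only [ha, Nat.add_sub_cancel]
    push_cast
    rfl
  have hs : Summable fun n : ℕ => ((n : ℝ) + 1) * ‖a n‖ := by
    refine (summable_nat_add_iff 1).1 ?_
    refine ((isTaylor_pow 2 (2 * W)) ρ hρ).of_nonneg_of_le (fun n => by positivity) fun n => ?_
    have h3 : ‖(n : ℂ) + 1‖ = (n : ℝ) + 1 := by norm_cast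
    rw [ha1, norm_mul, norm_mul, norm_pow, h3, Complex.norm_real]
    push_cast
    have hn : (0 : ℝ) ≤ n := n.cast_nonneg
    have hρn : 0 ≤ ρ ^ n := pow_nonneg hρ.1 n
    have h4 : ‖c n‖ ≤ |W| * ρ ^ n := (hc n).trans (mul_le_mul_of_nonneg_right (le_abs_self W) hρn)
    have h5 : ‖2 * W‖ = 2 * |W| := by simp
    calc ((n : ℝ) + 1 + 1) * ((n + 1) * ‖c n‖) ≤ (2 * (n + 1)) * ((n + 1) * (|W| * ρ ^ n)) := by
          gcongr
          linarith
      _ = _ := by rw [h5]; ring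
  have haT : IsTaylor a := fun r hr => by
    refine hs.of_nonneg_of_le (fun n => mul_nonneg (norm_nonneg _) (pow_nonneg hr.1 n)) fun n => ?_
    rw [mul_comm]
    refine mul_le_mul_of_nonneg_right ?_ (norm_nonneg _)
    have := pow_le_one₀ (n := n) hr.1 hr.2.le
    linarith [(n.cast_nonneg : (0 : ℝ) ≤ n)]
  have hco := coeff_ofCoeffs haT
  obtain ⟨x, hx⟩ := h.exists_of_summable (ofCoeffs_mem haT) (by rw [hco]; exact hs)
  refine ⟨x, ?_, fun z hz => ?_, ?_⟩
  · rw [hx, ← coeff_zero (ofCoeffs _), hco]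
    simp [ha]
  · rw [hx]
    refine (hasSum_deriv (ofCoeffs_mem haT) hz).congr_fun fun n => ?_
    rw [hco, ha1]
    ring
  · have h1 := h.hasSum_functional he Φ (x := x) (by rw [hx, hco]; exact hs)
    rw [hx, hco] at h1
    have h2 := (hasSum_nat_add_iff' 1).2 h1
    have h0 : a 0 = 0 := by simp [ha]
    simp only [Finset.range_one, Finset.sum_singleton, h0, zero_mul, sub_zero] at h2
    refine h2.congr_fun fun n => ?_
    rw [ha1]
    ring

end Test

/-- Functionals on the space defined by an area integral are represented by Bloch functions. -/
theorem BlochOne.exists_representation (h : w.Regular) : ∃ D : ℝ, ∀ e : ℕ → BlochOne w,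
    (∀ n, (BlochOne.toHol w (e n) : ℂ → ℂ) = monomial n) → ∀ Φ : BlochOne w →L[ℂ] ℂ,
      ∃ y, (∀ n, coeff (Bloch.toHol w y) n = Φ (e n)) ∧ ‖y‖ ≤ D * ‖Φ‖ := by
  have hX := isModel_blochOne h
  obtain ⟨C, hC, hK⟩ := h.lintegral_sqKernel_le
  obtain ⟨E, hE, hEn⟩ := hX.norm_monomials_le
  refine ⟨E + Real.pi⁻¹ * C, fun e he Φ => ?_⟩
  have hpi := Real.pi_pos
  have hT := hX.isTaylor_functional he Φ
  have hco := coeff_ofCoeffs hT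
  have hg := ofCoeffs_mem hT
  have hder : ∀ ζ ∈ disk, ‖deriv (ofCoeffs fun n => Φ (e n)) ζ‖ ≤
      (‖Φ‖ * (Real.pi⁻¹ * C)) * majorant w ζ := fun ζ hζ => by
    -- For `c n = ζ ^ n` the test function has derivative `sqKernel (ζ * z)`, and `Φ` takes on it
    -- the value `g'(ζ)`.
    obtain ⟨x, hx0, hxd, hxΦ⟩ := hX.exists_test he Φ (c := fun n => ζ ^ n) (W := 1) (ρ := ‖ζ‖)
      (norm_mem_Ico hζ) fun n => by rw [norm_pow, one_mul]
    have h1 : deriv (ofCoeffs fun n => Φ (e n)) ζ = Φ x := by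
      refine (hasSum_deriv hg hζ).unique ?_
      rw [hco]
      exact hxΦ
    have h2 : ∀ z ∈ disk, deriv (BlochOne.toHol w x).1 z = sqKernel (ζ * z) := fun z hz => by
      refine (hxd z hz).unique ?_
      refine (hasSum_sqKernel (mul_mem_disk (mem_disk.1 hζ).le hz)).congr_fun fun n => ?_
      rw [mul_pow]
      ring
    have hm := majorant_pos w hζ
    have h3 := BlochOne.norm_le x (B := C * majorant w ζ) (by positivity) (by
      refine le_trans (le_of_eq ?_) (hK ζ hζ)
      refine setLIntegral_congr_fun measurableSet_disk fun z hz => ?_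
      have := h2 z hz
      change deriv x z = _ at this
      rw [this])
    have hx0' : x 0 = 0 := hx0
    rw [hx0', norm_zero, zero_add] at h3
    rw [h1]
    refine (Φ.le_opNorm x).trans ((mul_le_mul_of_nonneg_left h3 (norm_nonneg Φ)).trans_eq ?_)
    ring
  obtain ⟨y, hy, hyn⟩ := Bloch.exists_of_norm_deriv_le hg hder
  refine ⟨y, fun n => by rw [hy, hco], hyn.trans ?_⟩
  rw [← coeff_zero (ofCoeffs _), hco]
  have h4 := (Φ.le_opNorm (e 0)).trans (mul_le_mul_of_nonneg_left (hEn e he 0) (norm_nonneg Φ))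
  push_cast at h4
  linarith

/-- Uniform bounds for the weighted integrals of dilations bound the integral itself. -/
theorem lintegral_le_of_dilate {g : ℂ → ℂ} (hg : g ∈ Hol) {B : ENNReal}
    (h : ∀ ρ ∈ Ioo (0 : ℝ) 1, ∫⁻ z in disk, ‖deriv g (ρ * z)‖ₑ * w.ennreal ‖z‖ ≤ B) :
    ∫⁻ z in disk, ‖deriv g z‖ₑ * w.ennreal ‖z‖ ≤ B := by
  have hwn : Measurable fun z : ℂ => w.ennreal ‖z‖ := w.measurable_ennreal.comp measurable_norm
  -- The `2` keeps `ρ 0` positive. Fatou's lemma along this sequence gives the bound.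
  set ρ : ℕ → ℝ := fun n => 1 - 1 / ((n : ℝ) + 2) with hρ
  have hρ1 : ∀ n, ρ n ∈ Ioo (0 : ℝ) 1 := fun n => by
    have hn : (0 : ℝ) ≤ n := n.cast_nonneg
    have h1 : (1 : ℝ) / (n + 2) < 1 := by rw [div_lt_one (by positivity)]; linarith
    have h2 : (0 : ℝ) < 1 / (n + 2) := by positivity
    exact ⟨by simp only [hρ]; linarith, by simp only [hρ]; linarith⟩
  have hρt : Tendsto ρ atTop (𝓝 1) := by
    have h1 : Tendsto (fun n : ℕ => 1 / (((n + 1 : ℕ) : ℝ) + 1)) atTop (𝓝 0) :=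
      tendsto_one_div_add_atTop_nhds_zero_nat.comp (tendsto_add_atTop_nat 1)
    have h2 := h1.const_sub 1
    rw [sub_zero] at h2
    refine h2.congr fun n => ?_
    simp only [hρ]
    push_cast
    ring
  have h1 : ∫⁻ z in disk, ‖deriv g z‖ₑ * w.ennreal ‖z‖ ≤
      ∫⁻ z in disk, liminf (fun n => ‖deriv g (ρ n * z)‖ₑ * w.ennreal ‖z‖) atTop := by
    refine setLIntegral_mono' measurableSet_disk fun z hz => ?_
    have hct : Tendsto (fun n => ‖deriv g (ρ n * z)‖ₑ * w.ennreal ‖z‖) atTop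
        (𝓝 (‖deriv g z‖ₑ * w.ennreal ‖z‖)) := by
      refine ENNReal.Tendsto.mul_const ?_ (Or.inr ENNReal.ofReal_ne_top)
      have hc : ContinuousAt (deriv g) z :=
        (Hol.continuousOn_deriv hg).continuousAt (isOpen_disk.mem_nhds hz)
      have h3 : Tendsto (fun n => (ρ n : ℂ) * z) atTop (𝓝 z) := by
        have := ((Complex.continuous_ofReal.tendsto 1).comp hρt).mul_const z
        simpa using this
      exact (continuous_enorm.tendsto _).comp (hc.tendsto.comp h3)
    rw [hct.liminf_eq]
  refine h1.trans ((lintegral_liminf_le fun n => ?_).trans ?_)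
  · exact ((measurable_deriv g).comp (measurable_const_mul _)).enorm.mul hwn
  · exact liminf_le_of_le ⟨0, by simp⟩ fun b hb => by
      obtain ⟨n, hn⟩ := hb.exists
      exact hn.trans (h _ (hρ1 n))

/-- Functionals on the little Bloch-type space are represented by functions with finite weighted
area integral. -/
theorem LittleBloch.exists_representation (h : w.Regular) : ∃ D : ℝ, ∀ e : ℕ → LittleBloch w,
    (∀ n, (LittleBloch.toHol w (e n) : ℂ → ℂ) = monomial n) → ∀ Φ : LittleBloch w →L[ℂ] ℂ,
      ∃ y, (∀ n, coeff (BlochOne.toHol w y) n = Φ (e n)) ∧ ‖y‖ ≤ D * ‖Φ‖ := by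
  have hX := isModel_littleBloch h
  obtain ⟨C, hC, hK⟩ := h.lintegral_sqKernel_le
  obtain ⟨C', hC', hmaj⟩ := h.majorant_le
  obtain ⟨E, hE, hEn⟩ := hX.norm_monomials_le
  obtain ⟨W, hW, hWb⟩ := h.exists_lintegral_le
  have hpi := Real.pi_pos
  refine ⟨E + Real.pi⁻¹ * (C * C'), fun e he Φ => ?_⟩
  have hT := hX.isTaylor_functional he Φ
  have hco := coeff_ofCoeffs hT
  have hg := ofCoeffs_mem hT
  set g := ofCoeffs fun n => Φ (e n)
  have hwn : Measurable fun z : ℂ => w.ennreal ‖z‖ := w.measurable_ennreal.comp measurable_norm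
  have hle : ∀ᵐ z ∂(volume.restrict disk), ‖z‖ ≤ 1 :=
    (ae_restrict_mem measurableSet_disk).mono fun z hz => (mem_disk.1 hz).le
  have key : ∀ ρ ∈ Ioo (0 : ℝ) 1, ∫⁻ z in disk, ‖deriv g (ρ * z)‖ₑ * w.ennreal ‖z‖ ≤
      ENNReal.ofReal (‖Φ‖ * (C * C')) := fun ρ hρ => by
    have hnρ : ‖(ρ : ℂ)‖ = ρ := by rw [Complex.norm_real, Real.norm_of_nonneg hρ.1.le]
    have hρd : (ρ : ℂ) ∈ disk := by rw [mem_disk, hnρ]; exact hρ.2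
    -- Chosen so that `deriv g (ρ * z) * u z` is the modulus times the weight, while `|u|` is at
    -- most the weight and hence within reach of the kernel estimate.
    set u : ℂ → ℂ := fun z => conjSign (deriv g (ρ * z)) * ((w.ennreal ‖z‖).toReal : ℂ) with hu
    have hum : Measurable u :=
      (measurable_conjSign.comp ((measurable_deriv g).comp (measurable_const_mul _))).mul
        (Complex.measurable_ofReal.comp hwn.ennreal_toReal)
    have hun : ∀ z, ‖u z‖ₑ ≤ w.ennreal ‖z‖ := fun z => by
      rw [hu, ← ofReal_norm, norm_mul, Complex.norm_real,
        Real.norm_of_nonneg ENNReal.toReal_nonneg]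
      refine (ENNReal.ofReal_le_ofReal (mul_le_of_le_one_left ENNReal.toReal_nonneg
        (norm_conjSign_le _))).trans_eq ?_
      exact ENNReal.ofReal_toReal ENNReal.ofReal_ne_top
    have hui : IntegrableOn u disk := by
      refine ⟨hum.aestronglyMeasurable, ?_⟩
      rw [hasFiniteIntegral_iff_enorm]
      exact ((lintegral_mono fun z => hun z).trans hWb).trans_lt ENNReal.ofReal_lt_top
    set m : ℕ → ℂ := fun n => ∫ z in disk, z ^ n * u z with hm
    have hmW : ∀ n, ‖m n‖ ≤ W := fun n => by
      have h1 : ‖m n‖ₑ ≤ ENNReal.ofReal W := by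
        refine (enorm_integral_le_lintegral_enorm _).trans (le_trans ?_ hWb)
        refine setLIntegral_mono' measurableSet_disk fun z hz => ?_
        rw [enorm_mul]
        refine le_trans (mul_le_of_le_one_left' ?_) (hun z)
        rw [← ofReal_norm, norm_pow, ← ENNReal.ofReal_one]
        exact ENNReal.ofReal_le_ofReal (pow_le_one₀ (norm_nonneg _) (mem_disk.1 hz).le)
      rw [← ofReal_norm] at h1
      exact (ENNReal.ofReal_le_ofReal_iff hW.le).1 h1
    -- The moments of `u` stand in for the powers of a point: `x'` becomes an average of kernels
    -- against `u`, and `Φ x` an average of `g'`. The factor `ρ ^ n` keeps `x` in the little space.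
    obtain ⟨x, hx0, hxd, hxΦ⟩ := hX.exists_test he Φ (c := fun n => (ρ : ℂ) ^ n * m n) (W := W)
      (ρ := ρ) ⟨hρ.1.le, hρ.2⟩ fun n => by
        rw [norm_mul, norm_pow, hnρ, mul_comm]
        exact mul_le_mul_of_nonneg_right (hmW n) (pow_nonneg hρ.1.le n)
    have hxn : ‖x‖ ≤ C * C' := by
      have h1 : ∀ ζ ∈ disk, ‖deriv (LittleBloch.toHol w x).1 ζ‖ ≤ C * C' * majorant w ζ :=
        fun ζ hζ => by
          have hζρ := mul_mem_disk (hnρ.trans_le hρ.2.le) hζ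
          have h2 : deriv (LittleBloch.toHol w x).1 ζ =
              ∫ z in disk, sqKernel ((ρ * ζ) * z) * u z := by
            refine (hxd ζ hζ).unique ?_
            refine (hasSum_integral_powerSeries (μ := volume.restrict disk) (φ := fun z => z)
              measurable_id.aestronglyMeasurable hle hui (fun z hz => hasSum_sqKernel hz)
              hζρ).congr_fun fun n => ?_
            rw [mul_pow]
            ring
          have hle2 : ‖(ρ : ℂ) * ζ‖ ≤ ‖ζ‖ := by
            rw [norm_mul, hnρ]
            exact mul_le_of_le_one_left (norm_nonneg _) hρ.2.le
          have hmζ := majorant_pos w hζ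
          have h3 : ‖deriv (LittleBloch.toHol w x).1 ζ‖ₑ ≤
              ENNReal.ofReal (C * C' * majorant w ζ) := by
            rw [h2]
            refine (enorm_integral_le_lintegral_enorm _).trans ?_
            refine le_trans (lintegral_mono fun z => ?_) ((hK _ hζρ).trans ?_)
            · rw [enorm_mul]
              exact mul_le_mul_right (hun z) _
            · refine ENNReal.ofReal_le_ofReal ?_
              rw [mul_assoc]
              -- The kernel estimate holds at `ρ ζ`; almost monotonicity of the majorant moves it to
              -- `ζ` with a constant independent of `ρ`.
              exact mul_le_mul_of_nonneg_left (hmaj _ hζρ ζ hζ hle2) hC.le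
          rw [← ofReal_norm] at h3
          exact (ENNReal.ofReal_le_ofReal_iff (by positivity)).1 h3
      have h4 := Bloch.norm_le (x : Bloch w) h1
      have hx0' : (x : Bloch w) 0 = 0 := hx0
      rwa [hx0', norm_zero, zero_add] at h4
    have hΦx : Φ x = ∫ z in disk, deriv g (ρ * z) * u z := by
      refine hxΦ.unique ?_
      refine (hasSum_integral_powerSeries (μ := volume.restrict disk) (φ := fun z => z)
        measurable_id.aestronglyMeasurable hle hui (fun z hz => hasSum_deriv hg hz)
        hρd).congr_fun fun n => ?_
      rw [hco]
      ring
    have hprod : ∀ z, deriv g (ρ * z) * u z =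
        ((‖deriv g (ρ * z)‖ * (w.ennreal ‖z‖).toReal : ℝ) : ℂ) := fun z => by
      rw [hu, ← mul_assoc, mul_conjSign]
      push_cast
      rfl
    simp_rw [hprod] at hΦx
    rw [integral_complex_ofReal] at hΦx
    obtain ⟨M, hM⟩ := exists_bound_deriv_dilate hg ⟨hρ.1.le, hρ.2⟩
    have hMb : ∀ z ∈ disk, ‖deriv g (ρ * z)‖ ≤ M := fun z hz => hM _ (by
      rw [norm_mul, hnρ]
      exact mul_le_of_le_one_right hρ.1.le (mem_disk.1 hz).le)
    have hint : IntegrableOn (fun z : ℂ => ‖deriv g (ρ * z)‖ * (w.ennreal ‖z‖).toReal) disk := by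
      have h1 : IntegrableOn (fun z : ℂ => deriv g (ρ * z) * u z) disk := by
        refine (hui.norm.const_mul M).mono'
          (((measurable_deriv g).comp (measurable_const_mul _)).mul hum).aestronglyMeasurable ?_
        filter_upwards [ae_restrict_mem measurableSet_disk] with z hz
        rw [norm_mul]
        exact mul_le_mul_of_nonneg_right (hMb z hz) (norm_nonneg _)
      refine (Integrable.re h1).congr (Eventually.of_forall fun z => ?_)
      simp only
      rw [hprod]
      exact Complex.ofReal_re _
    have h5 : ∫⁻ z in disk, ‖deriv g (ρ * z)‖ₑ * w.ennreal ‖z‖ =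
        ENNReal.ofReal (∫ z in disk, ‖deriv g (ρ * z)‖ * (w.ennreal ‖z‖).toReal) := by
      rw [ofReal_integral_eq_lintegral_ofReal hint (Eventually.of_forall fun z =>
        mul_nonneg (norm_nonneg _) ENNReal.toReal_nonneg)]
      refine lintegral_congr fun z => ?_
      rw [ENNReal.ofReal_mul (norm_nonneg _), ofReal_norm,
        ENNReal.ofReal_toReal (show w.ennreal ‖z‖ ≠ ⊤ from ENNReal.ofReal_ne_top)]
    rw [h5]
    refine ENNReal.ofReal_le_ofReal ?_
    have h6 := (Φ.le_opNorm x).trans (mul_le_mul_of_nonneg_left hxn (norm_nonneg Φ))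
    rw [hΦx, Complex.norm_real] at h6
    exact (le_abs_self _).trans h6
  obtain ⟨y, hy, hyn⟩ := BlochOne.exists_of_lintegral_le (w := w) hg (B := ‖Φ‖ * (C * C'))
    (by positivity) (lintegral_le_of_dilate hg key)
  refine ⟨y, fun n => by rw [hy, hco], hyn.trans ?_⟩
  rw [← coeff_zero g, hco]
  have h4 := (Φ.le_opNorm (e 0)).trans (mul_le_mul_of_nonneg_left (hEn e he 0) (norm_nonneg Φ))
  push_cast at h4
  linarith

/-! ### The duality theorems -/

/-- Serves both dualities: the little space carries the norm of the large one, and the Abel means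
are symmetric. The `π` undoes the normalization of area in the norm of `g`. -/
theorem norm_abelSum_bloch_le (h : w.Regular) : ∃ C : ℝ, ∀ (f : Bloch w) (g : BlochOne w),
    ∀ r ∈ Ioo (0 : ℝ) 1, ‖abelSum f g r‖ ≤ C * ‖f‖ * ‖g‖ := by
  obtain ⟨C, hC, h⟩ := h.norm_abelSum_le
  refine ⟨1 + C * Real.pi, fun f g r hr => ?_⟩
  have h1 := h f.2.1 g.2.1 (norm_nonneg f) (mul_nonneg Real.pi_pos.le (norm_nonneg g))
    (fun z hz => f.norm_deriv_le hz) g.lintegral_le r hr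
  have h2 := mul_le_mul f.norm_apply_zero_le g.norm_apply_zero_le (norm_nonneg _) (norm_nonneg f)
  refine h1.trans ((add_le_add_left h2 _).trans_eq ?_)
  ring

theorem littleBloch_duality (h : w.Regular) :
    ∃ e : BlochOne w ≃ₗ[ℂ] (LittleBloch w →L[ℂ] ℂ),
      (∀ (g : BlochOne w) (f : LittleBloch w), HasPairing f g (e g f)) ∧
      ∃ C : ℝ, 0 < C ∧ ∀ g, ‖g‖ / C ≤ ‖e g‖ ∧ ‖e g‖ ≤ C * ‖g‖ := by
  obtain ⟨C, hC⟩ := norm_abelSum_bloch_le h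
  obtain ⟨D, hD⟩ := LittleBloch.exists_representation h
  have hC' : ∀ (x : LittleBloch w) (y : BlochOne w), ∀ r ∈ Ioo (0 : ℝ) 1,
      ‖abelSum (LittleBloch.toHol w x) (BlochOne.toHol w y) r‖ ≤ C * ‖x‖ * ‖y‖ :=
    fun x y r hr => hC x y r hr
  have := IsModel.duality (isModel_littleBloch h) BlochOne.toHol_injective hC' hD
  exact this

theorem blochOne_duality (h : w.Regular) :
    ∃ e : Bloch w ≃ₗ[ℂ] (BlochOne w →L[ℂ] ℂ),
      (∀ (g : Bloch w) (f : BlochOne w), HasPairing f g (e g f)) ∧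
      ∃ C : ℝ, 0 < C ∧ ∀ g, ‖g‖ / C ≤ ‖e g‖ ∧ ‖e g‖ ≤ C * ‖g‖ := by
  obtain ⟨C, hC⟩ := norm_abelSum_bloch_le h
  obtain ⟨D, hD⟩ := BlochOne.exists_representation h
  have hC' : ∀ (x : BlochOne w) (y : Bloch w), ∀ r ∈ Ioo (0 : ℝ) 1,
      ‖abelSum (BlochOne.toHol w x) (Bloch.toHol w y) r‖ ≤ C * ‖x‖ * ‖y‖ := fun x y r hr => by
    rw [abelSum_comm, mul_right_comm]
    exact hC y x r hr
  have := IsModel.duality (isModel_blochOne h) Bloch.toHol_injective hC' hD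
  exact this

end LogBloch

end

theorem mainTheorem1 :
    (∀ α : ℝ,
      (∃ e : BlochOne (logWeight α) ≃ₗ[ℂ] (LittleBloch (logWeight α) →L[ℂ] ℂ),
        (∀ (g : BlochOne (logWeight α)) (f : LittleBloch (logWeight α)),
          HasPairing f g (e g f)) ∧
        ∃ C : ℝ, 0 < C ∧ ∀ g, ‖g‖ / C ≤ ‖e g‖ ∧ ‖e g‖ ≤ C * ‖g‖) ∧
      (∃ e : Bloch (logWeight α) ≃ₗ[ℂ] (BlochOne (logWeight α) →L[ℂ] ℂ),
        (∀ (g : Bloch (logWeight α)) (f : BlochOne (logWeight α)),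
          HasPairing f g (e g f)) ∧
        ∃ C : ℝ, 0 < C ∧ ∀ g, ‖g‖ / C ≤ ‖e g‖ ∧ ‖e g‖ ≤ C * ‖g‖)) ∧
    (∃ e : BlochOne loglogWeight ≃ₗ[ℂ] (LittleBloch loglogWeight →L[ℂ] ℂ),
      (∀ (g : BlochOne loglogWeight) (f : LittleBloch loglogWeight),
        HasPairing f g (e g f)) ∧
      ∃ C : ℝ, 0 < C ∧ ∀ g, ‖g‖ / C ≤ ‖e g‖ ∧ ‖e g‖ ≤ C * ‖g‖) ∧
    (∃ e : Bloch loglogWeight ≃ₗ[ℂ] (BlochOne loglogWeight →L[ℂ] ℂ),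
      (∀ (g : Bloch loglogWeight) (f : BlochOne loglogWeight),
        HasPairing f g (e g f)) ∧
      ∃ C : ℝ, 0 < C ∧ ∀ g, ‖g‖ / C ≤ ‖e g‖ ∧ ‖e g‖ ≤ C * ‖g‖) := by
  exact ⟨fun α =>
      ⟨littleBloch_duality (regular_logWeight α), blochOne_duality (regular_logWeight α)⟩,
    littleBloch_duality regular_loglogWeight, blochOne_duality regular_loglogWeight⟩
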